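/- **Model.** Consider an asynchronous message-passing system of $n$ nodes joined by reliable FIFO channels (including one from each node to itself), in which at most $f$ nodes crash, where $2f<n$. A crash may occur at any point, also in the middle of sending a message to several nodes. Nodes are event-driven and have no clocks, local computation takes no time, and each node has at most one pending command. An execution has message delays at most $D>0$ if every message, also one whose sender crashes after sending it, is received within time $D$ of being sent unless its receiver has crashed by then. An *update-query state machine* has a set of states with an initial state, updates $u:S\to S$ any two of which commute, and queries, each of which returns a function of the state without changing it. An implementation is *linearizable* if in every execution all commands can be arranged in one sequence that respects the real-time order (a command that completes before another one is invoked precedes it), and in which every completed query returns the answer of the machine in the state produced by the updates before it, and every completed update returns an acknowledgement. **AC-ASO.** Every node $i$ keeps sets $V[j]$ of timestamped values received from $j$ ($V[i]$ contains all values that $i$ has received or written) and the largest tag $maxTag$ it has received in writeTag or echoTag messages. For a set $H$ of values, $H^{\le r}$ is the set of those with tag at most $r$. * A value received for the first time is forwarded to all. A tag received in a writeTag message is echoed to all and acknowledged. A readTag request is answered with $maxTag$. When $(\mathrm{goodLA},r)$ arrives from $j$, the node sets $D[j]:=V[j]^{\le r}$. A node waits for $n-f$ acknowledgements of each of its readTag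 and writeTag requests; requests are numbered, so that late acknowledgements are not confused. * $\mathrm{Lattice}(r)$: write the tag $r$ to $n-f$ nodes; wait until at least $n-f$ nodes $j$ satisfy $V[j]^{\le r}=V[i]^{\le r}$; if then $maxTag\le r$, send $(\mathrm{goodLA},r)$ to all and succeed with the view $V[i]^{\le r}$; otherwise fail. * $\mathrm{LatticeRenewal}(r)$: run $\mathrm{Lattice}(r)$; after each of the first two failures set $r:=maxTag$ and run $\mathrm{Lattice}(r)$ again; a success returns its view; after the third failure, with tag $r$, wait until $(\mathrm{goodLA},r)$ has been received from some $j$ and return $D[j]$. * $\mathrm{Update}(v)$ at $i$: read the largest tag $r$ from $n-f$ nodes; send $v$ with timestamp $(r+1,i)$ to all; run $\mathrm{Lattice}(r)$, then $\mathrm{LatticeRenewal}(\max\{r+1,maxTag\})$; acknowledge. * $\mathrm{Scan}$ at $i$: read the largest tag $r$ from $n-f$ nodes, run $\mathrm{LatticeRenewal}(r)$, and return a result computed from the view obtained. **Theorem.** There is a linearizable implementation of update-query state machines with commuting updates in which each command takes $O(\sqrt k)$ message delays, where $k$ is the actual number of crashes ($O(1)$ message delays if $k=0$), and the message-size overhead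 is $O(1)$. It is obtained from AC-ASO by letting Scan return its whole view: an update command $u$ is executed as $\mathrm{Update}(u)$, and a query is answered by performing a Scan, applying to the initial state all update commands in the view, and evaluating the query in the resulting state. Precisely, there are constants $C$ and $b$ such that for all $n$ and $f$ with $2f<n$, every update-query state machine, every $D>0$, and every finite execution of this implementation with at most $f$ crashes and message delays at most $D$: 1. the execution is linearizable; 2. if $k$ nodes have crashed, then no command at a node that has not crashed has been pending for longer than $C(\sqrt k+1)D$; 3. besides its kind (one of seven), each message consists of at most one update command and at most $b$ natural numbers, each at most $b\,(n+m)$, where $m$ is the number of commands invoked so far. -/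

import Mathlib

/-!
# Update-query state machines over asynchronous crash-prone message passing

Part 1: sequential objects, histories and linearizability.
Part 2: event-driven protocols and their timed executions in an asynchronous message-passing
system with reliable FIFO channels and crash failures.
Part 3: update-query state machines.
Part 4: the snapshot algorithm AC-ASO, and the state machine implementation obtained from it.
-/

/-! ## Part 1: linearizability -/

/-- A deterministic sequential object with operations in `In` and replies in `Out`. -/
structure SeqObject (S In Out : Type*) where
  init : S
  step : In → S → S × Out

/-- The state of the object after the operations of a list, applied from left to right. -/
def SeqObject.run {S In Out : Type*} (O : SeqObject S In Out) (l : List In) : S :=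
  l.foldl (fun s a => (O.step a s).1) O.init

/-- An event at the interface between the clients and the system of `n` nodes. -/
inductive Event (n : ℕ) (In Out : Type*) where
  | inv (p : Fin n) (a : In)
  | res (p : Fin n) (b : Out)

/-- The node at which an event takes place. -/
def Event.node {n : ℕ} {In Out : Type*} : Event n In Out → Fin n
  | .inv p _ => p
  | .res p _ => p

/-- The operation invoked by an event, if the event is an invocation. -/
def Event.input {n : ℕ} {In Out : Type*} : Event n In Out → Option In
  | .inv _ a => some a
  | .res _ _ => none

/-- The operations of a history `H` (in chronological order) are named by the positions of their
invocations in `H`. -/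
def IsInvocation {n : ℕ} {In Out : Type*} (H : List (Event n In Out)) (i : ℕ) : Prop :=
  ∃ p a, H[i]? = some (Event.inv p a)

/-- The operation invoked at position `i` of `H` completes at position `j`, with reply `b`: this is
the next event of the same node. -/
def CompletesAt {n : ℕ} {In Out : Type*} (H : List (Event n In Out)) (i j : ℕ) (b : Out) : Prop :=
  i < j ∧ ∃ p a, H[i]? = some (Event.inv p a) ∧ H[j]? = some (Event.res p b) ∧
    ∀ m e, i < m → m < j → H[m]? = some e → e.node ≠ p

/-- Linearizability of a finite history: all operations can be arranged in a sequence `σ` that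
respects the real-time order and in which every completed operation has the reply that the
sequential object gives. Since a sequential object answers every operation in every state,
operations that are still pending may be taken to belong to `σ`; their replies are arbitrary. -/
def Linearizable {n : ℕ} {S In Out : Type*} (O : SeqObject S In Out)
    (H : List (Event n In Out)) : Prop :=
  (∀ j p b, H[j]? = some (Event.res p b) → ∃ i, CompletesAt H i j b) ∧
  ∃ σ : List ℕ, σ.Nodup ∧ (∀ i, i ∈ σ ↔ IsInvocation H i) ∧
    (∀ i j b i', CompletesAt H i j b → j < i' → IsInvocation H i' → [i, i'].Sublist σ) ∧
    (∀ pre i post, σ = pre ++ i :: post → ∀ p a j b, H[i]? = some (Event.inv p a) →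
      CompletesAt H i j b →
        b = (O.step a (O.run (pre.filterMap fun m => H[m]?.bind Event.input))).2)

/-! ## Part 2: message-passing protocols and their executions -/

/-- What a node does in one atomic step: it takes a new local state, executes a list of `send`
commands in order, each of which sends one message to a set of nodes, and possibly replies to
its client in the end. -/
structure Reaction (n : ℕ) (Out Msg L : Type*) where
  state : L
  sends : List (Finset (Fin n) × Msg)
  reply : Option Out

/-- An event-driven protocol for nodes with local states in `L`. Nodes have no clocks: a reaction
depends on the node, its local state, and the operation invoked or the message received. -/
structure Protocol (n : ℕ) (In Out Msg L : Type*) where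
  init : Fin n → L
  invoke : Fin n → L → In → Reaction n Out Msg L
  receive : Fin n → L → Fin n → Msg → Reaction n Out Msg L

/-- A global state of the system. -/
structure Config (n : ℕ) (In Out Msg L : Type*) where
  /-- the current time, which the nodes cannot read -/
  now : ℝ
  /-- the local states -/
  loc : Fin n → L
  /-- the nodes that have crashed so far -/
  crashed : Finset (Fin n)
  /-- `chan q p` holds the messages in transit from `q` to `p`, oldest first, each with the time
  at which it was sent -/
  chan : Fin n → Fin n → List (ℝ × Msg)
  /-- the invocation time of the pending operation of each node, if there is one -/
  pending : Fin n → Option ℝ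
  /-- the invocations and replies so far, in chronological order -/
  history : List (Event n In Out)

section Executions

variable {n : ℕ} {In Out Msg L : Type*}

def Config.initial (P : Protocol n In Out Msg L) : Config n In Out Msg L where
  now := 0
  loc := P.init
  crashed := ∅
  chan := fun _ _ => []
  pending := fun _ => none
  history := []

/-- Node `p` executes a list of `send` commands at the current time. -/
def Config.send (c : Config n In Out Msg L) (p : Fin n)
    (l : List (Finset (Fin n) × Msg)) : Config n In Out Msg L :=
  { c with
    chan := fun q r =>
      if q = p then c.chan q r ++ (l.filter fun x => r ∈ x.1).map fun x => (c.now, x.2)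
      else c.chan q r }

/-- The client of `p` invokes the operation `a`. -/
def Config.begin (c : Config n In Out Msg L) (p : Fin n) (a : In) : Config n In Out Msg L :=
  { c with
    pending := Function.update c.pending p (some c.now)
    history := c.history ++ [Event.inv p a] }

/-- The oldest message in transit from `q` to `p` is taken from the channel. -/
def Config.pop (c : Config n In Out Msg L) (q p : Fin n) : Config n In Out Msg L :=
  { c with chan := Function.update c.chan q (Function.update (c.chan q) p (c.chan q p).tail) }

/-- The client of `p` receives the reply `b`. -/
def Config.finish (c : Config n In Out Msg L) (p : Fin n) (b : Out) : Config n In Out Msg L :=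
  { c with
    pending := Function.update c.pending p none
    history := c.history ++ [Event.res p b] }

/-- Node `p` completes a reaction. -/
def Config.complete (c : Config n In Out Msg L) (p : Fin n) (r : Reaction n Out Msg L) :
    Config n In Out Msg L :=
  let c' := { c.send p r.sends with loc := Function.update c.loc p r.state }
  match r.reply with
  | none => c'
  | some b => c'.finish p b

/-- Node `p` crashes after having executed only the `send` commands `l`. -/
def Config.fail (c : Config n In Out Msg L) (p : Fin n)
    (l : List (Finset (Fin n) × Msg)) : Config n In Out Msg L :=
  { c.send p l with crashed := insert p c.crashed }

/-- `Interrupted l l'`: a node that crashes while executing the `send` commands `l` has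
effectively executed `l'`: some of the commands in full, the next one possibly towards only some
of its destinations, and none of the others. -/
inductive Interrupted : List (Finset (Fin n) × Msg) → List (Finset (Fin n) × Msg) → Prop
  | none (l) : Interrupted l []
  | part (d d' : Finset (Fin n)) (m : Msg) (l) : d' ⊆ d → Interrupted ((d, m) :: l) [(d', m)]
  | next (x : Finset (Fin n) × Msg) (l l') : Interrupted l l' → Interrupted (x :: l) (x :: l')

/-- The steps of a system in which at most `f` nodes crash and no message takes longer than `D`:
time does not pass beyond `s + D` while a message sent at time `s` is in transit to a node that
has not crashed (whether or not its sender has crashed since). Otherwise the order of events is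
arbitrary, and reactions take no time. A node's client invokes an operation only if none is
pending at the node. A node may crash at any point, also in the middle of a reaction; then its
client gets no reply. -/
inductive Step (P : Protocol n In Out Msg L) (f : ℕ) (D : ℝ) :
    Config n In Out Msg L → Config n In Out Msg L → Prop
  | tick (c : Config n In Out Msg L) (t : ℝ) : c.now ≤ t →
      (∀ q p, p ∉ c.crashed → ∀ x ∈ c.chan q p, t ≤ x.1 + D) →
      Step P f D c { c with now := t }
  | invoke (c : Config n In Out Msg L) (p : Fin n) (a : In) :
      p ∉ c.crashed → c.pending p = none →
      Step P f D c ((c.begin p a).complete p (P.invoke p (c.loc p) a))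
  | deliver (c : Config n In Out Msg L) (q p : Fin n) (s : ℝ) (m : Msg) :
      p ∉ c.crashed → (c.chan q p).head? = some (s, m) →
      Step P f D c ((c.pop q p).complete p (P.receive p (c.loc p) q m))
  | crash (c : Config n In Out Msg L) (p : Fin n) :
      p ∉ c.crashed → c.crashed.card < f → Step P f D c (c.fail p [])
  | crashInvoke (c : Config n In Out Msg L) (p : Fin n) (a : In)
      (l : List (Finset (Fin n) × Msg)) :
      p ∉ c.crashed → c.crashed.card < f → c.pending p = none →
      Interrupted (P.invoke p (c.loc p) a).sends l →
      Step P f D c ((c.begin p a).fail p l)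
  | crashDeliver (c : Config n In Out Msg L) (q p : Fin n) (s : ℝ) (m : Msg)
      (l : List (Finset (Fin n) × Msg)) :
      p ∉ c.crashed → c.crashed.card < f → (c.chan q p).head? = some (s, m) →
      Interrupted (P.receive p (c.loc p) q m).sends l →
      Step P f D c ((c.pop q p).fail p l)

/-- The configurations at the end of the finite executions with at most `f` crashes and with
message delays at most `D`. -/
def Reachable (P : Protocol n In Out Msg L) (f : ℕ) (D : ℝ) (c : Config n In Out Msg L) : Prop :=
  Relation.ReflTransGen (Step P f D) (Config.initial P) c

/-- The number of operations invoked so far. -/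
def Config.invocations (c : Config n In Out Msg L) : ℕ :=
  (c.history.filterMap Event.input).length

end Executions

/-! ## Part 3: update-query state machines -/

/-- A state machine with updates in `U`, any two of which commute, and queries in `Q` with answers
in `R`, which do not change the state. -/
structure UQMachine (S U Q R : Type*) where
  init : S
  apply : U → S → S
  ask : Q → S → R
  comm : ∀ u v s, apply u (apply v s) = apply v (apply u s)

inductive Command (U Q : Type*) where
  | update (u : U)
  | query (q : Q)

inductive Reply (R : Type*) where
  | ok
  | answer (r : R)

/-- The sequential object that an update-query state machine specifies. -/
def UQMachine.object {S U Q R : Type*} (M : UQMachine S U Q R) :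
    SeqObject S (Command U Q) (Reply R) where
  init := M.init
  step := fun
    | .update u, s => (M.apply u s, .ok)
    | .query q, s => (s, .answer (M.ask q s))

/-- The state after a multiset of updates, in whatever order. -/
def UQMachine.applyAll {S U Q R : Type*} (M : UQMachine S U Q R) (s : Multiset U) : S :=
  haveI : LeftCommutative M.apply := ⟨M.comm⟩
  s.foldr M.apply M.init

/-! ## Part 4: AC-ASO -/

/-- A value together with its timestamp: a tag and the node that writes the value. -/
structure Stamped (n : ℕ) (U : Type*) where
  val : U
  tag : ℕ
  owner : Fin n

/-- The messages. The number `req` in a request is repeated in its acknowledgements, so that a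
node can tell them from late acknowledgements of its earlier requests. -/
inductive Msg (n : ℕ) (U : Type*) where
  | value (x : Stamped n U)
  | readTag (req : ℕ)
  | readAck (req tag : ℕ)
  | writeTag (req tag : ℕ)
  | writeAck (req tag : ℕ)
  | echoTag (tag : ℕ)
  | goodLA (tag : ℕ)

/-- The values written by clients (here: update commands) that a message carries. -/
def Msg.commands {n : ℕ} {U : Type*} : Msg n U → List U
  | .value x => [x.val]
  | _ => []

/-- The numbers that a message carries, besides its kind. -/
def Msg.numbers {n : ℕ} {U : Type*} : Msg n U → List ℕ
  | .value x => [x.tag, x.owner]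
  | .readTag req => [req]
  | .readAck req tag => [req, tag]
  | .writeTag req tag => [req, tag]
  | .writeAck req tag => [req, tag]
  | .echoTag tag => [tag]
  | .goodLA tag => [tag]

/-- The point that the client thread of a node has reached. The number `ph` counts the lattice
operations of an operation: `0` is the one that an update performs before `LatticeRenewal`, and
`1, 2, 3` are those of `LatticeRenewal`. -/
inductive Phase (A : Type*) where
  /-- no operation is pending -/
  | idle
  /-- in `readTag()`, waiting for acknowledgements -/
  | reading (a : A)
  /-- in `Lattice(r)`, in `writeTag(r)`, waiting for acknowledgements -/
  | writing (a : A) (ph r : ℕ)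
  /-- in `Lattice(r)`, waiting for an equivalence quorum -/
  | agreeing (a : A) (ph r : ℕ)
  /-- at the end of `LatticeRenewal`, waiting for a message `goodLA r` -/
  | borrowing (a : A) (r : ℕ)

/-- The local state of a node. -/
structure AsoState (n : ℕ) (U A : Type*) where
  /-- `V j` is the set of values received from `j`; for the node `i` itself, `V i` is the set of
  all values that it has received or written -/
  V : Fin n → Finset (Stamped n U)
  /-- the largest tag received in `writeTag` and `echoTag` messages -/
  maxTag : ℕ
  /-- the views borrowed from good lattice operations of other nodes -/
  D : Fin n → Finset (Stamped n U)
  /-- the tags `r` for which a message `goodLA r` has been received from `j` -/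
  good : Fin n → Finset ℕ
  /-- the number of the current request -/
  req : ℕ
  /-- the nodes that have acknowledged the current request -/
  acks : Finset (Fin n)
  /-- the largest tag in the acknowledgements of the current `readTag` request -/
  ackTag : ℕ
  phase : Phase A

namespace AcAso

open Classical in
/-- The values with tag at most `r` in a set of values. -/
noncomputable def upTo {n : ℕ} {U : Type*} (r : ℕ) (H : Finset (Stamped n U)) :
    Finset (Stamped n U) :=
  H.filter fun x => x.tag ≤ r

/-- The predicate `EQ(V, i)`: some quorum of at least `n - f` nodes `j` has `V j = V i`. -/
def EQ {n : ℕ} {T : Type*} (f : ℕ) (V : Fin n → T) (i : Fin n) : Prop :=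
  ∃ W : Finset (Fin n), n - f ≤ W.card ∧ ∀ j ∈ W, V j = V i

section Code

variable {n : ℕ} {U Q B : Type*}

/-- The reaction type of the algorithm; replies to clients are in `B`. -/
abbrev React (n : ℕ) (U Q B : Type*) :=
  Reaction n B (Msg n U) (AsoState n U (Command U Q))

/-- Add `send m to all` at the end of a reaction. -/
def sendAll (m : Msg n U) (e : React n U Q B) : React n U Q B :=
  { e with sends := e.sends ++ [(Finset.univ, m)] }

/-- Change the local state in a reaction. -/
def modify (g : AsoState n U (Command U Q) → AsoState n U (Command U Q)) (e : React n U Q B) :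
    React n U Q B :=
  { e with state := g e.state }

/-- Enter `Lattice(r)`: start `writeTag(r)`. -/
def startLattice (a : Command U Q) (ph r : ℕ) (e : React n U Q B) : React n U Q B :=
  sendAll (.writeTag (e.state.req + 1) r) <|
    modify (fun s => { s with req := s.req + 1, acks := ∅, phase := .writing a ph r }) e

/-- The operation `a` ends with the view `H`: an update is acknowledged, and a scan, which serves
the query `q`, returns `out q H`. -/
def finishOp (out : Q → Finset (Stamped n U) → B) (ack : B) (a : Command U Q)
    (H : Finset (Stamped n U)) (e : React n U Q B) : React n U Q B :=
  { modify (fun s => { s with phase := .idle }) e with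
    reply := some (match a with
      | .update _ => ack
      | .query q => out q H) }

open Classical in
/-- The client thread after `readTag()`: a scan enters `LatticeRenewal`; an update gives its value
the timestamp `(r + 1, i)`, sends it to all, and enters its phase 0 lattice operation. -/
noncomputable def afterRead (f : ℕ) (i : Fin n) (e : React n U Q B) : React n U Q B :=
  match e.state.phase with
  | .reading a =>
    if n - f ≤ e.state.acks.card then
      let r := e.state.ackTag
      match a with
      | .update u =>
        let x : Stamped n U := ⟨u, r + 1, i⟩
        startLattice a 0 r <| sendAll (.value x) <|
          modify (fun s => { s with V := Function.update s.V i (insert x (s.V i)) }) e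
      | .query _ => startLattice a 1 r e
    else e
  | _ => e

/-- The client thread after `writeTag(r)` in `Lattice(r)`. -/
def afterWrite (f : ℕ) (e : React n U Q B) : React n U Q B :=
  match e.state.phase with
  | .writing a ph r =>
    if n - f ≤ e.state.acks.card then modify (fun s => { s with phase := .agreeing a ph r }) e
    else e
  | _ => e

open Classical in
/-- The end of `Lattice(r)`, as soon as there is an equivalence quorum. The lattice operation is
good if no tag larger than `r` has been seen. After phase 0, an update enters `LatticeRenewal`.
In `LatticeRenewal`, a good lattice operation ends the operation with its view; otherwise the
next lattice operation is entered, or, after the third one, the node waits for a borrowed view. -/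
noncomputable def afterQuorum (f : ℕ) (out : Q → Finset (Stamped n U) → B) (ack : B) (i : Fin n)
    (e : React n U Q B) : React n U Q B :=
  match e.state.phase with
  | .agreeing a ph r =>
    if EQ f (fun j => upTo r (e.state.V j)) i then
      if e.state.maxTag ≤ r then
        let e' := sendAll (.goodLA r) e
        if ph = 0 then startLattice a 1 (max (r + 1) e.state.maxTag) e'
        else finishOp out ack a (upTo r (e.state.V i)) e'
      else if ph = 0 then startLattice a 1 (max (r + 1) e.state.maxTag) e
      else if ph = 3 then modify (fun s => { s with phase := .borrowing a r }) e
      else startLattice a (ph + 1) e.state.maxTag e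
    else e
  | _ => e

open Classical in
/-- The end of `LatticeRenewal` with a borrowed view. -/
noncomputable def afterGood (out : Q → Finset (Stamped n U) → B) (ack : B)
    (e : React n U Q B) : React n U Q B :=
  match e.state.phase with
  | .borrowing a r =>
    if h : ∃ j, r ∈ e.state.good j then finishOp out ack a (e.state.D h.choose) e else e
  | _ => e

/-- The client thread proceeds until it has to wait. -/
noncomputable def advance (f : ℕ) (out : Q → Finset (Stamped n U) → B) (ack : B) (i : Fin n)
    (e : React n U Q B) : React n U Q B :=
  afterGood out ack (afterQuorum f out ack i (afterWrite f (afterRead f i e)))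

/-- An operation is invoked: start `readTag()`. -/
def start (s : AsoState n U (Command U Q)) (a : Command U Q) : React n U Q B where
  state := { s with req := s.req + 1, acks := ∅, ackTag := 0, phase := .reading a }
  sends := [(Finset.univ, .readTag (s.req + 1))]
  reply := none

open Classical in
/-- The message handlers of node `i`, for a message from node `j`. -/
noncomputable def handle (i : Fin n) (s : AsoState n U (Command U Q)) (j : Fin n) :
    Msg n U → React n U Q B
  | .value x =>
    { state :=
        let V' := Function.update s.V j (insert x (s.V j))
        { s with V := Function.update V' i (insert x (V' i)) }
      sends := if x ∈ s.V i then [] else [(Finset.univ, .value x)]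
      reply := none }
  | .readTag k => { state := s, sends := [({j}, .readAck k s.maxTag)], reply := none }
  | .readAck k t =>
    { state :=
        if k = s.req then { s with acks := insert j s.acks, ackTag := max s.ackTag t } else s
      sends := []
      reply := none }
  | .writeTag k t =>
    { state := { s with maxTag := max s.maxTag t }
      sends := [(Finset.univ, .echoTag t), ({j}, .writeAck k t)]
      reply := none }
  | .writeAck k _ =>
    { state := if k = s.req then { s with acks := insert j s.acks } else s
      sends := []
      reply := none }
  | .echoTag t => { state := { s with maxTag := max s.maxTag t }, sends := [], reply := none }
  | .goodLA r =>
    { state :=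
        { s with
          D := Function.update s.D j (upTo r (s.V j))
          good := Function.update s.good j (insert r (s.good j)) }
      sends := []
      reply := none }

end Code

/-- The algorithm AC-ASO for `n` nodes of which at most `f` crash, in which an update is
acknowledged by `ack`, and a scan with argument `q` that has obtained the view `H` returns
`out q H`. (The atomic snapshot object is the case in which `out q H` extracts from `H` the latest
value of each node.) -/
noncomputable def protocol {U Q B : Type*} (n f : ℕ) (out : Q → Finset (Stamped n U) → B)
    (ack : B) : Protocol n (Command U Q) B (Msg n U) (AsoState n U (Command U Q)) where
  init := fun _ =>
    { V := fun _ => ∅, maxTag := 0, D := fun _ => ∅, good := fun _ => ∅, req := 0, acks := ∅,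
      ackTag := 0, phase := .idle }
  invoke := fun i s a => advance f out ack i (start s a)
  receive := fun i s j m => advance f out ack i (handle i s j m)

end AcAso

/-- The implementation of update-query state machines: an update command is written by an update of
AC-ASO; a query command performs a scan that returns its whole view, a set of update commands,
applies these commands, and answers the query in the resulting state. -/
noncomputable def uqProtocol {S U Q R : Type*} (n f : ℕ) (M : UQMachine S U Q R) :
    Protocol n (Command U Q) (Reply R) (Msg n U) (AsoState n U (Command U Q)) :=
  AcAso.protocol n f (fun q H => .answer (M.ask q (M.applyAll (H.val.map Stamped.val)))) .ok

/-! Reactions are cut into small steps (`Micro`), and configurations are enriched by auxiliary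
records of what each node has sent and received, and of which operation wrote which value (`Sys`).
`represents_step` shows that this refinement simulates the protocol, including crashes in the middle
of a reaction; all further arguments concern sequences of refined states.

Safety rests on FIFO order and quorum intersection. What a node has received from `k` stems from a
prefix of the log of `k`, and a node logs a value in the step in which it first learns it. So a
received set `V k` is the set of values in some prefix of the log of `k` (`exists_prefix_V`).
Prefixes of one log are comparable, and two sets of `n - f` nodes meet because `2 * f < n`. Hence
views of lattice operations with the same tag are comparable (`lat_comparable`). If `r < r'`, a good
operation with tag `r` relied on prefixes without an echo of `r'`, whereas an operation with tag
`r'` waited for such echoes; at a common node the second prefix is longer, so the good view is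
contained in the other one (`goodLat_subset`). Good views therefore form a chain, and a lattice
operation that starts after another one has ended inherits its values (`lat_mem`,
`lat_mem_of_later`).

Tags only grow from `r` to `r + 1`, when a phase 0 lattice operation succeeds, and the announcement
of that success is sent before the new tag. So when a tag is in use, a good operation with each
smaller tag has been announced (`goodLA_sent`), which makes borrowing terminate, and a quorum has
seen the tag just below it (`near_of_sysTag`). If an operation has read `ρ`, its third failure has a
tag of at least `ρ + 2`; a lattice operation with so large a tag cannot have started before the
reading did, so the borrowed view is recent enough (`outcome_of_reply`).

For the linearization, a completed query with view `A` gets the key `2 * |A| + 1`, and an update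
gets `2 * |H|` for the smallest good view `H` that contains its value. As good views form a chain,
the updates before a query are exactly those in its view, and updates commute, so their order does
not matter.

For the time bound, a node that waits for an equivalence quorum must receive a new value in each
interval of length `2 * D` (`exists_new`). Only values written early in the wait matter, and every
node that passes one on without crashing delivers it to the waiting node within `D`. So the value
that arrives in the `m`-th interval has travelled along a path of about `2 * m` nodes that crash,
and different values need different crashes. The total number of crashes is at least `∑ (2 * m - 1)
= M ^ 2` after `M` intervals (`sq_le_card`), so the wait is `O(√k)` delays. Every other wait is
`O(1)` delays, and an operation has at most four lattice operations.

The numbers in messages are bounded by potential arguments: each operation makes at most five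
requests and raises the largest tag at most once (`req_add_le`, `sysTag_add_le`). -/

namespace AcAso

/-! ### Small steps -/

section Micro

variable {n : ℕ} {U Q B : Type*}

/-- What triggers a small step of a node. -/
inductive Input (n : ℕ) (U Q B : Type*) where
  | invoke (a : Command U Q)
  | receive (q : Fin n) (m : Msg n U)
  | write (x : Stamped n U)
  | internal
  | reply (b : B)

/-- The state at the beginning of `Lattice(r)`. -/
def enter (s : AsoState n U (Command U Q)) (a : Command U Q) (ph r : ℕ) :
    AsoState n U (Command U Q) :=
  { s with req := s.req + 1, acks := ∅, phase := .writing a ph r }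

open Classical in
/-- The node `i` adds `x` to its own values. -/
noncomputable def addOwn (i : Fin n) (x : Stamped n U) (s : AsoState n U (Command U Q)) :
    AsoState n U (Command U Q) :=
  { s with V := Function.update s.V i (insert x (s.V i)) }

/-- The reply to the operation `a` when it ends with the view `H`. -/
def result (out : Q → Finset (Stamped n U) → B) (ack : B) (a : Command U Q)
    (H : Finset (Stamped n U)) : B :=
  match a with
  | .update _ => ack
  | .query q => out q H

/-- The small steps of node `i`: the message handlers, and the moves of the client thread between
two points where it may have to wait. -/
inductive Micro (f : ℕ) (out : Q → Finset (Stamped n U) → B) (ack : B) (i : Fin n) :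
    Input n U Q B → AsoState n U (Command U Q) → List (Finset (Fin n) × Msg n U) →
      AsoState n U (Command U Q) → Prop
  | start (s a) : Micro f out ack i (.invoke a) s [(Finset.univ, .readTag (s.req + 1))]
      { s with req := s.req + 1, acks := ∅, ackTag := 0, phase := .reading a }
  | deliver (s q m) : Micro f out ack i (.receive q m) s
      (handle (Q := Q) (B := B) i s q m).sends (handle (Q := Q) (B := B) i s q m).state
  | readUpdate (s u) : s.phase = .reading (.update u) → n - f ≤ s.acks.card →
      Micro f out ack i (.write ⟨u, s.ackTag + 1, i⟩) s
        [(Finset.univ, .value ⟨u, s.ackTag + 1, i⟩),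
          (Finset.univ, .writeTag (s.req + 1) s.ackTag)]
        (enter (addOwn i ⟨u, s.ackTag + 1, i⟩ s) (.update u) 0 s.ackTag)
  | readQuery (s q) : s.phase = .reading (.query q) → n - f ≤ s.acks.card →
      Micro f out ack i .internal s [(Finset.univ, .writeTag (s.req + 1) s.ackTag)]
        (enter s (.query q) 1 s.ackTag)
  | written (s a ph r) : s.phase = .writing a ph r → n - f ≤ s.acks.card →
      Micro f out ack i .internal s [] { s with phase := .agreeing a ph r }
  | goodFirst (s a r) : s.phase = .agreeing a 0 r → EQ f (fun j => upTo r (s.V j)) i →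
      s.maxTag ≤ r →
      Micro f out ack i .internal s
        [(Finset.univ, .goodLA r), (Finset.univ, .writeTag (s.req + 1) (r + 1))]
        (enter s a 1 (r + 1))
  | good (s a ph r) : s.phase = .agreeing a ph r → ph ≠ 0 → EQ f (fun j => upTo r (s.V j)) i →
      s.maxTag ≤ r →
      Micro f out ack i (.reply (result out ack a (upTo r (s.V i)))) s
        [(Finset.univ, .goodLA r)] { s with phase := .idle }
  | retry (s a ph r) : s.phase = .agreeing a ph r → EQ f (fun j => upTo r (s.V j)) i →
      r < s.maxTag → ph ≠ 3 →
      Micro f out ack i .internal s [(Finset.univ, .writeTag (s.req + 1) s.maxTag)]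
        (enter s a (ph + 1) s.maxTag)
  | borrow (s a r) : s.phase = .agreeing a 3 r → EQ f (fun j => upTo r (s.V j)) i →
      r < s.maxTag →
      Micro f out ack i .internal s [] { s with phase := .borrowing a r }
  | borrowed (s a r j) : s.phase = .borrowing a r → r ∈ s.good j →
      Micro f out ack i (.reply (result out ack a (s.D j))) s [] { s with phase := .idle }
  | skip (s) : Micro f out ack i .internal s [] s

/-- The client thread has to wait. -/
def Quiet (f : ℕ) (i : Fin n) (s : AsoState n U (Command U Q)) : Prop :=
  match s.phase with
  | .idle => True
  | .reading _ => s.acks.card < n - f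
  | .writing _ _ _ => s.acks.card < n - f
  | .agreeing _ _ r => ¬ EQ f (fun j => upTo r (s.V j)) i
  | .borrowing _ r => ∀ j, r ∉ s.good j

/-- A sequence of moves of the client thread, with all messages sent and the final reply. -/
inductive Chain (f : ℕ) (out : Q → Finset (Stamped n U) → B) (ack : B) (i : Fin n) :
    AsoState n U (Command U Q) → List (Finset (Fin n) × Msg n U) → Option B →
      AsoState n U (Command U Q) → Prop
  | done (s) : Chain f out ack i s [] none s
  | reply (s l b s') : Micro f out ack i (.reply b) s l s' → Chain f out ack i s l (some b) s'
  | internal (s l s' l' r s'') : Micro f out ack i .internal s l s' →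
      Chain f out ack i s' l' r s'' → Chain f out ack i s (l ++ l') r s''
  | write (s l s' x) : Micro f out ack i (.write x) s l s' → Chain f out ack i s l none s'

variable {f : ℕ} {out : Q → Finset (Stamped n U) → B} {ack : B} {i : Fin n}

/-- The client thread is analysed from its last stage back to its first, because each stage may fall
through to the next one within the same reaction. -/
lemma advance_borrowing (e : React n U Q B) (a : Command U Q) (r : ℕ)
    (he : e.reply = none) (hp : e.state.phase = .borrowing a r) :
    ∃ l, (afterGood out ack e).sends = e.sends ++ l ∧
      Chain f out ack i e.state l (afterGood out ack e).reply (afterGood out ack e).state ∧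
      Quiet f i (afterGood out ack e).state := by
  refine ⟨[], ?_⟩
  unfold afterGood
  rw [hp]
  dsimp only
  split_ifs with h
  · refine ⟨by simp [finishOp, modify], ?_, by simp [finishOp, modify, Quiet]⟩
    have := Chain.reply (f := f) (i := i) _ _ _ _
      (Micro.borrowed (f := f) (out := out) (ack := ack) (i := i) e.state a r _ hp h.choose_spec)
    cases a <;> simpa [finishOp, modify, result] using this
  · refine ⟨by simp, ?_, ?_⟩
    · rw [he]; exact Chain.done _
    · simp only [Quiet, hp]
      push Not at h
      exact h

lemma afterGood_of_ne (e : React n U Q B) (h : ∀ a r, e.state.phase ≠ .borrowing a r) :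
    afterGood out ack e = e := by
  unfold afterGood
  split
  · rename_i a r h'
    exact absurd h' (h a r)
  · rfl

open Classical in
lemma advance_agreeing (e : React n U Q B) (hnf : 0 < n - f) (a : Command U Q) (ph r : ℕ)
    (he : e.reply = none) (hp : e.state.phase = .agreeing a ph r) :
    ∃ l, (afterGood out ack (afterQuorum f out ack i e)).sends = e.sends ++ l ∧
      Chain f out ack i e.state l (afterGood out ack (afterQuorum f out ack i e)).reply
        (afterGood out ack (afterQuorum f out ack i e)).state ∧
      Quiet f i (afterGood out ack (afterQuorum f out ack i e)).state := by
  -- After a success `maxTag ≤ r`, so the maximum is `r + 1`; after a failure `r < maxTag`, so it is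
  -- `maxTag`. Thus leaving phase 0 after a failure has the same form as a retry with phase `ph +
  -- 1`.
  have hq : afterQuorum f out ack i e =
      if EQ f (fun j => upTo r (e.state.V j)) i then
      if e.state.maxTag ≤ r then
        if ph = 0 then startLattice a 1 (r + 1) (sendAll (.goodLA r) e)
        else finishOp out ack a (upTo r (e.state.V i)) (sendAll (.goodLA r) e)
      else if ph = 3 then modify (fun s => { s with phase := .borrowing a r }) e
      else startLattice a (ph + 1) e.state.maxTag e
    else e := by
    unfold afterQuorum
    rw [hp]
    dsimp only
    split_ifs with h1 h2 h3 h4 h5 <;> try rfl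
    · rw [max_eq_left (by omega : e.state.maxTag ≤ r + 1)]
    · omega
    · rw [max_eq_right (by omega), h4]
  rw [hq]
  split_ifs with h1 h2 h3 h4
  · subst h3
    rw [afterGood_of_ne _ (by simp [startLattice, sendAll, modify])]
    refine ⟨[(Finset.univ, .goodLA r), (Finset.univ, .writeTag (e.state.req + 1) (r + 1))],
      by simp [startLattice, sendAll, modify], ?_, ?_⟩
    · simpa [startLattice, sendAll, modify, he, enter] using
        Chain.internal _ _ _ _ _ _ (Micro.goodFirst (f := f) (out := out) (ack := ack) _ _ _ hp h1 h2)
          (Chain.done _)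
    -- The new request has an empty set of acknowledgements, so quietness says `0 < n - f`.
    · exact hnf
  · rw [afterGood_of_ne _ (by simp [finishOp, sendAll, modify])]
    refine ⟨[(Finset.univ, .goodLA r)], by simp [finishOp, sendAll, modify], ?_, ?_⟩
    · have := Chain.reply _ _ _ _
        (Micro.good (f := f) (out := out) (ack := ack) _ _ _ _ hp h3 h1 h2)
      cases a <;> simpa [finishOp, sendAll, modify, result] using this
    · simp [finishOp, sendAll, modify, Quiet]
  · subst h4
    obtain ⟨l, h5, h6, h7⟩ := advance_borrowing (f := f) (out := out) (ack := ack) (i := i)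
      (modify (fun s => { s with phase := .borrowing a r }) e) a r he rfl
    refine ⟨l, h5, ?_, h7⟩
    simpa using Chain.internal _ _ _ _ _ _ (Micro.borrow (f := f) (out := out) (ack := ack) _ _ _ hp h1
      (by omega)) h6
  · rw [afterGood_of_ne _ (by simp [startLattice, sendAll, modify])]
    refine ⟨[(Finset.univ, .writeTag (e.state.req + 1) e.state.maxTag)],
      by simp [startLattice, sendAll, modify], ?_, ?_⟩
    · simpa [startLattice, sendAll, modify, he, enter] using
        Chain.internal _ _ _ _ _ _ (Micro.retry (f := f) (out := out) (ack := ack) _ _ _ _ hp h1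
          (by omega) h4) (Chain.done _)
    · exact hnf
  · rw [afterGood_of_ne _ (by simp [hp])]
    exact ⟨[], by simp, by rw [he]; exact Chain.done _, by simpa [Quiet, hp] using h1⟩

lemma afterQuorum_of_ne (e : React n U Q B) (h : ∀ a ph r, e.state.phase ≠ .agreeing a ph r) :
    afterQuorum f out ack i e = e := by
  unfold afterQuorum
  split
  · rename_i a ph r h'
    exact absurd h' (h a ph r)
  · rfl

lemma advance_writing (e : React n U Q B) (hnf : 0 < n - f) (a : Command U Q) (ph r : ℕ)
    (he : e.reply = none) (hp : e.state.phase = .writing a ph r) :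
    ∃ l, (afterGood out ack (afterQuorum f out ack i (afterWrite f e))).sends = e.sends ++ l ∧
      Chain f out ack i e.state l
        (afterGood out ack (afterQuorum f out ack i (afterWrite f e))).reply
        (afterGood out ack (afterQuorum f out ack i (afterWrite f e))).state ∧
      Quiet f i (afterGood out ack (afterQuorum f out ack i (afterWrite f e))).state := by
  have hq : afterWrite f e =
      if n - f ≤ e.state.acks.card then modify (fun s => { s with phase := .agreeing a ph r }) e
      else e := by
    unfold afterWrite
    rw [hp]
  rw [hq]
  split_ifs with h1
  · obtain ⟨l, h5, h6, h7⟩ := advance_agreeing (f := f) (out := out) (ack := ack) (i := i)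
      (modify (fun s => { s with phase := .agreeing a ph r }) e) hnf a ph r he rfl
    refine ⟨l, h5, ?_, h7⟩
    simpa using Chain.internal _ _ _ _ _ _ (Micro.written (f := f) (out := out) (ack := ack) _ _ _ _
      hp h1) h6
  · rw [afterQuorum_of_ne _ (by simp [hp]), afterGood_of_ne _ (by simp [hp])]
    exact ⟨[], by simp, by rw [he]; exact Chain.done _, by simpa only [Quiet, hp, not_le] using h1⟩

lemma afterWrite_of_card (e : React n U Q B) (h : e.state.acks.card < n - f) :
    afterWrite f e = e := by
  unfold afterWrite
  split
  · rw [if_neg (not_le.mpr h)]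
  · rfl

lemma afterWrite_of_ne (e : React n U Q B) (h : ∀ a ph r, e.state.phase ≠ .writing a ph r) :
    afterWrite f e = e := by
  unfold afterWrite
  split
  · rename_i a ph r h'
    exact absurd h' (h a ph r)
  · rfl

lemma afterRead_of_ne (e : React n U Q B) (h : ∀ a, e.state.phase ≠ .reading a) :
    afterRead f i e = e := by
  unfold afterRead
  split
  · rename_i a h'
    exact absurd h' (h a)
  · rfl

/-- Besides splitting the client's part of a reaction into small steps, this records that the client
thread is stuck afterwards. Time can pass only in such states, and every bound on waiting comes from
there. -/
lemma advance_chain (e : React n U Q B) (hnf : 0 < n - f) (he : e.reply = none) :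
    ∃ l, (advance f out ack i e).sends = e.sends ++ l ∧
      Chain f out ack i e.state l (advance f out ack i e).reply (advance f out ack i e).state ∧
      Quiet f i (advance f out ack i e).state := by
  unfold advance
  rcases hp : e.state.phase with _ | a | ⟨a, ph, r⟩ | ⟨a, ph, r⟩ | ⟨a, r⟩
  · rw [afterRead_of_ne _ (by simp [hp]), afterWrite_of_ne _ (by simp [hp]),
      afterQuorum_of_ne _ (by simp [hp]), afterGood_of_ne _ (by simp [hp])]
    exact ⟨[], by simp, by rw [he]; exact Chain.done _, by simp [Quiet, hp]⟩
  · by_cases h : n - f ≤ e.state.acks.card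
    · rcases a with u | q
      · have : afterRead f i e = startLattice (.update u) 0 e.state.ackTag
            (sendAll (.value ⟨u, e.state.ackTag + 1, i⟩)
              (modify (addOwn i ⟨u, e.state.ackTag + 1, i⟩) e)) := by
          unfold afterRead
          rw [hp]
          dsimp only
          rw [if_pos h]
          rfl
        -- The request to write the tag has just been made and has no acknowledgements, so the
        -- remaining stages do nothing.
        rw [this, afterWrite_of_card _ hnf]
        simp only [startLattice, sendAll, modify]
        rw [afterQuorum_of_ne _ (by simp), afterGood_of_ne _ (by simp)]
        refine ⟨_, List.append_assoc _ _ _, ?_, ?_⟩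
        · rw [he]
          exact Chain.write _ _ _ _ (Micro.readUpdate _ _ hp h)
        · exact hnf
      · have : afterRead f i e = startLattice (.query q) 1 e.state.ackTag e := by
          unfold afterRead
          rw [hp]
          dsimp only
          rw [if_pos h]
        rw [this, afterWrite_of_card _ hnf]
        simp only [startLattice, sendAll, modify]
        rw [afterQuorum_of_ne _ (by simp), afterGood_of_ne _ (by simp)]
        refine ⟨_, rfl, ?_, ?_⟩
        · rw [he]
          exact Chain.internal _ _ _ [] _ _ (Micro.readQuery _ _ hp h) (Chain.done _)
        · exact hnf
    · have : afterRead f i e = e := by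
        unfold afterRead
        rw [hp]
        dsimp only
        rw [if_neg h]
      rw [this, afterWrite_of_ne _ (by simp [hp]),
        afterQuorum_of_ne _ (by simp [hp]), afterGood_of_ne _ (by simp [hp])]
      exact ⟨[], by simp, by rw [he]; exact Chain.done _, by simpa only [Quiet, hp, not_le] using h⟩
  · rw [afterRead_of_ne _ (by simp [hp])]
    exact advance_writing e hnf a ph r he hp
  · rw [afterRead_of_ne _ (by simp [hp]), afterWrite_of_ne _ (by simp [hp])]
    exact advance_agreeing e hnf a ph r he hp
  · rw [afterRead_of_ne _ (by simp [hp]), afterWrite_of_ne _ (by simp [hp]),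
      afterQuorum_of_ne _ (by simp [hp])]
    exact advance_borrowing e a r he hp

lemma handle_reply (s : AsoState n U (Command U Q)) (j : Fin n) (m : Msg n U) :
    (handle (Q := Q) (B := B) i s j m).reply = none := by
  cases m <;> rfl

end Micro


/-! ### The refined system -/

section Refined

variable {n : ℕ} {U Q B : Type*}

/-- The configurations of the algorithm. -/
abbrev Conf (n : ℕ) (U Q B : Type*) :=
  Config n (Command U Q) B (Msg n U) (AsoState n U (Command U Q))

/-- A configuration with auxiliary variables. -/
structure Sys (n : ℕ) (U Q B : Type*) extends
    Config n (Command U Q) B (Msg n U) (AsoState n U (Command U Q)) where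
  /-- the `send` commands that each node has started to execute -/
  log : Fin n → List (Finset (Fin n) × Msg n U)
  /-- `got p q` holds the messages that `p` has received from `q` -/
  got : Fin n → Fin n → List (Msg n U)
  /-- the position in the history of the latest invocation at each node -/
  op : Fin n → ℕ
  /-- the values written by the updates, which are named by the positions of their invocations -/
  val : ℕ → Option (Stamped n U)

/-- The initial state. -/
noncomputable def Sys.initial (f : ℕ) (out : Q → Finset (Stamped n U) → B) (ack : B) : Sys n U Q B where
  toConfig := Config.initial (protocol n f out ack)
  log := fun _ => []
  got := fun _ _ => []
  op := fun _ => 0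
  val := fun _ => none

/-- What is left of the channel from `q` to `r` when `p` takes its input. -/
def Input.rest (inp : Input n U Q B) (p q r : Fin n) (l : List (ℝ × Msg n U)) :
    List (ℝ × Msg n U) :=
  match inp with
  | .receive q' _ => if q = q' ∧ r = p then l.tail else l
  | _ => l

/-- The messages received, after the input. -/
def Input.gets (inp : Input n U Q B) (l : Fin n → List (Msg n U)) : Fin n → List (Msg n U) :=
  match inp with
  | .receive q m => Function.update l q (l q ++ [m])
  | _ => l

/-- The event at the interface that a small step of `p` causes. -/
def Input.event (inp : Input n U Q B) (p : Fin n) (dead : Bool) :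
    List (Event n (Command U Q) B) :=
  match inp, dead with
  | .invoke a, _ => [.inv p a]
  | .reply b, false => [.res p b]
  | _, _ => []

/-- Node `p` performs a small step with `send` commands `l`, of which only `l'` take effect; it
crashes if `dead` holds. -/
def Sys.exec (g : Sys n U Q B) (p : Fin n) (inp : Input n U Q B)
    (l l' : List (Finset (Fin n) × Msg n U)) (dead : Bool) (s' : AsoState n U (Command U Q)) :
    Sys n U Q B where
  now := g.now
  loc := Function.update g.loc p s'
  crashed := if dead then insert p g.crashed else g.crashed
  chan := fun q r => inp.rest p q r (g.chan q r) ++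
    if q = p then (l'.filter fun x => r ∈ x.1).map fun x => (g.now, x.2) else []
  pending := match inp, dead with
    | .invoke _, _ => Function.update g.pending p (some g.now)
    | .reply _, false => Function.update g.pending p none
    | _, _ => g.pending
  history := g.history ++ inp.event p dead
  log := Function.update g.log p (g.log p ++ l)
  got := Function.update g.got p (inp.gets (g.got p))
  op := match inp with
    | .invoke _ => Function.update g.op p g.history.length
    | _ => g.op
  val := match inp with
    | .write x => Function.update g.val (g.op p) (some x)
    | _ => g.val

/-- The input is available to `p`. -/
def Sys.Offers (g : Sys n U Q B) (p : Fin n) : Input n U Q B → Prop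
  | .invoke _ => g.pending p = none
  | .receive q m => ∃ σ, (g.chan q p).head? = some (σ, m)
  | _ => True

/-- Which `send` commands take effect. -/
def Effective (l l' : List (Finset (Fin n) × Msg n U)) (dead : Bool) : Prop :=
  if dead then Interrupted l l' else l' = l

variable (f : ℕ) (out : Q → Finset (Stamped n U) → B) (ack : B) (D : ℝ)

/-- The steps of the refined system. -/
inductive Move : Sys n U Q B → Sys n U Q B → Prop
  -- Idle steps allow a finite run to be continued to an infinite sequence of states.
  | stay (g) : Move g g
  | tick (g : Sys n U Q B) (t : ℝ) : g.now ≤ t →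
      (∀ q p, p ∉ g.crashed → ∀ x ∈ g.chan q p, t ≤ x.1 + D) →
      -- Reactions are instantaneous, so no clock tick may separate the small steps of one reaction.
      (∀ p, p ∉ g.crashed → Quiet f p (g.loc p)) →
      Move g { g with now := t }
  | act (g : Sys n U Q B) (p : Fin n) (inp : Input n U Q B) (l l' dead s') :
      p ∉ g.crashed → g.Offers p inp → Micro f out ack p inp (g.loc p) l s' →
      Effective l l' dead → (dead = true → g.crashed.card < f) →
      Move g (g.exec p inp l l' dead s')

abbrev Moves : Sys n U Q B → Sys n U Q B → Prop := Relation.ReflTransGen (Move f out ack D)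

variable {f out ack D}

lemma complete_complete (c : Conf n U Q B) (p : Fin n) (s s' : AsoState n U (Command U Q))
    (l l' : List (Finset (Fin n) × Msg n U)) (r : Option B) :
    (c.complete p ⟨s, l, none⟩).complete p ⟨s', l', r⟩ = c.complete p ⟨s', l ++ l', r⟩ := by
  cases r <;> simp only [Config.complete, Config.send, Config.finish, Function.update_idem] <;>
    congr 1 <;> funext q r <;> split_ifs <;> simp

lemma complete_fail (c : Conf n U Q B) (p : Fin n) (s : AsoState n U (Command U Q))
    (l l' : List (Finset (Fin n) × Msg n U)) :
    ∃ loc', (c.complete p ⟨s, l, none⟩).fail p l' = { c.fail p (l ++ l') with loc := loc' } ∧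
      ∀ q, q ≠ p → loc' q = c.loc q := by
  refine ⟨Function.update c.loc p s, ?_, fun q hq => Function.update_of_ne hq _ _⟩
  simp only [Config.complete, Config.fail, Config.send]
  congr 1
  funext q r
  split_ifs <;> simp

/-- This locates a crash in the middle of a reaction: either it falls into the first small step, or
that step is executed in full and the crash comes later. -/
lemma interrupted_append (l₁ l₂ l : List (Finset (Fin n) × Msg n U))
    (h : Interrupted (l₁ ++ l₂) l) :
    Interrupted l₁ l ∨ ∃ l₃, l = l₁ ++ l₃ ∧ Interrupted l₂ l₃ := by
  induction l₁ generalizing l with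
  | nil => exact Or.inr ⟨l, rfl, h⟩
  | cons x l₁ ih =>
    cases h with
    | none => exact Or.inl (.none _)
    | part d d' m _ hd => exact Or.inl (.part d d' m _ hd)
    | next _ _ l' h =>
      rcases ih _ h with h' | ⟨l₃, rfl, h'⟩
      · exact Or.inl (.next _ _ _ h')
      · exact Or.inr ⟨l₃, rfl, h'⟩

lemma exec_internal (g : Sys n U Q B) (p : Fin n) (l s') :
    (g.exec p .internal l l false s').toConfig = g.toConfig.complete p ⟨s', l, none⟩ := by
  simp only [Sys.exec, Config.complete, Config.send, Input.rest, Input.event, List.append_nil]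
  congr 1
  funext q r
  by_cases h : q = p <;> simp [h]

lemma exec_write (g : Sys n U Q B) (p : Fin n) (x l s') :
    (g.exec p (.write x) l l false s').toConfig = g.toConfig.complete p ⟨s', l, none⟩ := by
  simp only [Sys.exec, Config.complete, Config.send, Input.rest, Input.event, List.append_nil]
  congr 1
  funext q r
  by_cases h : q = p <;> simp [h]

lemma exec_reply (g : Sys n U Q B) (p : Fin n) (b l s') :
    (g.exec p (.reply b) l l false s').toConfig = g.toConfig.complete p ⟨s', l, some b⟩ := by
  simp only [Sys.exec, Config.complete, Config.send, Config.finish, Input.rest, Input.event]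
  congr 1
  funext q r
  by_cases h : q = p <;> simp [h]

lemma exec_invoke (g : Sys n U Q B) (p : Fin n) (a l s') :
    (g.exec p (.invoke a) l l false s').toConfig =
      (g.toConfig.begin p a).complete p ⟨s', l, none⟩ := by
  simp only [Sys.exec, Config.complete, Config.send, Config.begin, Input.rest, Input.event]
  congr 1
  funext q r
  by_cases h : q = p <;> simp [h]

lemma pop_chan (c : Conf n U Q B) (q p q' r : Fin n) : (c.pop q p).chan q' r =
    if q' = q ∧ r = p then (c.chan q' r).tail else c.chan q' r := by
  simp only [Config.pop]
  by_cases h : q' = q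
  · subst h
    by_cases h' : r = p
    · subst h'; simp
    · simp [h']
  · simp [h]

lemma exec_receive (g : Sys n U Q B) (p q : Fin n) (m l s') :
    (g.exec p (.receive q m) l l false s').toConfig =
      (g.toConfig.pop q p).complete p ⟨s', l, none⟩ := by
  simp only [Sys.exec, Config.complete, Config.send, Input.rest, Input.event, List.append_nil,
    pop_chan]
  simp only [Config.pop]
  congr 1
  funext q' r
  by_cases h : q' = p <;> simp [h]

lemma exec_internal_dead (g : Sys n U Q B) (p : Fin n) (l l' s') :
    (g.exec p .internal l l' true s').toConfig =
      { g.toConfig.fail p l' with loc := Function.update g.loc p s' } := by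
  simp only [Sys.exec, Config.fail, Config.send, Input.rest, Input.event, List.append_nil]
  congr 1
  funext q r
  by_cases h : q = p <;> simp [h]

lemma exec_write_dead (g : Sys n U Q B) (p : Fin n) (x l l' s') :
    (g.exec p (.write x) l l' true s').toConfig =
      { g.toConfig.fail p l' with loc := Function.update g.loc p s' } := by
  simp only [Sys.exec, Config.fail, Config.send, Input.rest, Input.event, List.append_nil]
  congr 1
  funext q r
  by_cases h : q = p <;> simp [h]

lemma exec_reply_dead (g : Sys n U Q B) (p : Fin n) (b l l' s') :
    (g.exec p (.reply b) l l' true s').toConfig =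
      { g.toConfig.fail p l' with loc := Function.update g.loc p s' } := by
  simp only [Sys.exec, Config.fail, Config.send, Input.rest, Input.event, List.append_nil]
  congr 1
  funext q r
  by_cases h : q = p <;> simp [h]

lemma exec_invoke_dead (g : Sys n U Q B) (p : Fin n) (a l l' s') :
    (g.exec p (.invoke a) l l' true s').toConfig =
      { (g.toConfig.begin p a).fail p l' with loc := Function.update g.loc p s' } := by
  simp only [Sys.exec, Config.fail, Config.send, Config.begin, Input.rest, Input.event]
  congr 1
  funext q r
  by_cases h : q = p <;> simp [h]

lemma exec_receive_dead (g : Sys n U Q B) (p q : Fin n) (m l l' s') :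
    (g.exec p (.receive q m) l l' true s').toConfig =
      { (g.toConfig.pop q p).fail p l' with loc := Function.update g.loc p s' } := by
  simp only [Sys.exec, Config.fail, Config.send, Input.rest, Input.event, List.append_nil,
    pop_chan]
  simp only [Config.pop]
  congr 1
  funext q' r
  by_cases h : q' = p <;> simp [h]

lemma moves_chain (g : Sys n U Q B) (p : Fin n) (hp : p ∉ g.crashed) (s l r s')
    (hc : Chain f out ack p s l r s') (hs : g.loc p = s) :
    ∃ g', Moves f out ack D g g' ∧ g'.toConfig = g.toConfig.complete p ⟨s', l, r⟩ := by
  induction hc generalizing g with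
  | done s =>
    refine ⟨_, .single (.act g p .internal [] [] false s hp trivial (hs ▸ .skip _) rfl (by simp)), ?_⟩
    exact exec_internal g p [] s
  | reply s l b s' hm =>
    refine ⟨_, .single (.act g p (.reply b) l l false s' hp trivial (hs ▸ hm) rfl (by simp)), ?_⟩
    exact exec_reply g p b l s'
  | internal s l s' l' r s'' hm _ ih =>
    obtain ⟨g', h1, h2⟩ := ih (g.exec p .internal l l false s') (by simpa [Sys.exec] using hp)
      (by simp [Sys.exec])
    refine ⟨g', .head (.act g p .internal l l false s' hp trivial (hs ▸ hm) rfl (by simp)) h1, ?_⟩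
    rw [h2, exec_internal, complete_complete]
  | write s l s' x hm =>
    refine ⟨_, .single (.act g p (.write x) l l false s' hp trivial (hs ▸ hm) rfl (by simp)), ?_⟩
    exact exec_write g p x l s'

/-- The crash is charged to the one small step whose commands it cuts short; the preceding ones are
executed completely. The local state of the dead node may then differ from that in the model, which
leaves it as it was before the reaction. Nothing depends on it. -/
lemma moves_chain_interrupted (g : Sys n U Q B) (p : Fin n) (hp : p ∉ g.crashed)
    (hcr : g.crashed.card < f) (s l r s')
    (hc : Chain f out ack p s l r s') (hs : g.loc p = s) (l') (hl : Interrupted l l') :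
    ∃ g' loc', Moves f out ack D g g' ∧ g'.toConfig = { g.toConfig.fail p l' with loc := loc' } ∧
      ∀ q, q ≠ p → loc' q = g.loc q := by
  induction hc generalizing g l' with
  | done s =>
    exact ⟨_, _, .single (.act g p .internal [] l' true s hp trivial (hs ▸ .skip _) hl
      fun _ => hcr), exec_internal_dead g p [] l' s, fun q hq => Function.update_of_ne hq _ _⟩
  | reply s l b s' hm =>
    exact ⟨_, _, .single (.act g p (.reply b) l l' true s' hp trivial (hs ▸ hm) hl fun _ => hcr),
      exec_reply_dead g p b l l' s', fun q hq => Function.update_of_ne hq _ _⟩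
  | internal s l₁ s' l₂ r s'' hm _ ih =>
    rcases interrupted_append _ _ _ hl with hl' | ⟨l₃, rfl, hl'⟩
    · exact ⟨_, _, .single (.act g p .internal l₁ l' true s' hp trivial (hs ▸ hm) hl' fun _ => hcr),
        exec_internal_dead g p l₁ l' s', fun q hq => Function.update_of_ne hq _ _⟩
    · obtain ⟨g', loc', h1, h2, h3⟩ := ih (g.exec p .internal l₁ l₁ false s')
        (by simpa [Sys.exec] using hp) (by simpa [Sys.exec] using hcr) (by simp [Sys.exec]) l₃ hl'
      obtain ⟨loc'', h4, h5⟩ := complete_fail g.toConfig p s' l₁ l₃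
      refine ⟨g', loc', .head (.act g p .internal l₁ l₁ false s' hp trivial (hs ▸ hm) rfl
        (by simp)) h1, ?_, fun q hq => ?_⟩
      · rw [h2, exec_internal, h4]
      · rw [h3 q hq]; simp [Sys.exec, hq]
  | write s l s' x hm =>
    exact ⟨_, _, .single (.act g p (.write x) l l' true s' hp trivial (hs ▸ hm) hl fun _ => hcr),
      exec_write_dead g p x l l' s', fun q hq => Function.update_of_ne hq _ _⟩

/-- A configuration is represented by a refined state that differs from it at most in the local
states of crashed nodes. -/
def Represents (f : ℕ) (g : Sys n U Q B) (c : Conf n U Q B) : Prop :=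
  (∃ loc', g.toConfig = { c with loc := loc' } ∧ ∀ p, p ∉ c.crashed → loc' p = c.loc p) ∧
    ∀ p, p ∉ c.crashed → Quiet f p (c.loc p)

lemma complete_now (c : Conf n U Q B) (p : Fin n) (r) : (c.complete p r).crashed = c.crashed ∧
    (c.complete p r).loc = Function.update c.loc p r.state := by
  unfold Config.complete
  cases r.reply <;> exact ⟨rfl, rfl⟩

lemma complete_loc (c : Conf n U Q B) (p : Fin n) (r loc') :
    ({ c with loc := loc' } : Conf n U Q B).complete p r =
      { c.complete p r with loc := Function.update loc' p r.state } := by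
  unfold Config.complete
  cases r.reply <;> rfl

/-- The simulation. Quietness of the live nodes is part of the relation because the refined clock
tick demands it; it holds after each reaction since `advance` runs until the client thread has to
wait. -/
lemma represents_step (hnf : f < n) (g : Sys n U Q B) (c c' : Conf n U Q B)
    (h : Represents f g c) (hs : Step (protocol n f out ack) f D c c') :
    ∃ g', Moves f out ack D g g' ∧ Represents f g' c' := by
  have hnf' : 0 < n - f := by omega
  obtain ⟨⟨loc', hg, hloc⟩, hq⟩ := h
  have e1 : g.crashed = c.crashed := by rw [hg]
  have e2 : g.pending = c.pending := by rw [hg]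
  have e3 : g.chan = c.chan := by rw [hg]
  have e4 : g.loc = loc' := by rw [hg]
  have e5 : g.now = c.now := by rw [hg]
  cases hs with
  | tick t h1 h2 =>
    refine ⟨_, .single (.tick g t (e5 ▸ h1) (by rw [e1, e3]; exact h2) ?_), ?_, hq⟩
    · intro p hp
      rw [e1] at hp
      rw [e4, hloc p hp]
      exact hq p hp
    · exact ⟨loc', by rw [hg], hloc⟩
  | invoke p a hp h1 =>
    obtain ⟨l, h2, h3, h4⟩ := advance_chain (out := out) (ack := ack) (i := p)
      (start (B := B) (c.loc p) a) hnf' rfl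
    let g₁ := g.exec p (.invoke a) [(Finset.univ, .readTag ((c.loc p).req + 1))]
      [(Finset.univ, .readTag ((c.loc p).req + 1))] false (start (B := B) (c.loc p) a).state
    have hm : Move f out ack D g g₁ := .act _ _ _ _ _ _ _ (by rwa [e1]) (by rw [← e2] at h1; exact h1)
      (by rw [e4, hloc p hp]; exact .start _ _) rfl (by simp)
    obtain ⟨g', h5, h6⟩ := moves_chain (D := D) g₁ p (by simpa [g₁, Sys.exec, e1] using hp) _ _ _ _ h3
      (by simp [g₁, Sys.exec])
    have key : g'.toConfig =
        { (c.begin p a).complete p ((protocol n f out ack).invoke p (c.loc p) a) with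
          loc := Function.update loc' p ((protocol n f out ack).invoke p (c.loc p) a).state } := by
      rw [h6, exec_invoke, complete_complete, ← complete_loc, hg]
      have : (protocol n f out ack).invoke p (c.loc p) a =
          ⟨(advance f out ack p (start (c.loc p) a)).state,
            (start (B := B) (c.loc p) a).sends ++ l,
            (advance f out ack p (start (c.loc p) a)).reply⟩ := by
        rw [← h2]; rfl
      rw [this]
      rfl
    refine ⟨g', .head hm h5, ⟨_, key, ?_⟩, ?_⟩
    · intro q hq'
      rw [(complete_now _ _ _).1] at hq'
      rw [(complete_now _ _ _).2]
      by_cases hqp : q = p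
      · subst hqp; simp
      · simp only [Function.update_of_ne hqp]; exact hloc q hq'
    · intro q hq'
      rw [(complete_now _ _ _).1] at hq'
      rw [(complete_now _ _ _).2]
      by_cases hqp : q = p
      · subst hqp; simp only [Function.update_self]; exact h4
      · simp only [Function.update_of_ne hqp]; exact hq q hq'
  | deliver q₀ p s m hp h1 =>
    obtain ⟨l, h2, h3, h4⟩ := advance_chain (out := out) (ack := ack) (i := p)
      (handle p (c.loc p) q₀ m) hnf' (handle_reply _ _ _)
    let g₁ := g.exec p (.receive q₀ m) (handle (Q := Q) (B := B) p (c.loc p) q₀ m).sends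
      (handle (Q := Q) (B := B) p (c.loc p) q₀ m).sends false
      (handle (B := B) p (c.loc p) q₀ m).state
    have hm : Move f out ack D g g₁ := .act _ _ _ _ _ _ _ (by rwa [e1])
      ⟨s, by rw [e3]; exact h1⟩
      (by rw [e4, hloc p hp]; exact .deliver _ _ _) rfl (by simp)
    obtain ⟨g', h5, h6⟩ := moves_chain (D := D) g₁ p (by simpa [g₁, Sys.exec, e1] using hp) _ _ _ _ h3
      (by simp [g₁, Sys.exec])
    have key : g'.toConfig =
        { (c.pop q₀ p).complete p ((protocol n f out ack).receive p (c.loc p) q₀ m) with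
          loc := Function.update loc' p ((protocol n f out ack).receive p (c.loc p) q₀ m).state } := by
      rw [h6, exec_receive, complete_complete, ← complete_loc, hg]
      have : (protocol n f out ack).receive p (c.loc p) q₀ m =
          ⟨(advance f out ack p (handle p (c.loc p) q₀ m)).state,
            (handle (Q := Q) (B := B) p (c.loc p) q₀ m).sends ++ l,
            (advance f out ack p (handle p (c.loc p) q₀ m)).reply⟩ := by
        rw [← h2]; rfl
      rw [this]
      rfl
    refine ⟨g', .head hm h5, ⟨_, key, ?_⟩, ?_⟩
    · intro q hq'
      rw [(complete_now _ _ _).1] at hq'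
      rw [(complete_now _ _ _).2]
      by_cases hqp : q = p
      · subst hqp; simp
      · simp only [Function.update_of_ne hqp]; exact hloc q hq'
    · intro q hq'
      rw [(complete_now _ _ _).1] at hq'
      rw [(complete_now _ _ _).2]
      by_cases hqp : q = p
      · subst hqp; simp only [Function.update_self]; exact h4
      · simp only [Function.update_of_ne hqp]; exact hq q hq'
  | crash p hp h1 =>
    -- A crash between two reactions is a step `skip` that the node does not survive.
    have hm : Move f out ack D g (g.exec p .internal [] [] true (g.loc p)) :=
      .act _ _ _ _ _ _ _ (by rwa [e1]) trivial (.skip _) (.none _) (by rw [e1]; exact fun _ => h1)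
    refine ⟨_, .single hm, ⟨loc', ?_, ?_⟩, ?_⟩
    · rw [exec_internal_dead, hg]
      simp [Config.fail, Config.send]
    · intro q hq'
      exact hloc q fun h => hq' (Finset.mem_insert_of_mem h)
    · intro q hq'
      exact hq q fun h => hq' (Finset.mem_insert_of_mem h)
  | crashInvoke p a l' hp h1 h0 hl =>
    obtain ⟨l, h2, h3, h4⟩ := advance_chain (out := out) (ack := ack) (i := p)
      (start (B := B) (c.loc p) a) hnf' rfl
    have hl' : Interrupted ((start (B := B) (c.loc p) a).sends ++ l) l' := by rw [← h2]; exact hl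
    -- Either the crash interrupts the broadcast of the `readTag` request, or it happens later in
    -- the reaction.
    rcases interrupted_append _ _ _ hl' with hl₂ | ⟨l₃, rfl, hl₂⟩
    · have hm : Move f out ack D g (g.exec p (.invoke a) _ l' true _) :=
        .act _ _ _ _ _ _ _ (by rwa [e1]) (by rw [← e2] at h0; exact h0)
          (by rw [e4, hloc p hp]; exact .start _ _) hl₂ (by rw [e1]; exact fun _ => h1)
      refine ⟨_, .single hm, ⟨Function.update loc' p (start (B := B) (c.loc p) a).state, ?_, ?_⟩, ?_⟩
      · exact (exec_invoke_dead _ _ _ _ _ _).trans (by rw [hg]; rfl)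
      · intro q hq'
        have hq' : q ≠ p ∧ q ∉ c.crashed := by
          simpa [Config.fail, Config.begin, Config.send, Finset.mem_insert, not_or] using hq'
        rw [Function.update_of_ne hq'.1]
        exact hloc q hq'.2
      · intro q hq'
        exact hq q fun h => hq' (Finset.mem_insert_of_mem h)
    · let g₁ := g.exec p (.invoke a) [(Finset.univ, .readTag ((c.loc p).req + 1))]
        [(Finset.univ, .readTag ((c.loc p).req + 1))] false (start (B := B) (c.loc p) a).state
      have hm : Move f out ack D g g₁ := .act _ _ _ _ _ _ _ (by rwa [e1])
        (by rw [← e2] at h0; exact h0)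
        (by rw [e4, hloc p hp]; exact .start _ _) rfl (by simp)
      obtain ⟨g', loc'', h5, h6, h7⟩ := moves_chain_interrupted (D := D) g₁ p
        (by simpa [g₁, Sys.exec, e1] using hp) (by simpa [g₁, Sys.exec, e1] using h1) _ _ _ _ h3
        (by simp [g₁, Sys.exec]) l₃ hl₂
      refine ⟨g', .head hm h5, ⟨loc'', ?_, ?_⟩, ?_⟩
      · obtain ⟨loc₃, h8, -⟩ := complete_fail (g.toConfig.begin p a) p
          (start (B := B) (c.loc p) a).state [(Finset.univ, .readTag ((c.loc p).req + 1))] l₃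
        rw [h6, exec_invoke, h8, hg]
        rfl
      · intro q hq'
        have hq' : q ≠ p ∧ q ∉ c.crashed := by
          simpa [Config.fail, Config.begin, Config.send, Finset.mem_insert, not_or] using hq'
        rw [h7 q hq'.1]
        have : g₁.loc q = g.loc q := by simp [g₁, Sys.exec, hq'.1]
        rw [this, e4]
        exact hloc q hq'.2
      · intro q hq'
        exact hq q fun h => hq' (Finset.mem_insert_of_mem h)
  | crashDeliver q₀ p s m l' hp h1 h0 hl =>
    obtain ⟨l, h2, h3, h4⟩ := advance_chain (out := out) (ack := ack) (i := p)
      (handle p (c.loc p) q₀ m) hnf' (handle_reply _ _ _)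
    have hl' : Interrupted ((handle (Q := Q) (B := B) p (c.loc p) q₀ m).sends ++ l) l' := by
      rw [← h2]; exact hl
    rcases interrupted_append _ _ _ hl' with hl₂ | ⟨l₃, rfl, hl₂⟩
    · have hm : Move f out ack D g (g.exec p (.receive q₀ m) _ l' true _) :=
        .act _ _ _ _ _ _ _ (by rwa [e1]) ⟨s, by rw [e3]; exact h0⟩
          (by rw [e4, hloc p hp]; exact .deliver _ _ _) hl₂ (by rw [e1]; exact fun _ => h1)
      refine ⟨_, .single hm, ⟨Function.update loc' p (handle (B := B) p (c.loc p) q₀ m).state, ?_, ?_⟩, ?_⟩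
      · exact (exec_receive_dead _ _ _ _ _ _ _).trans (by rw [hg]; rfl)
      · intro q hq'
        have hq' : q ≠ p ∧ q ∉ c.crashed := by
          simpa [Config.fail, Config.pop, Config.send, Finset.mem_insert, not_or] using hq'
        rw [Function.update_of_ne hq'.1]
        exact hloc q hq'.2
      · intro q hq'
        exact hq q fun h => hq' (Finset.mem_insert_of_mem h)
    · let g₁ := g.exec p (.receive q₀ m) (handle (Q := Q) (B := B) p (c.loc p) q₀ m).sends
        (handle (Q := Q) (B := B) p (c.loc p) q₀ m).sends false
        (handle (B := B) p (c.loc p) q₀ m).state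
      have hm : Move f out ack D g g₁ := .act _ _ _ _ _ _ _ (by rwa [e1])
        ⟨s, by rw [e3]; exact h0⟩
        (by rw [e4, hloc p hp]; exact .deliver _ _ _) rfl (by simp)
      obtain ⟨g', loc'', h5, h6, h7⟩ := moves_chain_interrupted (D := D) g₁ p
        (by simpa [g₁, Sys.exec, e1] using hp) (by simpa [g₁, Sys.exec, e1] using h1) _ _ _ _ h3
        (by simp [g₁, Sys.exec]) l₃ hl₂
      refine ⟨g', .head hm h5, ⟨loc'', ?_, ?_⟩, ?_⟩
      · obtain ⟨loc₃, h8, -⟩ := complete_fail (g.toConfig.pop q₀ p) p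
          (handle (B := B) p (c.loc p) q₀ m).state
          (handle (Q := Q) (B := B) p (c.loc p) q₀ m).sends l₃
        rw [h6, exec_receive, h8, hg]
        rfl
      · intro q hq'
        have hq' : q ≠ p ∧ q ∉ c.crashed := by
          simpa [Config.fail, Config.pop, Config.send, Finset.mem_insert, not_or] using hq'
        rw [h7 q hq'.1]
        have : g₁.loc q = g.loc q := by simp [g₁, Sys.exec, hq'.1]
        rw [this, e4]
        exact hloc q hq'.2
      · intro q hq'
        exact hq q fun h => hq' (Finset.mem_insert_of_mem h)

/-- The executions of the refined system, as infinite sequences. -/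
structure Execution (f : ℕ) (out : Q → Finset (Stamped n U) → B) (ack : B) (D : ℝ)
    (e : ℕ → Sys n U Q B) : Prop where
  zero : e 0 = Sys.initial f out ack
  step : ∀ t, Move f out ack D (e t) (e (t + 1))

lemma exists_execution (g : Sys n U Q B) (h : Moves f out ack D (Sys.initial f out ack) g) :
    ∃ e N, Execution f out ack D e ∧ e N = g := by
  induction h with
  | refl => exact ⟨fun _ => Sys.initial f out ack, 0, ⟨rfl, fun _ => .stay _⟩, rfl⟩
  | @tail g g' _ h ih =>
    obtain ⟨e, N, he, rfl⟩ := ih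
    refine ⟨fun t => if t ≤ N then e t else g', N + 1, ⟨?_, fun t => ?_⟩, ?_⟩
    · simpa using he.zero
    · rcases lt_trichotomy t N with ht | rfl | ht
      · simpa [ht.le, Nat.succ_le_of_lt ht] using he.step t
      · simpa using h
      · simpa [not_le.mpr ht, show ¬ t + 1 ≤ N by omega] using Move.stay g'
    · simp

lemma exists_execution_of_reachable (hnf : f < n) (c : Conf n U Q B)
    (h : Reachable (protocol n f out ack) f D c) :
    ∃ e N, Execution f out ack D e ∧ Represents f (e N) c := by
  suffices h : ∃ g, Moves f out ack D (Sys.initial f out ack) g ∧ Represents f g c by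
    obtain ⟨g, h1, h2⟩ := h
    obtain ⟨e, N, he, rfl⟩ := exists_execution g h1
    exact ⟨e, N, he, h2⟩
  induction h with
  | refl =>
    refine ⟨_, .refl, ⟨_, rfl, fun _ _ => rfl⟩, fun p _ => ?_⟩
    simp [Quiet, Config.initial, protocol]
  | tail _ h ih =>
    obtain ⟨g, h1, h2⟩ := ih
    obtain ⟨g', h3, h4⟩ := represents_step hnf g _ _ h2 h
    exact ⟨g', h1.trans h3, h4⟩

end Refined


/-! ### What a small step can change and send -/

section MicroLemmas

variable {n : ℕ} {U Q B : Type*} {f : ℕ} {out : Q → Finset (Stamped n U) → B} {ack : B}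
  {p : Fin n} {inp : Input n U Q B} {s s' : AsoState n U (Command U Q)}
  {l : List (Finset (Fin n) × Msg n U)}

lemma Micro.mem_V (h : Micro f out ack p inp s l s') (q : Fin n) (x : Stamped n U) :
    x ∈ s'.V q ↔ x ∈ s.V q ∨ (inp = .write x ∧ q = p) ∨
      ∃ j, inp = .receive j (.value x) ∧ (q = j ∨ q = p) := by
  cases h with
  | deliver s j m =>
    cases m with
    | value y =>
      simp only [handle, Function.update_apply]
      split_ifs <;> simp_all [eq_comm, or_comm]
    | _ => simp only [handle]; (try split_ifs) <;> simp
  | readUpdate u =>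
    simp only [enter, addOwn, Function.update_apply]
    split_ifs <;> simp_all [eq_comm, or_comm]
  | _ => simp [enter]

lemma Micro.maxTag_le (h : Micro f out ack p inp s l s') : s.maxTag ≤ s'.maxTag := by
  cases h with
  | deliver s j m => cases m <;> simp only [handle] <;> (try split_ifs) <;> simp
  | _ => simp [enter, addOwn]

/-- A value is sent when it is written or first received, the same moment at which it enters `V p`.
This is why the log mirrors `V p`. -/
lemma Micro.value_mem (h : Micro f out ack p inp s l s') (d : Finset (Fin n)) (x : Stamped n U) :
    (d, Msg.value x) ∈ l ↔ d = Finset.univ ∧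
      (inp = .write x ∨ ∃ j, inp = .receive j (.value x) ∧ x ∉ s.V p) := by
  cases h with
  | deliver s j m =>
    cases m with
    | value y =>
      simp only [handle]
      split_ifs with h
      · simp; rintro - rfl; exact h
      · simp; rintro -
        constructor
        · rintro rfl; exact ⟨rfl, h⟩
        · rintro ⟨rfl, -⟩; rfl
    | _ => simp [handle]
  | readUpdate u => simp [eq_comm]
  | _ => simp

lemma Micro.of_writeTag {j : Fin n} {κ τ : ℕ}
    (h : Micro f out ack p (.receive j (.writeTag κ τ)) s l s') :
    l = [(Finset.univ, .echoTag τ), ({j}, .writeAck κ τ)] ∧ s' = { s with maxTag := max s.maxTag τ } := by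
  cases h
  exact ⟨rfl, rfl⟩

lemma Micro.of_readTag {j : Fin n} {κ : ℕ}
    (h : Micro f out ack p (.receive j (.readTag κ)) s l s') :
    l = [({j}, .readAck κ s.maxTag)] ∧ s' = s := by
  cases h
  exact ⟨rfl, rfl⟩

lemma Micro.of_echoTag {j : Fin n} {τ : ℕ}
    (h : Micro f out ack p (.receive j (.echoTag τ)) s l s') :
    l = [] ∧ s' = { s with maxTag := max s.maxTag τ } := by
  cases h
  exact ⟨rfl, rfl⟩

lemma Micro.of_goodLA {j : Fin n} {r : ℕ}
    (h : Micro f out ack p (.receive j (.goodLA r)) s l s') :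
    l = [] ∧ s' = { s with
          D := Function.update s.D j (upTo r (s.V j))
          good := Function.update s.good j (insert r (s.good j)) } := by
  cases h
  refine ⟨rfl, ?_⟩
  simp only [handle]

lemma Micro.echoTag_mem (h : Micro f out ack p inp s l s') (d : Finset (Fin n)) (τ : ℕ)
    (hm : (d, Msg.echoTag τ) ∈ l) : d = Finset.univ ∧ ∃ j κ, inp = .receive j (.writeTag κ τ) := by
  cases h with
  | deliver s j m =>
    cases m with
    | value y => simp only [handle] at hm; split_ifs at hm <;> simp at hm
    | _ => simp_all [handle]
  | _ => simp at hm

lemma Micro.writeAck_mem (h : Micro f out ack p inp s l s') (d : Finset (Fin n)) (κ τ : ℕ)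
    (hm : (d, Msg.writeAck κ τ) ∈ l) : ∃ j, d = {j} ∧ inp = .receive j (.writeTag κ τ) := by
  cases h with
  | deliver s j m =>
    cases m with
    | value y => simp only [handle] at hm; split_ifs at hm <;> simp at hm
    | _ => simp_all [handle]
  | _ => simp at hm

lemma Micro.readAck_mem (h : Micro f out ack p inp s l s') (d : Finset (Fin n)) (κ τ : ℕ)
    (hm : (d, Msg.readAck κ τ) ∈ l) :
    ∃ j, d = {j} ∧ inp = .receive j (.readTag κ) ∧ τ = s.maxTag := by
  cases h with
  | deliver s j m =>
    cases m with
    | value y => simp only [handle] at hm; split_ifs at hm <;> simp at hm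
    | _ => simp_all [handle]
  | _ => simp at hm

lemma Micro.readTag_mem (h : Micro f out ack p inp s l s') (d : Finset (Fin n)) (κ : ℕ)
    (hm : (d, Msg.readTag κ) ∈ l) :
    d = Finset.univ ∧ κ = s.req + 1 ∧ s'.req = s.req + 1 ∧ ∃ a, inp = .invoke a ∧
      s'.phase = .reading a := by
  cases h with
  | deliver s j m =>
    cases m with
    | value y => simp only [handle] at hm; split_ifs at hm <;> simp at hm
    | _ => simp_all [handle]
  | _ => simp_all

lemma Micro.writeTag_mem (h : Micro f out ack p inp s l s') (d : Finset (Fin n)) (κ τ : ℕ)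
    (hm : (d, Msg.writeTag κ τ) ∈ l) :
    d = Finset.univ ∧ κ = s.req + 1 ∧ s'.req = s.req + 1 ∧ ∃ a ph, s'.phase = .writing a ph τ := by
  cases h with
  | deliver s j m =>
    cases m with
    | value y => simp only [handle] at hm; split_ifs at hm <;> simp at hm
    | _ => simp_all [handle]
  | _ => simp_all [enter, addOwn]

/-- A step announces at most one good lattice operation, and before it sends anything else. Hence
the log up to the announcement is the log at the moment when the lattice operation ended. -/
lemma Micro.goodLA_mem (h : Micro f out ack p inp s l s') (d : Finset (Fin n)) (r : ℕ)
    (hm : (d, Msg.goodLA r) ∈ l) :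
    d = Finset.univ ∧ l.head? = some (Finset.univ, .goodLA r) ∧
      (∀ r', (d, Msg.goodLA r') ∈ l.tail → False) ∧ s'.V = s.V ∧ (∃ a ph, s.phase = .agreeing a ph r) ∧
      EQ f (fun j => upTo r (s.V j)) p ∧ s.maxTag ≤ r := by
  cases h with
  | deliver s j m =>
    cases m with
    | value y => simp only [handle] at hm; split_ifs at hm <;> simp at hm
    | _ => simp_all [handle]
  | _ => simp_all [enter]

/-- The client thread begins a new request. -/
lemma Micro.req_eq (h : Micro f out ack p inp s l s') : s'.req = s.req ∨
    (s'.req = s.req + 1 ∧ s'.acks = ∅ ∧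
      ((∃ a, inp = .invoke a ∧ s'.phase = .reading a ∧ s'.ackTag = 0 ∧
          l = [(Finset.univ, .readTag s'.req)]) ∨
        ∃ a ph r, s'.phase = .writing a ph r ∧ (Finset.univ, .writeTag s'.req r) ∈ l)) := by
  cases h with
  | deliver s j m =>
    cases m with
    | readAck => simp only [handle]; split_ifs <;> simp
    | writeAck => simp only [handle]; split_ifs <;> simp
    | _ => simp only [handle]; (try split_ifs) <;> simp
  | _ => simp [enter, addOwn]

/-- Without a new request, acknowledgements are only added. -/
lemma Micro.mem_acks (h : Micro f out ack p inp s l s') (hr : s'.req = s.req) (k : Fin n) :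
    k ∈ s'.acks ↔ k ∈ s.acks ∨ ∃ τ, inp = .receive k (.readAck s.req τ) ∨
      inp = .receive k (.writeAck s.req τ) := by
  cases h with
  | deliver s j m =>
    cases m with
    | readAck κ τ =>
      simp only [handle]; split_ifs with h
      · subst h; simp [eq_comm, or_comm]
      · simp [h]
    | writeAck κ τ =>
      simp only [handle]; split_ifs with h
      · subst h; simp [eq_comm, or_comm]
      · simp [h]
    | _ => simp [handle]
  | _ => first | (simp [enter, addOwn] at hr; done) | simp

lemma Micro.ackTag_le (h : Micro f out ack p inp s l s') (hr : s'.req = s.req) :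
    s.ackTag ≤ s'.ackTag := by
  cases h with
  | deliver s j m =>
    cases m with
    | readAck κ τ => simp only [handle]; split_ifs <;> simp
    | writeAck κ τ => simp only [handle]; split_ifs <;> simp
    | _ => simp [handle]
  | _ => first | (simp [enter, addOwn] at hr; done) | simp

lemma Micro.le_ackTag {k : Fin n} {τ : ℕ}
    (h : Micro f out ack p (.receive k (.readAck s.req τ)) s l s') :
    k ∈ s'.acks ∧ τ ≤ s'.ackTag := by
  cases h
  simp [handle]

lemma handle_phase (s : AsoState n U (Command U Q)) (j : Fin n) (m : Msg n U) :
    (handle (B := B) p s j m).state.phase = s.phase := by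
  cases m with
  | readAck κ τ => simp only [handle]; split_ifs <;> simp
  | writeAck κ τ => simp only [handle]; split_ifs <;> simp
  | _ => simp [handle]

/-- A message handler does not change the phase. -/
lemma Micro.receive_phase {j : Fin n} {m : Msg n U} (h : Micro f out ack p (.receive j m) s l s') :
    s'.phase = s.phase ∧ s'.req = s.req := by
  cases h
  cases m with
  | readAck κ τ => simp only [handle]; split_ifs <;> simp
  | writeAck κ τ => simp only [handle]; split_ifs <;> simp
  | _ => simp [handle]

lemma Micro.good_eq (h : Micro f out ack p inp s l s') :
    (s'.good = s.good ∧ s'.D = s.D ∧ ∀ j r, inp ≠ .receive j (.goodLA r)) ∨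
      ∃ j r, inp = .receive j (.goodLA r) := by
  cases h with
  | deliver s j m =>
    cases m with
    | readAck κ τ => simp only [handle]; split_ifs <;> simp
    | writeAck κ τ => simp only [handle]; split_ifs <;> simp
    | _ => simp [handle]
  | _ => simp [enter, addOwn]

end MicroLemmas


/-! ### Invariants of logs, channels and acknowledgements -/

section Invariants

variable {n : ℕ} {U Q B : Type*} {f : ℕ} {out : Q → Finset (Stamped n U) → B} {ack : B}
  {D : ℝ} {e : ℕ → Sys n U Q B}

/-- The initial state of a node. -/
def blank : AsoState n U (Command U Q) where
  V := fun _ => ∅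
  maxTag := 0
  D := fun _ => ∅
  good := fun _ => ∅
  req := 0
  acks := ∅
  ackTag := 0
  phase := .idle

/-- Node `p` performs a small step from `g` to `g'`. -/
structure Acts (f : ℕ) (out : Q → Finset (Stamped n U) → B) (ack : B) (g g' : Sys n U Q B)
    (p : Fin n) (inp : Input n U Q B) (l l' : List (Finset (Fin n) × Msg n U)) (dead : Bool)
    (s' : AsoState n U (Command U Q)) : Prop where
  alive : p ∉ g.crashed
  offers : g.Offers p inp
  micro : Micro f out ack p inp (g.loc p) l s'
  effective : Effective l l' dead
  few : dead = true → g.crashed.card < f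
  eq : g' = g.exec p inp l l' dead s'

/-- Time passes from `g` to `g'`. -/
structure Ticks (f : ℕ) (D : ℝ) (g g' : Sys n U Q B) : Prop where
  le : g.now ≤ g'.now
  chan : ∀ q p, p ∉ g.crashed → ∀ x ∈ g.chan q p, g'.now ≤ x.1 + D
  quiet : ∀ p, p ∉ g.crashed → Quiet f p (g.loc p)
  eq : g' = { g with now := g'.now }

lemma Execution.cases (he : Execution f out ack D e) (t : ℕ) :
    e (t + 1) = e t ∨ Ticks f D (e t) (e (t + 1)) ∨
      ∃ p inp l l' dead s', Acts f out ack (e t) (e (t + 1)) p inp l l' dead s' := by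
  have h := he.step t
  generalize e (t + 1) = g' at h
  cases h with
  | stay => exact Or.inl rfl
  | tick t h1 h2 h3 => exact Or.inr (Or.inl ⟨h1, h2, h3, rfl⟩)
  | act p inp l l' dead s' h1 h2 h3 h4 h5 =>
    exact Or.inr (Or.inr ⟨p, inp, l, l', dead, s', h1, h2, h3, h4, h5, rfl⟩)

lemma prefix_append_cases {α : Type*} {l a b : List α} (h : l <+: a ++ b) :
    l <+: a ∨ ∃ l', l = a ++ l' ∧ l' <+: b := by
  rcases List.prefix_or_prefix_of_prefix h (List.prefix_append a b) with h' | ⟨l', rfl⟩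
  · exact Or.inl h'
  · exact Or.inr ⟨l', rfl, (List.prefix_append_right_inj _).mp h⟩

section Acts

variable {g g' : Sys n U Q B} {p : Fin n} {inp : Input n U Q B}
  {l l' : List (Finset (Fin n) × Msg n U)} {dead : Bool} {s' : AsoState n U (Command U Q)}

lemma Acts.now (h : Acts f out ack g g' p inp l l' dead s') : g'.now = g.now := by
  rw [h.eq]; rfl

lemma Acts.loc_self (h : Acts f out ack g g' p inp l l' dead s') : g'.loc p = s' := by
  rw [h.eq]; simp [Sys.exec]

lemma Acts.loc_ne (h : Acts f out ack g g' p inp l l' dead s') {q : Fin n} (hq : q ≠ p) :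
    g'.loc q = g.loc q := by
  rw [h.eq]; simp [Sys.exec, hq]

lemma Acts.log_self (h : Acts f out ack g g' p inp l l' dead s') : g'.log p = g.log p ++ l := by
  rw [h.eq]; simp [Sys.exec]

lemma Acts.log_ne (h : Acts f out ack g g' p inp l l' dead s') {q : Fin n} (hq : q ≠ p) :
    g'.log q = g.log q := by
  rw [h.eq]; simp [Sys.exec, hq]

lemma Acts.got_self (h : Acts f out ack g g' p inp l l' dead s') :
    g'.got p = inp.gets (g.got p) := by
  rw [h.eq]; simp [Sys.exec]

lemma Acts.got_ne (h : Acts f out ack g g' p inp l l' dead s') {q : Fin n} (hq : q ≠ p) :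
    g'.got q = g.got q := by
  rw [h.eq]; simp [Sys.exec, hq]

lemma Acts.crashed (h : Acts f out ack g g' p inp l l' dead s') :
    g'.crashed = if dead then insert p g.crashed else g.crashed := by
  rw [h.eq]; rfl

lemma Acts.chan (h : Acts f out ack g g' p inp l l' dead s') (q r : Fin n) :
    g'.chan q r = inp.rest p q r (g.chan q r) ++
      if q = p then (l'.filter fun x => r ∈ x.1).map fun x => (g.now, x.2) else [] := by
  rw [h.eq]; rfl

lemma Acts.history (h : Acts f out ack g g' p inp l l' dead s') :
    g'.history = g.history ++ inp.event p dead := by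
  rw [h.eq]; rfl

lemma Acts.crashed_subset (h : Acts f out ack g g' p inp l l' dead s') :
    g.crashed ⊆ g'.crashed := by
  rw [h.crashed]
  split_ifs
  · exact Finset.subset_insert _ _
  · exact subset_rfl

end Acts

lemma Execution.node_cases (he : Execution f out ack D e) (t : ℕ) (p : Fin n) :
    ((e (t + 1)).loc p = (e t).loc p ∧ (e (t + 1)).log p = (e t).log p ∧
        (e (t + 1)).got p = (e t).got p) ∨
      ∃ inp l l' dead s', Acts f out ack (e t) (e (t + 1)) p inp l l' dead s' := by
  rcases he.cases t with h | h | ⟨q, inp, l, l', dead, s', h⟩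
  · rw [h]; simp
  · rw [h.eq]; simp
  · by_cases hq : p = q
    · subst hq
      exact Or.inr ⟨inp, l, l', dead, s', h⟩
    · exact Or.inl ⟨h.loc_ne hq, h.log_ne hq, h.got_ne hq⟩

lemma Execution.log_zero (he : Execution f out ack D e) (p : Fin n) : (e 0).log p = [] := by
  rw [he.zero]; rfl

lemma Execution.loc_zero (he : Execution f out ack D e) (p : Fin n) : (e 0).loc p =
    blank := by
  rw [he.zero]; rfl

/-- Induction for properties of a single node. -/
lemma Execution.local_induction (he : Execution f out ack D e) (p : Fin n)
    {P : AsoState n U (Command U Q) → List (Finset (Fin n) × Msg n U) →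
      (Fin n → List (Msg n U)) → Prop}
    (zero : P blank [] fun _ => [])
    (step : ∀ t inp l s', Micro f out ack p inp ((e t).loc p) l s' →
      P ((e t).loc p) ((e t).log p) ((e t).got p) →
      P s' ((e t).log p ++ l) (inp.gets ((e t).got p))) (t : ℕ) :
    P ((e t).loc p) ((e t).log p) ((e t).got p) := by
  induction t with
  | zero => rw [he.zero]; exact zero
  | succ t ih =>
    rcases he.node_cases t p with ⟨h1, h2, h3⟩ | ⟨inp, l, l', dead, s', h⟩
    · rwa [h1, h2, h3]
    · rw [h.loc_self, h.log_self, h.got_self]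
      exact step t inp l s' h.micro ih

lemma Input.mem_gets (inp : Input n U Q B) (l : Fin n → List (Msg n U)) (q : Fin n)
    (m : Msg n U) : m ∈ inp.gets l q ↔ m ∈ l q ∨ inp = .receive q m := by
  cases inp with
  | receive q' m' =>
    simp only [Input.gets, Function.update_apply]
    split_ifs with h
    · subst h; simp [eq_comm]
    · simp [Ne.symm h]
  | _ => simp [Input.gets]

lemma Execution.mem_V_self (he : Execution f out ack D e) (t : ℕ) (p : Fin n) (x : Stamped n U) :
    x ∈ ((e t).loc p).V p ↔ (Finset.univ, .value x) ∈ (e t).log p := by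
  refine he.local_induction p (P := fun s lg _ => x ∈ s.V p ↔ (Finset.univ, .value x) ∈ lg)
    (by simp [blank]) (fun t inp l s' hm ih => ?_) t
  rw [hm.mem_V, List.mem_append, hm.value_mem, ih]
  grind

lemma Execution.value_univ (he : Execution f out ack D e) (t : ℕ) (p : Fin n) (d : Finset (Fin n))
    (x : Stamped n U) :
    (d, .value x) ∈ (e t).log p → d = Finset.univ := by
  refine he.local_induction p (P := fun s lg _ => (d, .value x) ∈ lg → d = Finset.univ)
    (by simp) (fun t inp l s' hm ih => ?_) t
  rw [List.mem_append, hm.value_mem]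
  grind

/-- The case `q = p` is different, because `V p` also collects what arrives from all other nodes. -/
lemma Execution.mem_V_of_ne (he : Execution f out ack D e) (t : ℕ) {p q : Fin n} (hq : q ≠ p)
    (x : Stamped n U) :
    x ∈ ((e t).loc p).V q ↔ .value x ∈ (e t).got p q := by
  refine he.local_induction p (P := fun s _ gt => x ∈ s.V q ↔ .value x ∈ gt q)
    (by simp [blank]) (fun t inp l s' hm ih => ?_) t
  rw [hm.mem_V, Input.mem_gets, ih]
  grind

lemma Execution.mem_V_of_got (he : Execution f out ack D e) (t : ℕ) {p q : Fin n}
    (x : Stamped n U) :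
    .value x ∈ (e t).got p q → x ∈ ((e t).loc p).V p := by
  refine he.local_induction p (P := fun s _ gt => .value x ∈ gt q → x ∈ s.V p)
    (by simp [blank]) (fun t inp l s' hm ih => ?_) t
  rw [hm.mem_V, Input.mem_gets]
  grind

/-- A tag is echoed in the step that merges it into `maxTag`, which never decreases. So an echo in
the log of a node testifies that the node has seen the tag. -/
lemma Execution.echoTag_log (he : Execution f out ack D e) (t : ℕ) (p : Fin n)
    (d : Finset (Fin n)) (τ : ℕ) :
    (d, .echoTag τ) ∈ (e t).log p → d = Finset.univ ∧ τ ≤ ((e t).loc p).maxTag := by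
  refine he.local_induction p
    (P := fun s lg _ => (d, .echoTag τ) ∈ lg → d = Finset.univ ∧ τ ≤ s.maxTag)
    (by simp [blank]) (fun t inp l s' hm ih => ?_) t
  rw [List.mem_append]
  rintro (h | h)
  · exact ⟨(ih h).1, (ih h).2.trans hm.maxTag_le⟩
  · obtain ⟨h1, j, κ, rfl⟩ := hm.echoTag_mem d τ h
    refine ⟨h1, ?_⟩
    rw [hm.of_writeTag.2]
    exact le_max_right _ _

lemma Execution.echoTag_got (he : Execution f out ack D e) (t : ℕ) (p q : Fin n) (τ : ℕ) :
    .echoTag τ ∈ (e t).got p q → τ ≤ ((e t).loc p).maxTag := by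
  refine he.local_induction p (P := fun s _ gt => .echoTag τ ∈ gt q → τ ≤ s.maxTag)
    (by simp [blank]) (fun t inp l s' hm ih => ?_) t
  rw [Input.mem_gets]
  rintro (h | rfl)
  · exact (ih h).trans hm.maxTag_le
  · rw [hm.of_echoTag.2]
    exact le_max_right _ _

lemma Execution.writeAck_log (he : Execution f out ack D e) (t : ℕ) (p : Fin n)
    (d : Finset (Fin n)) (κ τ : ℕ) :
    (d, .writeAck κ τ) ∈ (e t).log p → ∃ j, d = {j} ∧ .writeTag κ τ ∈ (e t).got p j := by
  refine he.local_induction p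
    (P := fun _ lg gt => (d, .writeAck κ τ) ∈ lg → ∃ j, d = {j} ∧ .writeTag κ τ ∈ gt j)
    (by simp) (fun t inp l s' hm ih => ?_) t
  simp only [List.mem_append, Input.mem_gets]
  rintro (h | h)
  · obtain ⟨j, h1, h2⟩ := ih h
    exact ⟨j, h1, Or.inl h2⟩
  · obtain ⟨j, h1, h2⟩ := hm.writeAck_mem d κ τ h
    exact ⟨j, h1, Or.inr h2⟩

lemma Execution.readAck_log (he : Execution f out ack D e) (t : ℕ) (p : Fin n)
    (d : Finset (Fin n)) (κ τ : ℕ) :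
    (d, .readAck κ τ) ∈ (e t).log p → ∃ j, d = {j} ∧ .readTag κ ∈ (e t).got p j := by
  refine he.local_induction p
    (P := fun _ lg gt => (d, .readAck κ τ) ∈ lg → ∃ j, d = {j} ∧ .readTag κ ∈ gt j)
    (by simp) (fun t inp l s' hm ih => ?_) t
  simp only [List.mem_append, Input.mem_gets]
  rintro (h | h)
  · obtain ⟨j, h1, h2⟩ := ih h
    exact ⟨j, h1, Or.inl h2⟩
  · obtain ⟨j, h1, h2, -⟩ := hm.readAck_mem d κ τ h
    exact ⟨j, h1, Or.inr h2⟩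

/-- The echo of a tag is sent before the acknowledgement. -/
lemma Execution.echo_before_ack (he : Execution f out ack D e) (t : ℕ) (p : Fin n)
    (d : Finset (Fin n)) (κ τ : ℕ)
    (L : List (Finset (Fin n) × Msg n U)) (hL : L <+: (e t).log p) (h : (d, .writeAck κ τ) ∈ L) :
    (Finset.univ, .echoTag τ) ∈ L := by
  revert L
  refine he.local_induction p
    (P := fun _ lg _ => ∀ L, L <+: lg → (d, .writeAck κ τ) ∈ L → (Finset.univ, .echoTag τ) ∈ L)
    ?_ (fun t inp l s' hm ih L hL h => ?_) t
  · intro L hL h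
    rw [List.prefix_nil.mp hL] at h
    simp at h
  · rcases prefix_append_cases hL with hL | ⟨L', rfl, hL'⟩
    · exact ih L hL h
    · rcases List.mem_append.mp h with h | h
      · exact List.mem_append_left _ (ih _ List.prefix_rfl h)
      · obtain ⟨j, h1, rfl⟩ := hm.writeAck_mem d κ τ (hL'.subset h)
        obtain ⟨rfl, -⟩ := hm.of_writeTag
        rcases L' with _ | ⟨y, L'⟩
        · simp at h
        · obtain ⟨rfl, -⟩ := List.cons_prefix_cons.mp hL'
          simp

/-- The bound by the counter dates messages: a request whose number exceeds the counter at some time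
had not been made by then, and neither had its acknowledgements. -/
lemma Execution.readTag_log (he : Execution f out ack D e) (t : ℕ) (p : Fin n)
    (d : Finset (Fin n)) (κ : ℕ) :
    (d, .readTag κ) ∈ (e t).log p → d = Finset.univ ∧ κ ≤ ((e t).loc p).req := by
  refine he.local_induction p
    (P := fun s lg _ => (d, .readTag κ) ∈ lg → d = Finset.univ ∧ κ ≤ s.req)
    (by simp [blank]) (fun t inp l s' hm ih => ?_) t
  rw [List.mem_append]
  rintro (h | h)
  · refine ⟨(ih h).1, (ih h).2.trans ?_⟩
    rcases hm.req_eq with h | h <;> omega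
  · obtain ⟨h1, h2, h3, -⟩ := hm.readTag_mem d κ h
    exact ⟨h1, by omega⟩

lemma Execution.writeTag_log (he : Execution f out ack D e) (t : ℕ) (p : Fin n)
    (d : Finset (Fin n)) (κ τ : ℕ) :
    (d, .writeTag κ τ) ∈ (e t).log p → d = Finset.univ ∧ κ ≤ ((e t).loc p).req := by
  refine he.local_induction p
    (P := fun s lg _ => (d, .writeTag κ τ) ∈ lg → d = Finset.univ ∧ κ ≤ s.req)
    (by simp [blank]) (fun t inp l s' hm ih => ?_) t
  rw [List.mem_append]
  rintro (h | h)
  · refine ⟨(ih h).1, (ih h).2.trans ?_⟩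
    rcases hm.req_eq with h | h <;> omega
  · obtain ⟨h1, h2, h3, -⟩ := hm.writeTag_mem d κ τ h
    exact ⟨h1, by omega⟩

lemma Execution.mem_good (he : Execution f out ack D e) (t : ℕ) (p q : Fin n) (r : ℕ) :
    r ∈ ((e t).loc p).good q ↔ .goodLA r ∈ (e t).got p q := by
  refine he.local_induction p (P := fun s _ gt => r ∈ s.good q ↔ .goodLA r ∈ gt q)
    (by simp [blank]) (fun t inp l s' hm ih => ?_) t
  rw [Input.mem_gets]
  rcases hm.good_eq with ⟨h1, -, h2⟩ | ⟨j, r', rfl⟩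
  · rw [h1, ih]
    simp [h2]
  · rw [hm.of_goodLA.2, ← ih]
    simp only [Function.update_apply]
    split_ifs with h
    · subst h
      simp [or_comm, eq_comm]
    · simp [Ne.symm h]

lemma Execution.exists_readAck (he : Execution f out ack D e) (t : ℕ) (p q : Fin n) (κ : ℕ) :
    .readTag κ ∈ (e t).got p q → ∃ τ, ({q}, .readAck κ τ) ∈ (e t).log p := by
  refine he.local_induction p
    (P := fun _ lg gt => .readTag κ ∈ gt q → ∃ τ, ({q}, .readAck κ τ) ∈ lg)
    (by simp) (fun t inp l s' hm ih => ?_) t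
  simp only [Input.mem_gets, List.mem_append]
  rintro (h | rfl)
  · obtain ⟨τ, h⟩ := ih h
    exact ⟨τ, Or.inl h⟩
  · rw [hm.of_readTag.1]
    exact ⟨((e t).loc p).maxTag, Or.inr (by simp)⟩

lemma Execution.exists_writeAck (he : Execution f out ack D e) (t : ℕ) (p q : Fin n) (κ τ : ℕ) :
    .writeTag κ τ ∈ (e t).got p q → ({q}, .writeAck κ τ) ∈ (e t).log p := by
  refine he.local_induction p
    (P := fun _ lg gt => .writeTag κ τ ∈ gt q → ({q}, .writeAck κ τ) ∈ lg)
    (by simp) (fun t inp l s' hm ih => ?_) t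
  simp only [Input.mem_gets, List.mem_append]
  rintro (h | rfl)
  · exact Or.inl (ih h)
  · rw [hm.of_writeTag.1]
    exact Or.inr (by simp)

/-- The messages to `p` among the effects of `send` commands. -/
def msgsTo (p : Fin n) (l : List (Finset (Fin n) × Msg n U)) : List (Msg n U) :=
  (l.filter fun x => p ∈ x.1).map Prod.snd

lemma msgsTo_append (p : Fin n) (l l' : List (Finset (Fin n) × Msg n U)) :
    msgsTo p (l ++ l') = msgsTo p l ++ msgsTo p l' := by
  simp [msgsTo]

lemma mem_msgsTo {p : Fin n} {l : List (Finset (Fin n) × Msg n U)} {m : Msg n U} :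
    m ∈ msgsTo p l ↔ ∃ d, (d, m) ∈ l ∧ p ∈ d := by
  simp [msgsTo]

lemma Interrupted.msgsTo_prefix {l l' : List (Finset (Fin n) × Msg n U)} (h : Interrupted l l')
    (p : Fin n) : msgsTo p l' <+: msgsTo p l := by
  induction h with
  | none => exact List.nil_prefix
  | part d d' m l hd =>
    simp only [msgsTo, List.filter_cons, List.filter_nil, decide_eq_true_eq]
    by_cases h : p ∈ d'
    · simp [h, hd h]
    · simp [h]
  | next x l l' _ ih =>
    rw [← List.singleton_append, ← List.singleton_append (l := l), msgsTo_append, msgsTo_append]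
    exact (List.prefix_append_right_inj _).mpr ih

/-- A prefix of the messages to `p` comes from a prefix of the `send` commands. -/
lemma exists_of_prefix_msgsTo {p : Fin n} {l : List (Finset (Fin n) × Msg n U)}
    {k : List (Msg n U)} (h : k <+: msgsTo p l) : ∃ L, L <+: l ∧ msgsTo p L = k := by
  induction l generalizing k with
  | nil => exact ⟨[], List.prefix_rfl, by simpa [msgsTo, eq_comm] using h⟩
  | cons x l ih =>
    rcases k with _ | ⟨m, k⟩
    · exact ⟨[], List.nil_prefix, rfl⟩
    · by_cases hx : p ∈ x.1
      · have hh : msgsTo p (x :: l) = x.2 :: msgsTo p l := by simp [msgsTo, hx]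
        rw [hh, List.cons_prefix_cons] at h
        obtain ⟨L, h1, h2⟩ := ih h.2
        refine ⟨x :: L, List.cons_prefix_cons.mpr ⟨rfl, h1⟩, ?_⟩
        rw [h.1, ← h2]
        simp [msgsTo, hx]
      · have hh : msgsTo p (x :: l) = msgsTo p l := by simp [msgsTo, hx]
        rw [hh] at h
        obtain ⟨L, h1, h2⟩ := ih h
        refine ⟨x :: L, List.cons_prefix_cons.mpr ⟨rfl, h1⟩, ?_⟩
        rw [← h2]
        simp [msgsTo, hx]

/-- The next message to `p` comes from some `send` command. -/
lemma exists_of_prefix_msgsTo_concat {p : Fin n} {l : List (Finset (Fin n) × Msg n U)}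
    {k : List (Msg n U)} {m : Msg n U} (h : k ++ [m] <+: msgsTo p l) :
    ∃ L d, L ++ [(d, m)] <+: l ∧ p ∈ d ∧ msgsTo p L = k := by
  induction l generalizing k with
  | nil => simp [msgsTo] at h
  | cons x l ih =>
    by_cases hx : p ∈ x.1
    · have hh : msgsTo p (x :: l) = x.2 :: msgsTo p l := by simp [msgsTo, hx]
      rw [hh] at h
      rcases k with _ | ⟨m', k⟩
      · obtain ⟨h, -⟩ := List.cons_prefix_cons.mp h
        exact ⟨[], x.1, by simp [h], hx, rfl⟩
      · rw [List.cons_append, List.cons_prefix_cons] at h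
        obtain ⟨L, d, h1, h2, h3⟩ := ih h.2
        refine ⟨x :: L, d, List.cons_prefix_cons.mpr ⟨rfl, h1⟩, h2, ?_⟩
        rw [h.1, ← h3]
        simp [msgsTo, hx]
    · have hh : msgsTo p (x :: l) = msgsTo p l := by simp [msgsTo, hx]
      rw [hh] at h
      obtain ⟨L, d, h1, h2, h3⟩ := ih h
      refine ⟨x :: L, d, List.cons_prefix_cons.mpr ⟨rfl, h1⟩, h2, ?_⟩
      rw [← h3]
      simp [msgsTo, hx]

/-- All messages sent from `q` to `p`. -/
def Sys.sent (g : Sys n U Q B) (q p : Fin n) : List (Msg n U) :=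
  g.got p q ++ (g.chan q p).map Prod.snd

lemma Acts.effective_eq {g g' : Sys n U Q B} {p : Fin n} {inp : Input n U Q B}
    {l l' : List (Finset (Fin n) × Msg n U)} {dead : Bool} {s' : AsoState n U (Command U Q)}
    (h : Acts f out ack g g' p inp l l' dead s') (hd : p ∉ g'.crashed) :
    l' = l := by
  rw [h.crashed] at hd
  have := h.effective
  rcases dead with _ | _
  · simpa [Effective] using this
  · simp at hd

lemma Acts.msgsTo_effective {g g' : Sys n U Q B} {p : Fin n} {inp : Input n U Q B}
    {l l' : List (Finset (Fin n) × Msg n U)} {dead : Bool} {s' : AsoState n U (Command U Q)}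
    (h : Acts f out ack g g' p inp l l' dead s') (r : Fin n) : msgsTo r l' <+: msgsTo r l := by
  have := h.effective
  rcases dead with _ | _
  · have h : l' = l := by simpa [Effective] using this
    rw [h]
  · exact Interrupted.msgsTo_prefix this r

lemma Acts.sent {g g' : Sys n U Q B} {p : Fin n} {inp : Input n U Q B}
    {l l' : List (Finset (Fin n) × Msg n U)} {dead : Bool} {s' : AsoState n U (Command U Q)}
    (h : Acts f out ack g g' p inp l l' dead s') (q r : Fin n) :
    g'.sent q r = g.sent q r ++ if q = p then msgsTo r l' else [] := by
  have h1 : g'.got r q ++ (inp.rest p q r (g.chan q r)).map Prod.snd = g.sent q r := by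
    have h2 := h.offers
    by_cases hr : r = p
    · subst hr
      rw [h.got_self]
      cases inp with
      | receive q' m =>
        obtain ⟨σ, h2⟩ := h2
        simp only [Input.gets, Input.rest, Sys.sent, Function.update_apply]
        split_ifs with h3 h4
        · subst h3
          obtain ⟨c, hc⟩ := List.head?_eq_some_iff.mp h2
          simp [hc]
        · simp_all
        · simp_all
        · rfl
      | _ => rfl
    · rw [h.got_ne hr]
      cases inp with
      | receive q' m => simp [Input.rest, Sys.sent, hr]
      | _ => rfl
  rw [Sys.sent, h.chan, List.map_append, ← List.append_assoc, h1]
  congr 1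
  split_ifs with hq
  · simp [msgsTo, Function.comp_def]
  · rfl

/-- The log records a whole step even if the node crashes in it. An interruption cuts off a final
segment of the messages to each receiver, so only equality is lost, and only for crashed senders. -/
lemma Execution.sent_log (he : Execution f out ack D e) (t : ℕ) (q p : Fin n) :
    (e t).sent q p <+: msgsTo p ((e t).log q) ∧
      (q ∉ (e t).crashed → (e t).sent q p = msgsTo p ((e t).log q)) := by
  induction t with
  | zero => rw [he.zero]; simp [Sys.sent, Sys.initial, Config.initial, msgsTo]
  | succ t ih =>
    rcases he.cases t with h | h | ⟨r, inp, l, l', dead, s', h⟩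
    · rwa [h]
    · rw [h.eq]; exact ih
    · rw [h.sent]
      by_cases hq : q = r
      · subst hq
        rw [if_pos rfl, h.log_self, msgsTo_append, ih.2 h.alive]
        refine ⟨(List.prefix_append_right_inj _).mpr (h.msgsTo_effective p), fun hq => ?_⟩
        rw [h.effective_eq hq]
      · rw [if_neg hq, h.log_ne hq, List.append_nil]
        exact ⟨ih.1, fun hq => ih.2 fun h' => hq (h.crashed_subset h')⟩

/-- FIFO order enters here: messages are taken from the front of the channel, so those received
precede those in transit. -/
lemma Execution.got_prefix (he : Execution f out ack D e) (t : ℕ) (p q : Fin n) :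
    (e t).got p q <+: msgsTo p ((e t).log q) :=
  (List.prefix_append _ _).trans (he.sent_log t q p).1

lemma Execution.exists_log_of_got (he : Execution f out ack D e) {t : ℕ} {p q : Fin n}
    {m : Msg n U} (h : m ∈ (e t).got p q) : ∃ d, (d, m) ∈ (e t).log q ∧ p ∈ d :=
  mem_msgsTo.mp ((he.got_prefix t p q).subset h)

lemma Execution.exists_log_of_chan (he : Execution f out ack D e) {t : ℕ} {p q : Fin n}
    {x : ℝ × Msg n U} (h : x ∈ (e t).chan q p) : ∃ d, (d, x.2) ∈ (e t).log q ∧ p ∈ d :=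
  mem_msgsTo.mp ((he.sent_log t q p).1.subset
    (List.mem_append_right _ (List.mem_map_of_mem h)))

/-- Acknowledgements answer requests. -/
lemma Execution.writeTag_of_writeAck (he : Execution f out ack D e) {t : ℕ} {p k : Fin n}
    {κ τ : ℕ} {d : Finset (Fin n)} (h : (d, .writeAck κ τ) ∈ (e t).log k) (hp : p ∈ d) :
    (Finset.univ, .writeTag κ τ) ∈ (e t).log p := by
  obtain ⟨j, rfl, h1⟩ := he.writeAck_log t k d κ τ h
  obtain rfl := Finset.mem_singleton.mp hp
  obtain ⟨d, h2, -⟩ := he.exists_log_of_got h1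
  obtain ⟨rfl, -⟩ := he.writeTag_log t p d κ τ h2
  exact h2

lemma Execution.readTag_of_readAck (he : Execution f out ack D e) {t : ℕ} {p k : Fin n}
    {κ τ : ℕ} {d : Finset (Fin n)} (h : (d, .readAck κ τ) ∈ (e t).log k) (hp : p ∈ d) :
    (Finset.univ, .readTag κ) ∈ (e t).log p := by
  obtain ⟨j, rfl, h1⟩ := he.readAck_log t k d κ τ h
  obtain rfl := Finset.mem_singleton.mp hp
  obtain ⟨d, h2, -⟩ := he.exists_log_of_got h1
  obtain ⟨rfl, -⟩ := he.readTag_log t p d κ h2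
  exact h2

/-- The acknowledgements of the current request. -/
lemma Execution.mem_acks (he : Execution f out ack D e) (t : ℕ) (p k : Fin n) :
    (k ∈ ((e t).loc p).acks ↔ ∃ τ, .readAck ((e t).loc p).req τ ∈ (e t).got p k ∨
        .writeAck ((e t).loc p).req τ ∈ (e t).got p k) ∧
      ∀ τ, .readAck ((e t).loc p).req τ ∈ (e t).got p k → τ ≤ ((e t).loc p).ackTag := by
  refine he.local_induction p (P := fun s _ gt => (k ∈ s.acks ↔ ∃ τ, .readAck s.req τ ∈ gt k ∨
        .writeAck s.req τ ∈ gt k) ∧ ∀ τ, .readAck s.req τ ∈ gt k → τ ≤ s.ackTag)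
    (by simp [blank]) (fun t inp l s' hm ih => ?_) t
  simp only [Input.mem_gets]
  rcases hm.req_eq with h | ⟨h1, h2, h3⟩
  · rw [h, hm.mem_acks h, ih.1]
    refine ⟨by grind, ?_⟩
    rintro τ (h4 | rfl)
    · exact (ih.2 τ h4).trans (hm.ackTag_le h)
    · exact hm.le_ackTag.2
  -- A new request has a number larger than all earlier ones, so no acknowledgement of it can have
  -- arrived already.
  · have h4 : ∀ τ, .readAck s'.req τ ∉ (e t).got p k := by
      intro τ hτ
      obtain ⟨d, h5, h6⟩ := he.exists_log_of_got hτ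
      have := (he.readTag_log t p _ _ (he.readTag_of_readAck h5 h6)).2
      omega
    have h5 : ∀ τ, .writeAck s'.req τ ∉ (e t).got p k := by
      intro τ hτ
      obtain ⟨d, h5, h6⟩ := he.exists_log_of_got hτ
      have := (he.writeTag_log t p _ _ _ (he.writeTag_of_writeAck h5 h6)).2
      omega
    have h6 : ∀ m, inp ≠ .receive k m := by
      rintro m rfl
      have := hm.receive_phase.2
      omega
    simp [h2, h4, h5, h6]

/-- The request that corresponds to the phase of the client thread. -/
lemma Execution.request_reading (he : Execution f out ack D e) (t : ℕ) (p : Fin n)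
    (a : Command U Q) : ((e t).loc p).phase = .reading a →
      (Finset.univ, .readTag ((e t).loc p).req) ∈ (e t).log p ∧
        ∀ d τ, (d, .writeTag ((e t).loc p).req τ) ∉ (e t).log p := by
  refine he.local_induction p (P := fun s lg _ => s.phase = .reading a →
      (Finset.univ, .readTag s.req) ∈ lg ∧ ∀ d τ, (d, .writeTag s.req τ) ∉ lg)
    (by simp [blank]) (fun t inp l s' hm ih hs => ?_) t
  have hw : ∀ d τ, (d, .writeTag s'.req τ) ∉ l := by
    intro d τ hd
    obtain ⟨-, -, -, a', ph, h⟩ := hm.writeTag_mem d _ τ hd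
    rw [h] at hs
    cases hs
  rcases hm.req_eq with h | ⟨h1, h2, h3⟩
  · have h' : ((e t).loc p).phase = .reading a := by
      cases hm with
      | deliver s q m =>
        rw [← hs, handle_phase]
      | skip => exact hs
      | start => simp at h
      | _ => simp [enter] at hs
    obtain ⟨h3, h4⟩ := ih h'
    rw [h] at hw ⊢
    refine ⟨List.mem_append_left _ h3, fun d τ hd => ?_⟩
    rcases List.mem_append.mp hd with hd | hd
    · exact h4 d τ hd
    · exact hw d τ hd
  · have h5 : ∀ d τ, (d, .writeTag s'.req τ) ∉ (e t).log p := by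
      intro d τ hd
      have := (he.writeTag_log t p _ _ _ hd).2
      omega
    refine ⟨?_, fun d τ hd => ?_⟩
    · rcases h3 with ⟨a', -, -, -, h3⟩ | ⟨a', ph, r, h3, -⟩
      · rw [h3]; simp
      · rw [h3] at hs; cases hs
    · rcases List.mem_append.mp hd with hd | hd
      · exact h5 d τ hd
      · exact hw d τ hd

/-- Each number belongs to a single request. Hence the acknowledgements counted in this phase are
those of a `writeTag` request, and of one with tag `r`. -/
lemma Execution.request_writing (he : Execution f out ack D e) (t : ℕ) (p : Fin n)
    (a : Command U Q) (ph r : ℕ) :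
    ((e t).loc p).phase = .writing a ph r ∨ ((e t).loc p).phase = .agreeing a ph r →
      (Finset.univ, .writeTag ((e t).loc p).req r) ∈ (e t).log p ∧
        (∀ d, (d, .readTag ((e t).loc p).req) ∉ (e t).log p) ∧
        ∀ d τ, (d, .writeTag ((e t).loc p).req τ) ∈ (e t).log p → τ = r := by
  refine he.local_induction p (P := fun s lg _ => s.phase = .writing a ph r ∨
      s.phase = .agreeing a ph r → (Finset.univ, .writeTag s.req r) ∈ lg ∧
        (∀ d, (d, .readTag s.req) ∉ lg) ∧ ∀ d τ, (d, .writeTag s.req τ) ∈ lg → τ = r)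
    (by simp [blank]) (fun t inp l s' hm ih hs => ?_) t
  have hr : ∀ d, (d, .readTag s'.req) ∉ l := by
    intro d hd
    obtain ⟨-, -, -, a', -, h⟩ := hm.readTag_mem d _ hd
    rw [h] at hs
    simp at hs
  have hw : ∀ d τ, (d, .writeTag s'.req τ) ∈ l → τ = r := by
    intro d τ hd
    obtain ⟨-, -, -, a', ph, h⟩ := hm.writeTag_mem d _ τ hd
    rw [h] at hs
    simp at hs
    exact hs.2.2
  rcases hm.req_eq with h | ⟨h1, h2, h3⟩
  · have h' : ((e t).loc p).phase = .writing a ph r ∨ ((e t).loc p).phase = .agreeing a ph r := by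
      cases hm with
      | deliver s q m =>
        rwa [handle_phase] at hs
      | skip => exact hs
      -- No new request is made when `writing` turns into `agreeing`, so the request of the former
      -- phase is still the current one.
      | written _ a' ph' r' h4 h5 =>
        simp only [reduceCtorEq, Phase.agreeing.injEq, false_or] at hs
        obtain ⟨rfl, rfl, rfl⟩ := hs
        exact Or.inl h4
      | start => simp at h
      | _ => first | (simp [enter, addOwn] at h; done) | (simp at hs)
    obtain ⟨h3, h4, h5⟩ := ih h'
    rw [h] at hw hr ⊢
    refine ⟨List.mem_append_left _ h3, fun d hd => ?_, fun d τ hd => ?_⟩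
    · rcases List.mem_append.mp hd with hd | hd
      · exact h4 d hd
      · exact hr d hd
    · rcases List.mem_append.mp hd with hd | hd
      · exact h5 d τ hd
      · exact hw d τ hd
  · refine ⟨?_, fun d hd => ?_, fun d τ hd => ?_⟩
    · rcases h3 with ⟨a', -, h3, -, -⟩ | ⟨a', ph, r', h3, h4⟩
      · rw [h3] at hs; simp at hs
      · obtain rfl := hw _ _ h4
        exact List.mem_append_right _ h4
    · rcases List.mem_append.mp hd with hd | hd
      · have := (he.readTag_log t p _ _ hd).2
        omega
      · exact hr d hd
    · rcases List.mem_append.mp hd with hd | hd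
      · have := (he.writeTag_log t p _ _ _ hd).2
        omega
      · exact hw d τ hd

end Invariants


/-! ### Quantities that are monotone along an execution -/

section Monotonicity

variable {n : ℕ} {U Q B : Type*} {f : ℕ} {out : Q → Finset (Stamped n U) → B} {ack : B}
  {D : ℝ} {e : ℕ → Sys n U Q B}

lemma Execution.log_mono (he : Execution f out ack D e) {t t' : ℕ} (h : t ≤ t') (p : Fin n) :
    (e t).log p <+: (e t').log p := by
  induction t', h using Nat.le_induction with
  | base => exact List.prefix_rfl
  | succ t' _ ih =>
    refine ih.trans ?_
    rcases he.node_cases t' p with ⟨-, h, -⟩ | ⟨inp, l, l', dead, s', h⟩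
    · rw [h]
    · rw [h.log_self]; exact List.prefix_append _ _

lemma Execution.maxTag_mono (he : Execution f out ack D e) {t t' : ℕ} (h : t ≤ t') (p : Fin n) :
    ((e t).loc p).maxTag ≤ ((e t').loc p).maxTag := by
  induction t', h using Nat.le_induction with
  | base => exact le_rfl
  | succ t' _ ih =>
    refine ih.trans ?_
    rcases he.node_cases t' p with ⟨h, -, -⟩ | ⟨inp, l, l', dead, s', h⟩
    · rw [h]
    · rw [h.loc_self]; exact h.micro.maxTag_le

lemma Micro.req_le {p : Fin n} {inp : Input n U Q B} {s s' : AsoState n U (Command U Q)}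
    {l : List (Finset (Fin n) × Msg n U)} (h : Micro f out ack p inp s l s') : s.req ≤ s'.req := by
  rcases h.req_eq with h | h <;> omega

lemma Execution.req_mono (he : Execution f out ack D e) {t t' : ℕ} (h : t ≤ t') (p : Fin n) :
    ((e t).loc p).req ≤ ((e t').loc p).req := by
  induction t', h using Nat.le_induction with
  | base => exact le_rfl
  | succ t' _ ih =>
    refine ih.trans ?_
    rcases he.node_cases t' p with ⟨h, -, -⟩ | ⟨inp, l, l', dead, s', h⟩
    · rw [h]
    · rw [h.loc_self]; exact h.micro.req_le

lemma Execution.V_mono (he : Execution f out ack D e) {t t' : ℕ} (h : t ≤ t') (p q : Fin n) :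
    ((e t).loc p).V q ⊆ ((e t').loc p).V q := by
  induction t', h using Nat.le_induction with
  | base => exact subset_rfl
  | succ t' _ ih =>
    refine ih.trans ?_
    rcases he.node_cases t' p with ⟨h, -, -⟩ | ⟨inp, l, l', dead, s', h⟩
    · rw [h]
    · rw [h.loc_self]; exact fun x hx => (h.micro.mem_V q x).mpr (Or.inl hx)

lemma Execution.history_mono (he : Execution f out ack D e) {t t' : ℕ} (h : t ≤ t') :
    (e t).history <+: (e t').history := by
  induction t', h using Nat.le_induction with
  | base => exact List.prefix_rfl
  | succ t' _ ih =>
    refine ih.trans ?_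
    rcases he.cases t' with h | h | ⟨q, inp, l, l', dead, s', h⟩
    · rw [h]
    · rw [h.eq]
    · rw [h.history]; exact List.prefix_append _ _

lemma Execution.now_mono (he : Execution f out ack D e) {t t' : ℕ} (h : t ≤ t') :
    (e t).now ≤ (e t').now := by
  induction t', h using Nat.le_induction with
  | base => exact le_rfl
  | succ t' _ ih =>
    refine ih.trans ?_
    rcases he.cases t' with h | h | ⟨q, inp, l, l', dead, s', h⟩
    · rw [h]
    · exact h.le
    · rw [h.now]

lemma Execution.crashed_mono (he : Execution f out ack D e) {t t' : ℕ} (h : t ≤ t') :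
    (e t).crashed ⊆ (e t').crashed := by
  induction t', h using Nat.le_induction with
  | base => exact subset_rfl
  | succ t' _ ih =>
    refine ih.trans ?_
    rcases he.cases t' with h | h | ⟨q, inp, l, l', dead, s', h⟩
    · rw [h]
    · rw [h.eq]
    · exact h.crashed_subset

lemma Execution.sent_mono (he : Execution f out ack D e) {t t' : ℕ} (h : t ≤ t') (q p : Fin n) :
    (e t).sent q p <+: (e t').sent q p := by
  induction t', h using Nat.le_induction with
  | base => exact List.prefix_rfl
  | succ t' _ ih =>
    refine ih.trans ?_
    rcases he.cases t' with h | h | ⟨q, inp, l, l', dead, s', h⟩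
    · rw [h]
    · rw [h.eq]; exact List.prefix_rfl
    · rw [h.sent]; exact List.prefix_append _ _

lemma Execution.crashed_card (he : Execution f out ack D e) (t : ℕ) : (e t).crashed.card ≤ f := by
  induction t with
  | zero => rw [he.zero]; exact Nat.zero_le _
  | succ t ih =>
    rcases he.cases t with h | h | ⟨q, inp, l, l', dead, s', h⟩
    · rwa [h]
    · rw [h.eq]; exact ih
    · rw [h.crashed]
      split_ifs with hd
      · exact (Finset.card_insert_le _ _).trans (h.few hd)
      · exact ih

end Monotonicity

/-! ### Quorum intersection -/

section Quorums

variable {n : ℕ} {U Q B : Type*}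

/-- At least `n - f` nodes satisfy `P`. -/
def Most (f : ℕ) (P : Fin n → Prop) : Prop :=
  ∃ W : Finset (Fin n), n - f ≤ W.card ∧ ∀ k ∈ W, P k

lemma Most.mono {f : ℕ} {P P' : Fin n → Prop} (h : Most f P) (hP : ∀ k, P k → P' k) :
    Most f P' := by
  obtain ⟨W, h1, h2⟩ := h
  exact ⟨W, h1, fun k hk => hP k (h2 k hk)⟩

/-- Two disjoint quorums would need `2 * (n - f) > n` nodes. -/
lemma Most.exists_and {f : ℕ} (hf : 2 * f < n) {P P' : Fin n → Prop} (h : Most f P)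
    (h' : Most f P') : ∃ k, P k ∧ P' k := by
  obtain ⟨W, h1, h2⟩ := h
  obtain ⟨W', h3, h4⟩ := h'
  have h5 := Finset.card_union_add_card_inter W W'
  have h6 : (W ∪ W').card ≤ n := (Finset.card_le_univ _).trans (by simp)
  have h7 : 0 < (W ∩ W').card := by omega
  obtain ⟨k, hk⟩ := Finset.card_pos.mp h7
  rw [Finset.mem_inter] at hk
  exact ⟨k, h2 k hk.1, h4 k hk.2⟩

lemma most_true (f : ℕ) : Most f fun _ : Fin n => True :=
  ⟨Finset.univ, by simp, fun _ _ => trivial⟩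

lemma mem_upTo {r : ℕ} {H : Finset (Stamped n U)} {x : Stamped n U} :
    x ∈ upTo r H ↔ x ∈ H ∧ x.tag ≤ r := by
  simp [upTo]

end Quorums

/-! ### How tags arise and spread -/

section Tags

variable {n : ℕ} {U Q B : Type*} {f : ℕ} {out : Q → Finset (Stamped n U) → B} {ack : B}
  {D : ℝ} {e : ℕ → Sys n U Q B}

/-- The tags in a local state from which new messages can be formed. -/
def StateTag (s : AsoState n U (Command U Q)) (τ : ℕ) : Prop :=
  τ = s.maxTag ∨ τ = s.ackTag ∨ ∃ a ph, s.phase = .writing a ph τ ∨ s.phase = .agreeing a ph τ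

/-- The tag of a message that matters to the receiver's tags. -/
def MsgTag (m : Msg n U) (τ : ℕ) : Prop :=
  (∃ κ, m = .readAck κ τ ∨ m = .writeTag κ τ) ∨ m = .echoTag τ

/-- The tags that occur in nodes that have not crashed and in channels. -/
def SysTag (g : Sys n U Q B) (τ : ℕ) : Prop :=
  (∃ p, p ∉ g.crashed ∧ StateTag (g.loc p) τ) ∨ ∃ q p, ∃ x ∈ g.chan q p, MsgTag x.2 τ

/-- Steps only copy tags that are present already, with two exceptions: the tag `0` appears when
`ackTag` is reset, and a successful phase 0 lattice operation creates `r + 1`. The timestamps of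
values do not count, since receivers never derive tags from them. -/
lemma Micro.tags {p : Fin n} {inp : Input n U Q B} {s s' : AsoState n U (Command U Q)}
    {l : List (Finset (Fin n) × Msg n U)} (h : Micro f out ack p inp s l s') {τ : ℕ}
    (hτ : StateTag s' τ ∨ ∃ y ∈ l, MsgTag y.2 τ) :
    StateTag s τ ∨ (∃ q m, inp = .receive q m ∧ MsgTag m τ) ∨ τ = 0 ∨
      ∃ a r, s.phase = .agreeing a 0 r ∧ τ = r + 1 ∧
        l = [(Finset.univ, .goodLA r), (Finset.univ, .writeTag (s.req + 1) (r + 1))] ∧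
        s'.phase = .writing a 1 (r + 1) := by
  cases h with
  | deliver s q m =>
    cases m with
    | value y =>
      refine Or.inl ?_
      simp only [handle] at hτ
      rcases hτ with hτ | ⟨y, hy, hτ⟩
      · exact hτ
      · split_ifs at hy
        · simp at hy
        · simp only [List.mem_singleton] at hy
          subst hy
          simp [MsgTag] at hτ
    | readTag κ =>
      refine Or.inl ?_
      simp only [handle, List.mem_singleton, exists_eq_left] at hτ
      rcases hτ with hτ | hτ
      · exact hτ
      · simp only [MsgTag, Msg.readAck.injEq, reduceCtorEq, or_false] at hτ
        obtain ⟨κ, -, rfl⟩ := hτ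
        exact Or.inl rfl
    | readAck κ τ' =>
      simp only [handle, List.not_mem_nil, false_and, exists_false, or_false] at hτ
      split_ifs at hτ with h
      · rcases hτ with hτ | hτ | hτ
        · exact Or.inl (Or.inl hτ)
        · rcases max_choice s.ackTag τ' with h1 | h1
          · exact Or.inl (Or.inr (Or.inl (hτ.trans h1)))
          · refine Or.inr (Or.inl ⟨q, _, rfl, Or.inl ⟨κ, Or.inl ?_⟩⟩)
            rw [hτ]; simp only at h1 ⊢; rw [h1]
        · exact Or.inl (Or.inr (Or.inr hτ))
      · exact Or.inl hτ
    | writeTag κ τ' =>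
      by_cases h : τ = τ'
      · subst h
        exact Or.inr (Or.inl ⟨q, _, rfl, Or.inl ⟨κ, Or.inr rfl⟩⟩)
      · left
        simp only [handle, List.mem_cons, List.not_mem_nil, or_false, exists_eq_or_imp,
          exists_eq_left] at hτ
        rcases hτ with (hτ | hτ) | hτ | hτ
        · rcases max_choice s.maxTag τ' with h1 | h1
          · exact Or.inl (hτ.trans h1)
          · exact absurd (hτ.trans h1) h
        · exact Or.inr hτ
        · simp [MsgTag, Ne.symm h] at hτ
        · simp [MsgTag] at hτ
    | writeAck κ τ' =>
      refine Or.inl ?_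
      simp only [handle, List.not_mem_nil, false_and, exists_false, or_false] at hτ
      split_ifs at hτ with h <;> exact hτ
    | echoTag τ' =>
      by_cases h : τ = τ'
      · subst h
        exact Or.inr (Or.inl ⟨q, _, rfl, Or.inr rfl⟩)
      · left
        simp only [handle, List.not_mem_nil, false_and, exists_false, or_false] at hτ
        rcases hτ with hτ | hτ
        · rcases max_choice s.maxTag τ' with h1 | h1
          · exact Or.inl (hτ.trans h1)
          · exact absurd (hτ.trans h1) h
        · exact Or.inr hτ
    | goodLA r =>
      refine Or.inl ?_
      simp only [handle, List.not_mem_nil, false_and, exists_false, or_false] at hτ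
      exact hτ
  | start a =>
    simp [StateTag, MsgTag] at hτ ⊢
    omega
  | goodFirst a r h1 h2 h3 =>
    simp [StateTag, MsgTag, enter] at hτ ⊢
    grind
  | _ =>
    simp [StateTag, MsgTag, enter, addOwn] at hτ ⊢
    grind

lemma Interrupted.snd_mem {l l' : List (Finset (Fin n) × Msg n U)} (h : Interrupted l l')
    {y : Finset (Fin n) × Msg n U} (hy : y ∈ l') : ∃ y' ∈ l, y'.2 = y.2 ∧ y.1 ⊆ y'.1 := by
  induction h with
  | none => simp at hy
  | part d d' m l hd =>
    obtain rfl := List.mem_singleton.mp hy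
    exact ⟨_, List.mem_cons_self, rfl, hd⟩
  | next x l l' _ ih =>
    rcases List.mem_cons.mp hy with rfl | hy
    · exact ⟨_, List.mem_cons_self, rfl, subset_rfl⟩
    · obtain ⟨y', h1, h2⟩ := ih hy
      exact ⟨y', List.mem_cons_of_mem _ h1, h2⟩

/-- If anything beyond the first command takes effect, the first one has been executed towards all
its destinations. -/
lemma Interrupted.head_mem {x : Finset (Fin n) × Msg n U} {l l' : List (Finset (Fin n) × Msg n U)}
    (h : Interrupted (x :: l) l') {y : Finset (Fin n) × Msg n U} (hy : y ∈ l') (hn : y.2 ≠ x.2) :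
    x ∈ l' := by
  cases h with
  | none => simp at hy
  | part d d' m l hd =>
    obtain rfl := List.mem_singleton.mp hy
    exact absurd rfl hn
  | next x l l' _ => simp

variable {g g' : Sys n U Q B} {p : Fin n} {inp : Input n U Q B}
    {l l' : List (Finset (Fin n) × Msg n U)} {dead : Bool} {s' : AsoState n U (Command U Q)}

lemma Acts.snd_mem (h : Acts f out ack g g' p inp l l' dead s')
    {y : Finset (Fin n) × Msg n U} (hy : y ∈ l') : ∃ y' ∈ l, y'.2 = y.2 ∧ y.1 ⊆ y'.1 := by
  have := h.effective
  rcases dead with _ | _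
  · have h : l' = l := by simpa [Effective] using this
    exact ⟨y, h ▸ hy, rfl, subset_rfl⟩
  · exact Interrupted.snd_mem this hy

lemma Acts.mem_chan (h : Acts f out ack g g' p inp l l' dead s') {q r : Fin n} {x : ℝ × Msg n U}
    (hx : x ∈ g'.chan q r) :
    x ∈ g.chan q r ∨ (q = p ∧ x.1 = g.now ∧ ∃ d, (d, x.2) ∈ l' ∧ r ∈ d) := by
  rw [h.chan, List.mem_append] at hx
  rcases hx with hx | hx
  · left
    cases inp with
    | receive q' m =>
      simp only [Input.rest] at hx
      split_ifs at hx
      · exact List.mem_of_mem_tail hx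
      · exact hx
    | _ => exact hx
  · right
    split_ifs at hx with hq
    · obtain ⟨y, hy, rfl⟩ := List.mem_map.mp hx
      obtain ⟨h1, h2⟩ := List.mem_filter.mp hy
      exact ⟨hq, rfl, y.1, h1, by simpa using h2⟩
    · simp at hx

lemma Acts.chan_of_mem (h : Acts f out ack g g' p inp l l' dead s') {r : Fin n}
    {y : Finset (Fin n) × Msg n U} (hy : y ∈ l') (hr : r ∈ y.1) : (g.now, y.2) ∈ g'.chan p r := by
  rw [h.chan, if_pos rfl]
  refine List.mem_append_right _ (List.mem_map.mpr ⟨y, List.mem_filter.mpr ⟨hy, by simpa using hr⟩, rfl⟩)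

lemma Acts.mem_chan_of_receive {q : Fin n} {m : Msg n U}
    (h : Acts f out ack g g' p (.receive q m) l l' dead s') : ∃ σ, (σ, m) ∈ g.chan q p := by
  obtain ⟨σ, hσ⟩ := h.offers
  exact ⟨σ, List.mem_of_head? hσ⟩

/-- The new tag `r + 1` comes into use only together with an announcement of `r` that is on its way
to every node, even if the announcing node crashes in the same step. -/
lemma Acts.sysTag (h : Acts f out ack g g' p inp l l' dead s') {τ : ℕ} (hτ : SysTag g' τ) :
    SysTag g τ ∨ τ = 0 ∨ ∃ a r, (g.loc p).phase = .agreeing a 0 r ∧ τ = r + 1 ∧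
      (∀ i, (g.now, .goodLA r) ∈ g'.chan p i) ∧
      (p ∈ g'.crashed ∨ (g'.loc p).phase = .writing a 1 (r + 1)) := by
  have key : (StateTag s' τ ∨ ∃ y ∈ l, MsgTag y.2 τ) → SysTag g τ ∨ τ = 0 ∨
      ∃ a r, (g.loc p).phase = .agreeing a 0 r ∧ τ = r + 1 ∧
        l = [(Finset.univ, .goodLA r), (Finset.univ, .writeTag ((g.loc p).req + 1) (r + 1))] ∧
        s'.phase = .writing a 1 (r + 1) := by
    intro h1
    rcases h.micro.tags h1 with h2 | ⟨q, m, rfl, h2⟩ | h2 | h2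
    · exact Or.inl (Or.inl ⟨p, h.alive, h2⟩)
    · obtain ⟨σ, h3⟩ := h.mem_chan_of_receive
      exact Or.inl (Or.inr ⟨q, p, _, h3, h2⟩)
    · exact Or.inr (Or.inl h2)
    · exact Or.inr (Or.inr h2)
  rcases hτ with ⟨q, hq, hτ⟩ | ⟨q, r, x, hx, hτ⟩
  · by_cases hqp : q = p
    · subst hqp
      rw [h.loc_self] at hτ
      rcases key (Or.inl hτ) with h1 | h1 | ⟨a, r, h1, h2, h3, h4⟩
      · exact Or.inl h1
      · exact Or.inr (Or.inl h1)
      · refine Or.inr (Or.inr ⟨a, r, h1, h2, fun i => ?_, Or.inr (by rw [h.loc_self, h4])⟩)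
        have h5 := h.effective_eq hq
        exact h.chan_of_mem (y := (Finset.univ, .goodLA r)) (by rw [h5, h3]; simp) (by simp)
    · rw [h.loc_ne hqp] at hτ
      exact Or.inl (Or.inl ⟨q, fun h1 => hq (h.crashed_subset h1), hτ⟩)
  · rcases h.mem_chan hx with hx | ⟨rfl, -, d, hx, -⟩
    · exact Or.inl (Or.inr ⟨q, r, x, hx, hτ⟩)
    · obtain ⟨y', h1, h2, -⟩ := h.snd_mem hx
      rcases key (Or.inr ⟨y', h1, h2 ▸ hτ⟩) with h3 | h3 | ⟨a, r, h3, h4, h5, h6⟩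
      · exact Or.inl h3
      · exact Or.inr (Or.inl h3)
      · refine Or.inr (Or.inr ⟨a, r, h3, h4, fun i => ?_, Or.inr (by rw [h.loc_self, h6])⟩)
        refine h.chan_of_mem (y := (Finset.univ, .goodLA r)) ?_ (by simp)
        have h7 := h.effective
        rcases dead with _ | _
        · have h7 : l' = l := by simpa [Effective] using h7
          rw [h7, h5]; simp
        · rw [Effective, if_pos rfl, h5] at h7
          -- The message with the new tag is not the announcement itself, so it was sent after the
          -- announcement had gone to all nodes.
          refine Interrupted.head_mem h7 hx ?_
          rintro h8
          simp only at h8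
          rw [h8] at hτ
          simp [MsgTag] at hτ

lemma sysTag_tick (h : Ticks f D g g') {τ : ℕ} : SysTag g' τ ↔ SysTag g τ := by
  rw [h.eq]; exact Iff.rfl

lemma Execution.sysTag_zero (he : Execution f out ack D e) {τ : ℕ} (h : SysTag (e 0) τ) :
    τ = 0 := by
  rw [he.zero] at h
  have h : Nonempty (Fin n) ∧ τ = 0 := by
    simpa [SysTag, StateTag, Sys.initial, Config.initial, protocol] using h
  exact h.2

/-- Before a tag is in use, a good lattice operation with each smaller tag has been announced. -/
lemma Execution.goodLA_sent (he : Execution f out ack D e) (t τ : ℕ) (hτ : SysTag (e t) τ) (m : ℕ)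
    (hm : m < τ) : ∃ p, ∀ i, .goodLA m ∈ (e t).sent p i := by
  induction t generalizing τ m with
  | zero =>
    have := he.sysTag_zero hτ
    omega
  | succ t ih =>
    have hmono : ∀ {m}, (∃ p, ∀ i, .goodLA m ∈ (e t).sent p i) →
        ∃ p, ∀ i, .goodLA m ∈ (e (t + 1)).sent p i := fun ⟨p, h⟩ =>
      ⟨p, fun i => (he.sent_mono t.le_succ p i).subset (h i)⟩
    rcases he.cases t with h | h | ⟨q, inp, l, l', dead, s', h⟩
    · rw [h] at hτ
      exact hmono (ih τ hτ m hm)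
    · rw [sysTag_tick h] at hτ
      exact hmono (ih τ hτ m hm)
    · rcases h.sysTag hτ with h1 | h1 | ⟨a, r, h1, h2, h3, -⟩
      · exact hmono (ih τ h1 m hm)
      · omega
      -- The tag `r` was in use at the acting node, which covers all smaller tags by induction; `r`
      -- itself is announced in this step.
      · rcases Nat.lt_succ_iff_lt_or_eq.mp (h2 ▸ hm) with h4 | rfl
        · exact hmono (ih r (Or.inl ⟨q, h.alive, Or.inr (Or.inr ⟨a, 0, Or.inr h1⟩)⟩) m h4)
        · exact ⟨q, fun i => List.mem_append_right _ (List.mem_map_of_mem (h3 i))⟩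

end Tags


/-! ### Views of lattice operations and how they compare -/

section Lattice

variable {n : ℕ} {U Q B : Type*} {f : ℕ} {out : Q → Finset (Stamped n U) → B} {ack : B}
  {D : ℝ} {e : ℕ → Sys n U Q B}

/-- At time `t`, node `p` has the acknowledgements of its request to write the tag `r`, which it
started at time `w`. -/
def Wrote (f : ℕ) (e : ℕ → Sys n U Q B) (p : Fin n) (r w t : ℕ) : Prop :=
  Most f fun k => ∃ L, L <+: (e t).log k ∧ (Finset.univ, .echoTag r) ∈ L ∧ (e w).log k <+: L ∧
    ∀ x, (Finset.univ, .value x) ∈ L → x ∈ ((e t).loc p).V p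

/-- A quorum has seen the tag `r - 1`. -/
def Near (f : ℕ) (e : ℕ → Sys n U Q B) (r t : ℕ) : Prop :=
  Most f fun k => r ≤ ((e t).loc k).maxTag + 1

/-- An equivalence quorum for the view `H` at time `t`. -/
def Agreed (f : ℕ) (e : ℕ → Sys n U Q B) (r : ℕ) (H : Finset (Stamped n U)) (t : ℕ) : Prop :=
  Most f fun k => ∃ L, L <+: (e t).log k ∧
    ∀ x, x ∈ H ↔ (Finset.univ, .value x) ∈ L ∧ x.tag ≤ r

/-- An equivalence quorum of nodes from which no tag larger than `r` has been received. -/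
def AgreedGood (f : ℕ) (e : ℕ → Sys n U Q B) (r : ℕ) (H : Finset (Stamped n U)) (t : ℕ) : Prop :=
  Most f fun k => ∃ L, L <+: (e t).log k ∧
    (∀ x, x ∈ H ↔ (Finset.univ, .value x) ∈ L ∧ x.tag ≤ r) ∧
    ∀ τ, (Finset.univ, .echoTag τ) ∈ L → τ ≤ r

/-- A lattice operation with tag `r` that started at time `w` ended at time `t` with view `H`. -/
structure Lat (f : ℕ) (e : ℕ → Sys n U Q B) (r : ℕ) (H : Finset (Stamped n U)) (w t : ℕ) :
    Prop where
  near : Near f e r (w + 1)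
  wrote : Most f fun k => ∃ L, L <+: (e t).log k ∧ (Finset.univ, .echoTag r) ∈ L ∧
    (e w).log k <+: L ∧ ∀ x, (Finset.univ, .value x) ∈ L → x.tag ≤ r → x ∈ H
  agreed : Agreed f e r H t

/-- A good lattice operation. -/
structure GoodLat (f : ℕ) (e : ℕ → Sys n U Q B) (r : ℕ) (H : Finset (Stamped n U)) (w t : ℕ) :
    Prop extends Lat f e r H w t where
  good : AgreedGood f e r H t

/-- The tag `ρ` is at least as large as the largest tag of each node of some quorum. -/
def ReadAt (f : ℕ) (e : ℕ → Sys n U Q B) (ρ t : ℕ) : Prop :=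
  Most f fun k => ((e t).loc k).maxTag ≤ ρ

/-- A quorum has seen the tag `r`. -/
def Seen (f : ℕ) (e : ℕ → Sys n U Q B) (r t : ℕ) : Prop :=
  Most f fun k => r ≤ ((e t).loc k).maxTag

/-- The quorum that was asked contains a node of the quorum that had seen `r`. -/
lemma ReadAt.le {ρ r t : ℕ} (hf : 2 * f < n) (h : ReadAt f e ρ t) (h' : Seen f e r t) : r ≤ ρ := by
  obtain ⟨k, h1, h2⟩ := h.exists_and hf h'
  exact h2.trans h1

lemma ReadAt.le_succ {ρ r t : ℕ} (hf : 2 * f < n) (h : ReadAt f e ρ t) (h' : Near f e r t) :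
    r ≤ ρ + 1 := by
  obtain ⟨k, h1, h2⟩ := h.exists_and hf h'
  omega

lemma ReadAt.mono {ρ ρ' t : ℕ} (h : ReadAt f e ρ t) (hρ : ρ ≤ ρ') : ReadAt f e ρ' t :=
  Most.mono h fun _ h => h.trans hρ

lemma Execution.seen_mono (he : Execution f out ack D e) {r t t' : ℕ} (h : Seen f e r t)
    (ht : t ≤ t') : Seen f e r t' :=
  Most.mono h fun k h => h.trans (he.maxTag_mono ht k)

lemma Execution.near_mono (he : Execution f out ack D e) {r t t' : ℕ} (h : Near f e r t)
    (ht : t ≤ t') : Near f e r t' :=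
  Most.mono h fun k h => h.trans (Nat.succ_le_succ (he.maxTag_mono ht k))

lemma Execution.seen_of_wrote (he : Execution f out ack D e) {p : Fin n} {r w t : ℕ}
    (h : Wrote f e p r w t) : Seen f e r t :=
  Most.mono h fun k ⟨_, h1, h2, _⟩ => (he.echoTag_log t k _ r (h1.subset h2)).2

lemma Execution.seen_of_lat (he : Execution f out ack D e) {r H w t} (h : Lat f e r H w t) :
    Seen f e r t :=
  Most.mono h.wrote fun k ⟨_, h1, h2, _⟩ => (he.echoTag_log t k _ r (h1.subset h2)).2

lemma Execution.wrote_mono (he : Execution f out ack D e) {p : Fin n} {r w t t' : ℕ}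
    (h : Wrote f e p r w t) (ht : t ≤ t') : Wrote f e p r w t' :=
  Most.mono h fun k ⟨L, h1, h2, h3, h4⟩ => ⟨L, h1.trans (he.log_mono ht k), h2, h3,
    fun x hx => he.V_mono ht p p (h4 x hx)⟩

/-- Common prefixes of logs are comparable. -/
lemma Execution.prefix_total (he : Execution f out ack D e) {t t' : ℕ} {k : Fin n}
    {L L' : List (Finset (Fin n) × Msg n U)} (h : L <+: (e t).log k) (h' : L' <+: (e t').log k) :
    L <+: L' ∨ L' <+: L :=
  List.prefix_or_prefix_of_prefix (h.trans (he.log_mono (le_max_left t t') k))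
    (h'.trans (he.log_mono (le_max_right t t') k))

section Comparison

variable {r r' : ℕ} {H H' : Finset (Stamped n U)} {w w' t t' : ℕ}

/-- At a node of both equivalence quorums, both views are cut at the same tag from prefixes of one
log, and of two such prefixes one extends the other. -/
lemma Execution.lat_comparable (he : Execution f out ack D e) (hf : 2 * f < n)
    (h : Lat f e r H w t) (h' : Lat f e r H' w' t') : H ⊆ H' ∨ H' ⊆ H := by
  obtain ⟨k, ⟨L, h1, h2⟩, ⟨L', h3, h4⟩⟩ := h.agreed.exists_and hf h'.agreed
  rcases he.prefix_total h1 h3 with h5 | h5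
  · exact Or.inl fun x hx => (h4 x).mpr ⟨h5.subset ((h2 x).mp hx).1, ((h2 x).mp hx).2⟩
  · exact Or.inr fun x hx => (h2 x).mpr ⟨h5.subset ((h4 x).mp hx).1, ((h4 x).mp hx).2⟩

/-- A node common to the equivalence quorum of the good operation and to the nodes that acknowledged
`r'` decides. The prefix behind the good view has no echo of `r'`, the other one has, so the first
is the shorter one and its values were known to the second operation when it ended. Only the
operation with the smaller tag has to be good. -/
lemma Execution.goodLat_subset (he : Execution f out ack D e) (hf : 2 * f < n)
    (h : GoodLat f e r H w t) (h' : Lat f e r' H' w' t') (hr : r < r') : H ⊆ H' := by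
  obtain ⟨k, ⟨L, h1, h2, h3⟩, ⟨L', h4, h5, -, h6⟩⟩ := h.good.exists_and hf h'.wrote
  rcases he.prefix_total h1 h4 with h7 | h7
  · intro x hx
    obtain ⟨h8, h9⟩ := (h2 x).mp hx
    exact h6 x (h7.subset h8) (h9.trans hr.le)
  · have := h3 r' (h7.subset h5)
    omega

lemma Execution.goodLat_comparable (he : Execution f out ack D e) (hf : 2 * f < n)
    (h : GoodLat f e r H w t) (h' : GoodLat f e r' H' w' t') : H ⊆ H' ∨ H' ⊆ H := by
  rcases lt_trichotomy r r' with hr | rfl | hr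
  · exact Or.inl (he.goodLat_subset hf h h'.toLat hr)
  · exact he.lat_comparable hf h.toLat h'.toLat
  · exact Or.inr (he.goodLat_subset hf h' h.toLat hr)

/-- A common node had logged `x` before the second operation started. By FIFO order the value
travels ahead of the acknowledgement of that operation's tag. -/
lemma Execution.lat_mem (he : Execution f out ack D e) (hf : 2 * f < n)
    (h : Lat f e r H w t) (h' : Lat f e r' H' w' t') (ht : t ≤ w') {x : Stamped n U} (hx : x ∈ H)
    (hr : x.tag ≤ r') : x ∈ H' := by
  obtain ⟨k, ⟨L, h1, h2⟩, ⟨L', -, -, h3, h4⟩⟩ := h.agreed.exists_and hf h'.wrote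
  exact h4 x ((h1.trans ((he.log_mono ht k).trans h3)).subset ((h2 x).mp hx).1) hr

/-- The value `y` entered the log of a common node only after time `t`. So a prefix that contains
`y` extends the log at time `t`, and thereby contains `x`. No order between the two lattice
operations is needed. -/
lemma Execution.lat_mem_of_later (he : Execution f out ack D e) (hf : 2 * f < n)
    (h : Lat f e r H w t) (h' : Lat f e r' H' w' t') {x y : Stamped n U} (hx : x ∈ H)
    (hr : x.tag ≤ r') (hy : y ∈ H') (hy' : ∀ k, (Finset.univ, .value y) ∉ (e t).log k) :
    x ∈ H' := by
  obtain ⟨k, ⟨L, h1, h2⟩, ⟨L', h3, h4⟩⟩ := h.agreed.exists_and hf h'.agreed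
  refine (h4 x).mpr ⟨?_, hr⟩
  rcases he.prefix_total (List.prefix_rfl (l := (e t).log k)) h3 with h5 | h5
  · exact (h1.trans h5).subset ((h2 x).mp hx).1
  · exact absurd (h5.subset ((h4 y).mp hy).1) (hy' k)

end Comparison

/-- The values received by `p` from `k` are those of a prefix of the log of `k`. -/
lemma Execution.exists_prefix_V (he : Execution f out ack D e) (t : ℕ) (p k : Fin n) :
    ∃ L, L <+: (e t).log k ∧
      (∀ x, x ∈ ((e t).loc p).V k ↔ (Finset.univ, .value x) ∈ L) ∧
      ∀ τ, (Finset.univ, .echoTag τ) ∈ L → τ ≤ ((e t).loc p).maxTag := by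
  -- For `p` itself the prefix is the whole log, as `V p` mirrors it.
  by_cases hk : k = p
  · subst hk
    exact ⟨_, List.prefix_rfl, he.mem_V_self t k, fun τ hτ => (he.echoTag_log t k _ τ hτ).2⟩
  · obtain ⟨L, h1, h2⟩ := exists_of_prefix_msgsTo (he.got_prefix t p k)
    refine ⟨L, h1, fun x => ?_, fun τ hτ => ?_⟩
    · rw [he.mem_V_of_ne t hk, ← h2, mem_msgsTo]
      constructor
      · rintro ⟨d, h3, -⟩
        obtain rfl := he.value_univ t k d x (h1.subset h3)
        exact h3
      · exact fun h3 => ⟨_, h3, Finset.mem_univ _⟩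
    · refine he.echoTag_got t p k τ ?_
      rw [← h2, mem_msgsTo]
      exact ⟨_, hτ, Finset.mem_univ _⟩

lemma Execution.agreed_of_EQ (he : Execution f out ack D e) {t r : ℕ} {p : Fin n}
    (h : EQ f (fun j => upTo r (((e t).loc p).V j)) p) :
    Agreed f e r (upTo r (((e t).loc p).V p)) t := by
  obtain ⟨W, h1, h2⟩ := h
  refine ⟨W, h1, fun k hk => ?_⟩
  obtain ⟨L, h3, h4, -⟩ := he.exists_prefix_V t p k
  refine ⟨L, h3, fun x => ?_⟩
  rw [← show upTo r (((e t).loc p).V k) = upTo r (((e t).loc p).V p) from h2 k hk, mem_upTo, h4]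

lemma Execution.agreedGood_of_EQ (he : Execution f out ack D e) {t r : ℕ} {p : Fin n}
    (h : EQ f (fun j => upTo r (((e t).loc p).V j)) p) (hr : ((e t).loc p).maxTag ≤ r) :
    AgreedGood f e r (upTo r (((e t).loc p).V p)) t := by
  obtain ⟨W, h1, h2⟩ := h
  refine ⟨W, h1, fun k hk => ?_⟩
  obtain ⟨L, h3, h4, h5⟩ := he.exists_prefix_V t p k
  refine ⟨L, h3, fun x => ?_, fun τ hτ => (h5 τ hτ).trans hr⟩
  rw [← show upTo r (((e t).loc p).V k) = upTo r (((e t).loc p).V p) from h2 k hk, mem_upTo, h4]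

lemma Execution.lat_of_EQ (he : Execution f out ack D e) {t r w : ℕ} {p : Fin n}
    (hn : Near f e r (w + 1)) (hW : Wrote f e p r w t)
    (h : EQ f (fun j => upTo r (((e t).loc p).V j)) p) :
    Lat f e r (upTo r (((e t).loc p).V p)) w t :=
  ⟨hn, Most.mono hW fun _ ⟨L, h1, h2, h3, h4⟩ =>
    ⟨L, h1, h2, h3, fun x hx hr => mem_upTo.mpr ⟨h4 x hx, hr⟩⟩, he.agreed_of_EQ h⟩

/-- After the acknowledgements of a request to write a tag. -/
lemma Execution.wrote_of_acks (he : Execution f out ack D e) {t w r ph : ℕ} {a : Command U Q}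
    {p : Fin n} (hp : ((e t).loc p).phase = .writing a ph r)
    (hc : n - f ≤ ((e t).loc p).acks.card) (hr : ((e w).loc p).req < ((e t).loc p).req) :
    Wrote f e p r w t := by
  have hwt : w ≤ t := by
    by_contra h
    have := he.req_mono (le_of_not_ge h) p
    omega
  refine ⟨_, hc, fun k hk => ?_⟩
  obtain ⟨h1, h2, h3⟩ := he.request_writing t p a ph r (Or.inl hp)
  obtain ⟨τ, h4⟩ := (he.mem_acks t p k).1.mp hk
  have h5 : .writeAck ((e t).loc p).req r ∈ (e t).got p k := by
    rcases h4 with h4 | h4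
    · obtain ⟨d, h5, h6⟩ := he.exists_log_of_got h4
      exact absurd (he.readTag_of_readAck h5 h6) (h2 _)
    · obtain ⟨d, h5, h6⟩ := he.exists_log_of_got h4
      obtain rfl := h3 _ τ (he.writeTag_of_writeAck h5 h6)
      exact h4
  obtain ⟨L, h6, h7⟩ := exists_of_prefix_msgsTo (he.got_prefix t p k)
  rw [← h7, mem_msgsTo] at h5
  obtain ⟨d, h8, h9⟩ := h5
  refine ⟨L, h6, he.echo_before_ack t k _ _ _ L h6 h8, ?_, fun x hx => ?_⟩
  -- Otherwise the acknowledgement would already be in the log at time `w`, although its request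
  -- number exceeds the counter at that time.
  · rcases he.prefix_total (List.prefix_rfl (l := (e w).log k)) h6 with h | h
    · exact h
    · have h10 := he.writeTag_of_writeAck (h.subset h8) h9
      have := (he.writeTag_log w p _ _ _ h10).2
      omega
  -- All of `L` that is addressed to `p` has been received, in particular the values.
  · refine he.mem_V_of_got (q := k) t x ?_
    rw [← h7, mem_msgsTo]
    exact ⟨_, hx, Finset.mem_univ _⟩

/-- An acknowledgement of a `readTag` request carries a recent tag. -/
lemma Execution.maxTag_le_of_readAck (he : Execution f out ack D e) {s t : ℕ} (hst : s ≤ t)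
    {p k : Fin n} {κ τ : ℕ} (hκ : ((e s).loc p).req < κ) {d : Finset (Fin n)}
    (h : (d, .readAck κ τ) ∈ (e t).log k) (hp : p ∈ d) : ((e s).loc k).maxTag ≤ τ := by
  induction t, hst using Nat.le_induction with
  | base =>
    have := (he.readTag_log s p _ _ (he.readTag_of_readAck h hp)).2
    omega
  | succ t hst ih =>
    rcases he.node_cases t k with ⟨-, h1, -⟩ | ⟨inp, l, l', dead, s', h1⟩
    · exact ih (h1 ▸ h)
    · rw [h1.log_self, List.mem_append] at h
      rcases h with h | h
      · exact ih h
      · obtain ⟨j, -, -, rfl⟩ := h1.micro.readAck_mem d κ τ h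
        exact he.maxTag_mono hst k

lemma Execution.readAt_of_acks (he : Execution f out ack D e) {t s : ℕ} {a : Command U Q}
    {p : Fin n} (hp : ((e t).loc p).phase = .reading a)
    (hc : n - f ≤ ((e t).loc p).acks.card) (hr : ((e s).loc p).req < ((e t).loc p).req) :
    ReadAt f e ((e t).loc p).ackTag s := by
  have hst : s ≤ t := by
    by_contra h
    have := he.req_mono (le_of_not_ge h) p
    omega
  refine ⟨_, hc, fun k hk => ?_⟩
  obtain ⟨h1, h2⟩ := he.request_reading t p a hp
  obtain ⟨τ, h4⟩ := (he.mem_acks t p k).1.mp hk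
  rcases h4 with h4 | h4
  · refine le_trans ?_ ((he.mem_acks t p k).2 τ h4)
    obtain ⟨d, h5, h6⟩ := he.exists_log_of_got h4
    exact he.maxTag_le_of_readAck hst hr h5 h6
  · obtain ⟨d, h5, h6⟩ := he.exists_log_of_got h4
    exact absurd (he.writeTag_of_writeAck h5 h6) (h2 _ _)

/-- In the phase after `writeTag(r)`, a quorum has seen the tag `r`. -/
lemma Execution.seen_of_agreeing (he : Execution f out ack D e) (t : ℕ) (p : Fin n)
    (a : Command U Q) (ph r : ℕ) (h : ((e t).loc p).phase = .agreeing a ph r) : Seen f e r t := by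
  induction t with
  | zero => rw [he.loc_zero] at h; simp [blank] at h
  | succ t ih =>
    rcases he.node_cases t p with ⟨h1, -, -⟩ | ⟨inp, l, l', dead, s', h1⟩
    · exact he.seen_mono (ih (h1 ▸ h)) t.le_succ
    · rw [h1.loc_self] at h
      have hm := h1.micro
      generalize hs : (e t).loc p = s at hm
      cases hm with
      | deliver _ q m =>
        rw [handle_phase, ← hs] at h
        exact he.seen_mono (ih h) t.le_succ
      | skip =>
        rw [← hs] at h
        exact he.seen_mono (ih h) t.le_succ
      | written _ a' ph' r' h4 h5 =>
        simp only [Phase.agreeing.injEq] at h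
        obtain ⟨rfl, rfl, rfl⟩ := h
        rw [← hs] at h4 h5
        have h6 := (he.request_writing t p _ _ _ (Or.inl h4)).1
        -- Any time before the request serves as its start, for instance time `0`, when the counter
        -- is `0`; so the number of the request must be positive.
        have h7 : 0 < ((e t).loc p).req := by
          by_contra h8
          have h9 : ∀ t, ∀ x ∈ (e t).log p, ∀ κ τ, x.2 = .writeTag κ τ → 0 < κ := by
            intro t
            refine he.local_induction p (P := fun _ lg _ => ∀ x ∈ lg, ∀ κ τ,
              x.2 = .writeTag κ τ → 0 < κ) (by simp) (fun t inp l s' hm ih x hx κ τ hκ => ?_) t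
            rcases List.mem_append.mp hx with hx | hx
            · exact ih x hx κ τ hκ
            · obtain ⟨d, y⟩ := x
              simp only at hκ
              subst hκ
              have := (hm.writeTag_mem d κ τ hx).2.1
              omega
          exact h8 (h9 t _ h6 _ _ rfl)
        have h8 : ((e 0).loc p).req = 0 := by rw [he.loc_zero]; rfl
        exact he.seen_mono (he.seen_of_wrote (he.wrote_of_acks (w := 0) h4 h5 (by omega)))
          t.le_succ
      | _ => simp [enter] at h

/-- Tags grow by steps of one. -/
lemma Execution.near_of_sysTag (he : Execution f out ack D e) (t τ : ℕ) (hτ : SysTag (e t) τ) :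
    Near f e τ t := by
  induction t generalizing τ with
  | zero =>
    obtain rfl := he.sysTag_zero hτ
    exact (most_true f).mono fun _ _ => Nat.zero_le _
  | succ t ih =>
    rcases he.cases t with h | h | ⟨q, inp, l, l', dead, s', h⟩
    · rw [h] at hτ
      exact he.near_mono (ih τ hτ) t.le_succ
    · rw [sysTag_tick h] at hτ
      exact he.near_mono (ih τ hτ) t.le_succ
    · rcases h.sysTag hτ with h1 | rfl | ⟨a, r, h1, rfl, -, -⟩
      · exact he.near_mono (ih τ h1) t.le_succ
      · exact (most_true f).mono fun _ _ => Nat.zero_le _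
      -- The tag `r + 1` is created by a node that has had its tag `r` acknowledged by a quorum.
      · exact he.near_mono (Most.mono (he.seen_of_agreeing t q a 0 r h1) fun k h =>
          Nat.succ_le_succ h) t.le_succ

/-- A quorum has seen the tag of each announced good lattice operation. -/
lemma Execution.seen_of_goodLA (he : Execution f out ack D e) (t : ℕ) (p : Fin n)
    (d : Finset (Fin n)) (r : ℕ) (h : (d, .goodLA r) ∈ (e t).log p) : Seen f e r t := by
  induction t with
  | zero => rw [he.log_zero] at h; simp at h
  | succ t ih =>
    rcases he.node_cases t p with ⟨-, h1, -⟩ | ⟨inp, l, l', dead, s', h1⟩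
    · exact he.seen_mono (ih (h1 ▸ h)) t.le_succ
    · rw [h1.log_self, List.mem_append] at h
      rcases h with h | h
      · exact he.seen_mono (ih h) t.le_succ
      · obtain ⟨-, -, -, -, ⟨a, ph, h2⟩, -, -⟩ := h1.micro.goodLA_mem d r h
        exact he.seen_mono (he.seen_of_agreeing t p a ph r h2) t.le_succ

end Lattice


/-! ### What is known about an operation in each phase -/

section Operations

variable {n : ℕ} {U Q B : Type*} {f : ℕ} {out : Q → Finset (Stamped n U) → B} {ack : B}
  {D : ℝ} {e : ℕ → Sys n U Q B}

/-- At time `t`, node `p` executes the operation `a`, which was invoked at time `s`. -/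
structure Begun (e : ℕ → Sys n U Q B) (s t : ℕ) (p : Fin n) (a : Command U Q) : Prop where
  lt : s < t
  inv : (e t).history[(e s).history.length]? = some (.inv p a)
  op : (e t).op p = (e s).history.length
  last : ∀ m ev, (e s).history.length < m → (e t).history[m]? = some ev → ev.node ≠ p
  pending : (e t).pending p = some (e s).now
  req : ((e s).loc p).req < ((e t).loc p).req

/-- The operation `a` has read the tag `ρ`, and its value, if it is an update, is in use. -/
structure Core (f : ℕ) (e : ℕ → Sys n U Q B) (s t : ℕ) (p : Fin n) (a : Command U Q) (ρ : ℕ) :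
    Prop where
  begun : Begun e s t p a
  read : ReadAt f e ρ s
  -- This keeps an operation from borrowing a view announced by its own node, since the tag in
  -- question exceeds `ρ`.
  good : ∀ d τ, (d, .goodLA τ) ∈ (e t).log p → τ ≤ ρ
  own : ∀ u, a = .update u → (e t).val ((e t).op p) = some ⟨u, ρ + 1, p⟩ ∧
    ⟨u, ρ + 1, p⟩ ∈ ((e t).loc p).V p

/-- The tags of the lattice operations of `a` in terms of the tag `ρ` that it has read. -/
structure Level (a : Command U Q) (ρ ph r : ℕ) : Prop where
  le : ph ≤ 3
  zero : ph = 0 → r = ρ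
  -- Each failure raises the tag by at least one. A query enters phase 1 with the tag `ρ`, so the
  -- bound is attained there; in phase 3 it gives `ρ + 2 ≤ r` once the failure is known not to
  -- matter, exactly what borrowing needs.
  add_le : ρ + ph ≤ r + 1
  update : ph ≠ 0 → ∀ u, a = .update u → ρ + 1 ≤ r

/-- What is known about an operation in the phases of the client thread. -/
def PhaseInv (f : ℕ) (e : ℕ → Sys n U Q B) (t : ℕ) (p : Fin n) : Phase (Command U Q) → Prop
  | .idle => True
  | .reading a => ∃ s, Begun e s t p a ∧
      (∀ d τ, (d, .goodLA τ) ∈ (e t).log p → Seen f e τ s) ∧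
      (Finset.univ, .readTag ((e t).loc p).req) ∈ (e (s + 1)).log p ∧
      (e t).val ((e t).op p) = none
  | .writing a ph r => ∃ s ρ w, Core f e s t p a ρ ∧ Level a ρ ph r ∧ s < w ∧ w < t ∧
      ((e w).loc p).req < ((e t).loc p).req ∧ Near f e r (w + 1) ∧
      (Finset.univ, .writeTag ((e t).loc p).req r) ∈ (e (w + 1)).log p
  | .agreeing a ph r => ∃ s ρ w, Core f e s t p a ρ ∧ Level a ρ ph r ∧ s < w ∧ w < t ∧
      Wrote f e p r w t ∧ Near f e r (w + 1)
  -- The view `H` of the third lattice operation is kept although that operation was not good: for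
  -- an update it suffices as a proof that the value has reached a quorum.
  | .borrowing a r => ∃ s ρ H w t', Core f e s t p a ρ ∧ ρ + 2 ≤ r ∧ Lat f e r H w t' ∧ s < w ∧
      t' ≤ t ∧ ∀ u, a = .update u → ⟨u, ρ + 1, p⟩ ∈ H

lemma PhaseInv.begun {t : ℕ} {p : Fin n} {π : Phase (Command U Q)} (h : PhaseInv f e t p π)
    (hπ : π ≠ .idle) : ∃ s a, Begun e s t p a := by
  cases π with
  | idle => exact absurd rfl hπ
  | reading a => obtain ⟨s, h, -⟩ := h; exact ⟨s, a, h⟩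
  | writing a ph r => obtain ⟨s, ρ, w, h, -⟩ := h; exact ⟨s, a, h.begun⟩
  | agreeing a ph r => obtain ⟨s, ρ, w, h, -⟩ := h; exact ⟨s, a, h.begun⟩
  | borrowing a r => obtain ⟨s, ρ, H, w, t', h, -⟩ := h; exact ⟨s, a, h.begun⟩

/-- No operation of `p` begins or ends in the step at time `t`. -/
structure Still (e : ℕ → Sys n U Q B) (t : ℕ) (p : Fin n) : Prop where
  op : (e (t + 1)).op p = (e t).op p
  pending : (e (t + 1)).pending p = (e t).pending p
  history : ∀ (m : ℕ) (ev : Event n (Command U Q) B), (e (t + 1)).history[m]? = some ev →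
    (e t).history[m]? = some ev ∨ ev.node ≠ p

lemma Acts.history_cases {g g' : Sys n U Q B} {q : Fin n} {inp : Input n U Q B}
    {l l' : List (Finset (Fin n) × Msg n U)} {dead : Bool} {s' : AsoState n U (Command U Q)}
    (h : Acts f out ack g g' q inp l l' dead s') {m : ℕ} {ev : Event n (Command U Q) B}
    (hm : g'.history[m]? = some ev) : g.history[m]? = some ev ∨
      (m = g.history.length ∧ inp.event q dead = [ev]) := by
  rw [h.history] at hm
  by_cases h1 : m < g.history.length
  · rw [List.getElem?_append_left h1] at hm
    exact Or.inl hm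
  · rw [List.getElem?_append_right (not_lt.mp h1)] at hm
    generalize hi : m - g.history.length = i at hm
    cases inp with
    | invoke a =>
      rcases i with _ | i
      · simp only [Input.event, List.getElem?_cons_zero, Option.some.injEq] at hm
        exact Or.inr ⟨by omega, by simp [Input.event, hm]⟩
      · simp [Input.event] at hm
    | reply b =>
      cases dead with
      | true => simp [Input.event] at hm
      | false =>
        rcases i with _ | i
        · simp only [Input.event, List.getElem?_cons_zero, Option.some.injEq] at hm
          exact Or.inr ⟨by omega, by simp [Input.event, hm]⟩
        · simp [Input.event] at hm
    | _ => simp [Input.event] at hm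

section

variable {g g' : Sys n U Q B} {q : Fin n} {inp : Input n U Q B}
  {l l' : List (Finset (Fin n) × Msg n U)} {dead : Bool} {s' : AsoState n U (Command U Q)}

lemma Acts.op_eq (h : Acts f out ack g g' q inp l l' dead s') (p : Fin n)
    (hp : p = q → ∀ a, inp ≠ .invoke a) : g'.op p = g.op p := by
  rw [h.eq]
  cases inp with
  | invoke a =>
    have : p ≠ q := fun h => hp h a rfl
    simp [Sys.exec, this]
  | _ => rfl

lemma Acts.pending_eq (h : Acts f out ack g g' q inp l l' dead s') (p : Fin n)
    (hp : p = q → (∀ a, inp ≠ .invoke a) ∧ ∀ b, inp ≠ .reply b) : g'.pending p = g.pending p := by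
  rw [h.eq]
  cases inp with
  | invoke a =>
    have : p ≠ q := fun h => (hp h).1 a rfl
    simp [Sys.exec, this]
  | reply b =>
    have : p ≠ q := fun h => (hp h).2 b rfl
    cases dead <;> simp [Sys.exec, this]
  | _ => rfl

lemma Acts.val_eq (h : Acts f out ack g g' q inp l l' dead s') (i : ℕ)
    (hi : i = g.op q → ∀ x, inp ≠ .write x) : g'.val i = g.val i := by
  rw [h.eq]
  cases inp with
  | write x =>
    have : i ≠ g.op q := fun h => hi h x rfl
    simp [Sys.exec, this]
  | _ => rfl

lemma Acts.node_event (h : Acts f out ack g g' q inp l l' dead s')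
    {ev : Event n (Command U Q) B} (hev : inp.event q dead = [ev]) :
    ev.node = q ∧ ((∃ a, inp = .invoke a ∧ ev = .inv q a) ∨
      ∃ b, inp = .reply b ∧ dead = false ∧ ev = .res q b) := by
  cases inp with
  | invoke a =>
    simp only [Input.event, List.cons.injEq, and_true] at hev
    subst hev
    exact ⟨rfl, Or.inl ⟨a, rfl, rfl⟩⟩
  | reply b =>
    cases dead with
    | true => simp [Input.event] at hev
    | false =>
      simp only [Input.event, List.cons.injEq, and_true] at hev
      subst hev
      exact ⟨rfl, Or.inr ⟨b, rfl, rfl, rfl⟩⟩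
  | _ => simp [Input.event] at hev

end

lemma Acts.still {t : ℕ} {p q : Fin n} {inp : Input n U Q B}
    {l l' : List (Finset (Fin n) × Msg n U)} {dead : Bool} {s' : AsoState n U (Command U Q)}
    (h1 : Acts f out ack (e t) (e (t + 1)) q inp l l' dead s')
    (h2 : p = q → (∀ a, inp ≠ .invoke a) ∧ ∀ b, inp ≠ .reply b) : Still e t p := by
  refine ⟨h1.op_eq p fun hp => (h2 hp).1, h1.pending_eq p h2, fun m ev hm => ?_⟩
  rcases h1.history_cases hm with h3 | ⟨-, h3⟩
  · exact Or.inl h3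
  · obtain ⟨h4, h5⟩ := h1.node_event h3
    refine Or.inr ?_
    rw [h4]
    rintro rfl
    rcases h5 with ⟨a, h5, -⟩ | ⟨b, h5, -⟩
    · exact (h2 rfl).1 a h5
    · exact (h2 rfl).2 b h5

lemma Execution.still (he : Execution f out ack D e) (t : ℕ) (p : Fin n)
    (h : ¬ ∃ inp l l' dead s', Acts f out ack (e t) (e (t + 1)) p inp l l' dead s') :
    Still e t p := by
  rcases he.cases t with h1 | h1 | ⟨q, inp, l, l', dead, s', h1⟩
  · constructor <;> rw [h1]
    exact fun m ev hm => Or.inl hm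
  · constructor <;> rw [h1.eq]
    exact fun m ev hm => Or.inl hm
  · refine h1.still ?_
    rintro rfl
    exact absurd ⟨_, _, _, _, _, h1⟩ h

lemma Execution.begun_succ (he : Execution f out ack D e) {s t : ℕ} {p : Fin n} {a : Command U Q}
    (h : Begun e s t p a) (hs : Still e t p) : Begun e s (t + 1) p a where
  lt := h.lt.trans t.lt_succ_self
  inv := by
    have h1 := h.inv
    obtain ⟨l, h2⟩ := he.history_mono t.le_succ
    rw [← h2, List.getElem?_append_left]
    · exact h1
    · exact (List.getElem?_eq_some_iff.mp h1).1
  op := hs.op.trans h.op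
  last := fun m ev hm hev => (hs.history m ev hev).elim (h.last m ev hm) id
  pending := hs.pending.trans h.pending
  req := h.req.trans_le (he.req_mono t.le_succ p)

lemma Execution.core_succ (he : Execution f out ack D e) {s t ρ : ℕ} {p : Fin n}
    {a : Command U Q} (h : Core f e s t p a ρ) (hs : Still e t p)
    (hv : (e (t + 1)).val ((e t).op p) = (e t).val ((e t).op p))
    (hg : ∀ d τ, (d, .goodLA τ) ∈ (e (t + 1)).log p → (d, .goodLA τ) ∈ (e t).log p ∨ τ ≤ ρ) :
    Core f e s (t + 1) p a ρ where
  begun := he.begun_succ h.begun hs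
  read := h.read
  good := fun d τ hd => (hg d τ hd).elim (h.good d τ) id
  own := fun u hu => by
    rw [hs.op, hv]
    exact ⟨(h.own u hu).1, he.V_mono t.le_succ p p (h.own u hu).2⟩

/-- The frame rule: what is known in a phase survives every step in which the node neither begins
nor ends an operation, writes nothing, makes no request and announces nothing. -/
lemma Execution.phaseInv_succ (he : Execution f out ack D e) {t : ℕ} {p : Fin n}
    {π : Phase (Command U Q)} (h : PhaseInv f e t p π) (hs : Still e t p)
    (hv : π ≠ .idle → (e (t + 1)).val ((e t).op p) = (e t).val ((e t).op p))
    (hr : ((e (t + 1)).loc p).req = ((e t).loc p).req)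
    (hg : ∀ d τ, (d, .goodLA τ) ∈ (e (t + 1)).log p → (d, .goodLA τ) ∈ (e t).log p) :
    PhaseInv f e (t + 1) p π := by
  cases π with
  | idle => trivial
  | reading a =>
    obtain ⟨s, h1, h2, h3, h4⟩ := h
    exact ⟨s, he.begun_succ h1 hs, fun d τ hd => h2 d τ (hg d τ hd), by rwa [hr],
      by rw [hs.op, hv (by simp), h4]⟩
  | writing a ph r =>
    obtain ⟨s, ρ, w, h1, h2, h3, h4, h5, h6, h7⟩ := h
    exact ⟨s, ρ, w, he.core_succ h1 hs (hv (by simp)) fun d τ hd => Or.inl (hg d τ hd), h2, h3,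
      by omega, by omega, h6, by rwa [hr]⟩
  | agreeing a ph r =>
    obtain ⟨s, ρ, w, h1, h2, h3, h4, h5, h6⟩ := h
    exact ⟨s, ρ, w, he.core_succ h1 hs (hv (by simp)) fun d τ hd => Or.inl (hg d τ hd), h2, h3,
      by omega, he.wrote_mono h5 t.le_succ, h6⟩
  | borrowing a r =>
    obtain ⟨s, ρ, H, w, t', h1, h2, h3, h4, h5, h6⟩ := h
    exact ⟨s, ρ, H, w, t', he.core_succ h1 hs (hv (by simp)) fun d τ hd => Or.inl (hg d τ hd), h2,
      h3, h4, by omega, h6⟩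

lemma Begun.op_lt {s t : ℕ} {p : Fin n} {a : Command U Q} (h : Begun e s t p a) :
    (e t).op p < (e t).history.length := by
  rw [h.op]
  exact (List.getElem?_eq_some_iff.mp h.inv).1

lemma Begun.op_ne {s s' t : ℕ} {p q : Fin n} {a a' : Command U Q} (h : Begun e s t p a)
    (h' : Begun e s' t q a') (hpq : p ≠ q) : (e t).op p ≠ (e t).op q := by
  intro h1
  have h2 := h.inv
  rw [← h.op, h1, h'.op, h'.inv] at h2
  simp only [Option.some.injEq, Event.inv.injEq] at h2
  exact hpq h2.1.symm

/-- The invariant of the operations. -/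
structure OpInv (f : ℕ) (e : ℕ → Sys n U Q B) (t : ℕ) : Prop where
  phase : ∀ p, p ∉ (e t).crashed → PhaseInv f e t p ((e t).loc p).phase
  val_lt : ∀ i x, (e t).val i = some x → i < (e t).history.length

lemma OpInv.val_succ (he : Execution f out ack D e) {t : ℕ} (h : OpInv f e t) {s : ℕ} {p : Fin n}
    {a : Command U Q} (hb : Begun e s t p a)
    (hw : ¬ ∃ inp l l' dead s', Acts f out ack (e t) (e (t + 1)) p inp l l' dead s') :
    (e (t + 1)).val ((e t).op p) = (e t).val ((e t).op p) := by
  rcases he.cases t with h1 | h1 | ⟨q, inp, l, l', dead, s', h1⟩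
  · rw [h1]
  · rw [h1.eq]
  · refine h1.val_eq _ fun h2 x hx => ?_
    by_cases hpq : p = q
    · subst hpq
      exact hw ⟨_, _, _, _, _, h1⟩
    · subst hx
      have h3 := h.phase q h1.alive
      obtain ⟨s'', a', h4⟩ := h3.begun (by
        have := h1.micro
        cases this with
        | readUpdate _ _ h5 => rw [h5]; simp)
      exact hb.op_ne h4 hpq h2

lemma OpInv.val_lt_succ (he : Execution f out ack D e) {t : ℕ} (h : OpInv f e t) (i : ℕ)
    (x : Stamped n U) (hx : (e (t + 1)).val i = some x) : i < (e (t + 1)).history.length := by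
  suffices i < (e t).history.length from this.trans_le (he.history_mono t.le_succ).length_le
  rcases he.cases t with h1 | h1 | ⟨q, inp, l, l', dead, s', h1⟩
  · rw [h1] at hx; exact h.val_lt i x hx
  · rw [h1.eq] at hx; exact h.val_lt i x hx
  · by_cases h2 : i = (e t).op q ∧ ∃ x, inp = .write x
    · obtain ⟨rfl, y, rfl⟩ := h2
      obtain ⟨s'', a', h4⟩ := (h.phase q h1.alive).begun (by
        have := h1.micro
        cases this with
        | readUpdate _ _ h5 => rw [h5]; simp)
      exact h4.op_lt
    · rw [h1.val_eq i fun h3 y hy => h2 ⟨h3, y, hy⟩] at hx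
      exact h.val_lt i x hx

lemma Micro.not_goodLA {p : Fin n} {inp : Input n U Q B} {s s' : AsoState n U (Command U Q)}
    {l : List (Finset (Fin n) × Msg n U)} (h : Micro f out ack p inp s l s')
    (hs : ∀ a ph r, s.phase ≠ .agreeing a ph r) (d : Finset (Fin n)) (r : ℕ) :
    (d, .goodLA r) ∉ l := fun hd => by
  obtain ⟨-, -, -, -, ⟨a, ph, h1⟩, -⟩ := h.goodLA_mem d r hd
  exact hs a ph r h1

lemma Micro.receive_not_goodLA {p q : Fin n} {m : Msg n U} {s s' : AsoState n U (Command U Q)}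
    {l : List (Finset (Fin n) × Msg n U)} (h : Micro f out ack p (.receive q m) s l s')
    (d : Finset (Fin n)) (r : ℕ) : (d, .goodLA r) ∉ l := by
  cases h
  cases m with
  | value y => simp only [handle]; split_ifs <;> simp
  | _ => simp [handle]

lemma Begun.reading_succ {t : ℕ} {p : Fin n} {a : Command U Q}
    {l l' : List (Finset (Fin n) × Msg n U)} {dead : Bool} {s' : AsoState n U (Command U Q)}
    (h : Acts f out ack (e t) (e (t + 1)) p (.invoke a) l l' dead s') :
    Begun e t (t + 1) p a := by
  have hh : (e (t + 1)).history = (e t).history ++ [.inv p a] := h.history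
  refine ⟨t.lt_succ_self, by simp [hh], by rw [h.eq]; simp [Sys.exec], fun m ev hm hev => ?_,
    by rw [h.eq]; simp [Sys.exec], ?_⟩
  · have := (List.getElem?_eq_some_iff.mp hev).1
    rw [hh, List.length_append, List.length_singleton] at this
    omega
  · rw [h.loc_self]
    have hm := h.micro
    cases hm
    simp

lemma Execution.near_of_phase (he : Execution f out ack D e) {t : ℕ} {p : Fin n}
    {a : Command U Q} {ph r : ℕ} (hp : p ∉ (e t).crashed)
    (h : ((e t).loc p).phase = .writing a ph r) : Near f e r t :=
  he.near_of_sysTag t r (Or.inl ⟨p, hp, Or.inr (Or.inr ⟨a, ph, Or.inl h⟩)⟩)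

/-- The lattice operation that ends in the state at time `t`. -/
lemma PhaseInv.lat (he : Execution f out ack D e) {t : ℕ} {p : Fin n} {a : Command U Q}
    {ph r : ℕ} (h : PhaseInv f e t p (.agreeing a ph r))
    (hE : EQ f (fun j => upTo r (((e t).loc p).V j)) p) :
    ∃ s ρ w, Core f e s t p a ρ ∧ Level a ρ ph r ∧ s < w ∧
      Lat f e r (upTo r (((e t).loc p).V p)) w t ∧
      (ph ≠ 0 → ∀ u, a = .update u → ⟨u, ρ + 1, p⟩ ∈ upTo r (((e t).loc p).V p)) := by
  obtain ⟨s, ρ, w, h1, h2, h3, -, h5, h6⟩ := h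
  exact ⟨s, ρ, w, h1, h2, h3, he.lat_of_EQ h6 h5 hE, fun h7 u hu =>
    mem_upTo.mpr ⟨(h1.own u hu).2, h2.update h7 u hu⟩⟩

/-- The moves of the client thread carry the knowledge from one phase to the next. Whenever a
lattice operation is entered, its start `w` is the time of the present step, and the tag is then in
use at a live node, so that `near_of_phase` applies at `w + 1`. -/
lemma OpInv.phase_act (he : Execution f out ack D e) (hf : 2 * f < n) {t : ℕ}
    (h : OpInv f e t) {p : Fin n} {inp : Input n U Q B} {l l' : List (Finset (Fin n) × Msg n U)}
    {dead : Bool} {s' : AsoState n U (Command U Q)}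
    (h1 : Acts f out ack (e t) (e (t + 1)) p inp l l' dead s') (hp : p ∉ (e (t + 1)).crashed) :
    PhaseInv f e (t + 1) p ((e (t + 1)).loc p).phase := by
  have h2 := h.phase p h1.alive
  have hl := h1.loc_self
  have hlog := h1.log_self
  have hstill : (∀ a, inp ≠ .invoke a) → (∀ b, inp ≠ .reply b) → Still e t p :=
    fun h3 h4 => h1.still fun _ => ⟨h3, h4⟩
  have hval : (∀ x, inp ≠ .write x) → ∀ s a, Begun e s t p a →
      (e (t + 1)).val ((e t).op p) = (e t).val ((e t).op p) := fun h3 s a hb =>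
    h1.val_eq _ fun _ => h3
  have hm := h1.micro
  cases hm with
  | start _ a =>
    rw [hl]
    refine ⟨t, Begun.reading_succ h1, fun d τ hd => ?_, ?_, ?_⟩
    · rw [hlog] at hd
      simp only [List.mem_append, List.mem_cons, Prod.mk.injEq, reduceCtorEq, and_false,
        List.not_mem_nil, or_false] at hd
      exact he.seen_of_goodLA t p d τ hd
    · rw [hlog, hl]; simp
    -- The new operation is named by the length of the history, which lies beyond all names with a
    -- recorded value.
    · rw [(Begun.reading_succ h1).op, h1.val_eq _ fun _ x => by simp]
      by_contra h3
      obtain ⟨x, h3⟩ := Option.ne_none_iff_exists'.mp h3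
      exact lt_irrefl _ (h.val_lt _ x h3)
  | deliver _ q m =>
    rw [hl, handle_phase]
    refine he.phaseInv_succ h2 (hstill (by simp) (by simp)) (fun h3 => ?_) ?_ fun d τ hd => ?_
    · obtain ⟨s, a, hb⟩ := h2.begun h3
      exact hval (by simp) s a hb
    · rw [hl]; exact h1.micro.receive_phase.2
    · rw [hlog, List.mem_append] at hd
      exact hd.resolve_right (h1.micro.receive_not_goodLA d τ)
  | readUpdate _ u h3 h4 =>
    rw [h3] at h2
    obtain ⟨s, h5, h6, -, -⟩ := h2
    have hs := hstill (by simp) (by simp)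
    have hr : ReadAt f e ((e t).loc p).ackTag s := he.readAt_of_acks h3 h4 h5.req
    have hπ : ((e (t + 1)).loc p).phase = .writing (.update u) 0 ((e t).loc p).ackTag := by
      rw [hl]; rfl
    rw [hπ]
    refine ⟨s, _, t, ⟨he.begun_succ h5 hs, hr, fun d τ hd => ?_, ?_⟩,
      ⟨by simp, by simp, by simp, by simp⟩, h5.lt, t.lt_succ_self, ?_, he.near_of_phase hp hπ, ?_⟩
    · rw [hlog, List.mem_append] at hd
      rcases hd with hd | hd
      -- The tags of the node's earlier announcements had been seen by a quorum when the operation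
      -- was invoked, so the reading did not miss them.
      · exact hr.le hf (h6 d τ hd)
      · exact absurd hd (h1.micro.not_goodLA (by simp [h3]) d τ)
    · rintro _ ⟨⟩
      rw [hs.op]
      refine ⟨by rw [h1.eq]; simp [Sys.exec], ?_⟩
      rw [hl]; simp [enter, addOwn]
    · rw [hl]; simp [enter, addOwn]
    · rw [hlog, hl]; simp [enter, addOwn]
  | readQuery _ a h3 h4 =>
    rw [h3] at h2
    obtain ⟨s, h5, h6, -, -⟩ := h2
    have hs := hstill (by simp) (by simp)
    have hr : ReadAt f e ((e t).loc p).ackTag s := he.readAt_of_acks h3 h4 h5.req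
    have hπ : ((e (t + 1)).loc p).phase = .writing (.query a) 1 ((e t).loc p).ackTag := by
      rw [hl]; rfl
    rw [hπ]
    refine ⟨s, _, t, ⟨he.begun_succ h5 hs, hr, fun d τ hd => ?_, by simp⟩,
      ⟨by simp, by simp, by simp, by simp⟩, h5.lt, t.lt_succ_self, ?_, he.near_of_phase hp hπ, ?_⟩
    · rw [hlog, List.mem_append] at hd
      rcases hd with hd | hd
      · exact hr.le hf (h6 d τ hd)
      · exact absurd hd (h1.micro.not_goodLA (by simp [h3]) d τ)
    · rw [hl]; simp [enter]
    · rw [hlog, hl]; simp [enter]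
  | written _ a ph r h3 h4 =>
    rw [h3] at h2
    obtain ⟨s, ρ, w, h5, h6, h7, h8, h9, h10, h11⟩ := h2
    have hs := hstill (by simp) (by simp)
    rw [hl]
    exact ⟨s, ρ, w, he.core_succ h5 hs (hval (by simp) s a h5.begun) (by simp [hlog]; tauto), h6,
      h7, by omega, he.wrote_mono (he.wrote_of_acks h3 h4 h9) t.le_succ, h10⟩
  | goodFirst _ a r h3 h4 h5 =>
    rw [h3] at h2
    obtain ⟨s, ρ, w, h6, h7, h8, h9, -⟩ := h2
    have hs := hstill (by simp) (by simp)
    have hρ := h7.zero rfl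
    have hπ : ((e (t + 1)).loc p).phase = .writing a 1 (r + 1) := by rw [hl]; rfl
    rw [hπ]
    refine ⟨s, ρ, t, he.core_succ h6 hs (hval (by simp) s a h6.begun) ?_,
      ⟨by simp, by simp, by omega, fun _ _ _ => by omega⟩, by omega, by omega, ?_,
      he.near_of_phase hp hπ, ?_⟩
    · intro d τ hd
      rw [hlog] at hd
      simp only [List.mem_append, List.mem_cons, Prod.mk.injEq, Msg.goodLA.injEq, reduceCtorEq,
        and_false, List.not_mem_nil, or_false] at hd
      -- The only new announcement has the tag of the phase 0 operation, which is `ρ`.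
      exact hd.imp_right fun h => h.2.trans_le hρ.le
    · rw [hl]; simp [enter]
    · rw [hlog, hl]; simp [enter]
  | good => rw [hl]; trivial
  | retry _ a ph r h3 h4 h5 h6 =>
    rw [h3] at h2
    obtain ⟨s, ρ, w, h7, h8, h9, h10, -⟩ := h2
    have hs := hstill (by simp) (by simp)
    have hπ : ((e (t + 1)).loc p).phase = .writing a (ph + 1) ((e t).loc p).maxTag := by
      rw [hl]; rfl
    rw [hπ]
    have h11 := h8.add_le
    have h12 := h8.le
    refine ⟨s, ρ, t, he.core_succ h7 hs (hval (by simp) s a h7.begun) ?_,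
      ⟨by omega, by simp, by omega, fun _ _ _ => ?_⟩, by omega, by omega, ?_,
      he.near_of_phase hp hπ, ?_⟩
    · intro d τ hd
      rw [hlog] at hd
      simp only [List.mem_append, List.mem_cons, Prod.mk.injEq, reduceCtorEq,
        and_false, List.not_mem_nil, or_false] at hd
      exact Or.inl hd
    · rcases Nat.eq_zero_or_pos ph with h13 | h13
      · have := h8.zero h13
        omega
      · omega
    · rw [hl]; simp [enter]
    · rw [hlog, hl]; simp [enter]
  | borrow _ a r h3 h4 h5 =>
    rw [h3] at h2
    obtain ⟨s, ρ, w, h6, h7, h8, h9, h10⟩ := PhaseInv.lat he h2 h4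
    have hs := hstill (by simp) (by simp)
    have h11 := h7.add_le
    rw [hl]
    exact ⟨s, ρ, _, w, t, he.core_succ h6 hs (hval (by simp) s a h6.begun) (by simp [hlog]; tauto),
      by omega, h9, h8, t.le_succ, h10 (by simp)⟩
  | borrowed => rw [hl]; trivial
  | skip =>
    rw [hl]
    refine he.phaseInv_succ h2 (hstill (by simp) (by simp)) (fun h3 => ?_) (by rw [hl]) (by simp [hlog])
    obtain ⟨s, a, hb⟩ := h2.begun h3
    exact hval (by simp) s a hb

theorem Execution.opInv (he : Execution f out ack D e) (hf : 2 * f < n) (t : ℕ) :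
    OpInv f e t := by
  induction t with
  | zero =>
    refine ⟨fun p _ => ?_, fun i x hx => ?_⟩
    · rw [he.loc_zero]; trivial
    · rw [he.zero] at hx; cases hx
  | succ t ih =>
    refine ⟨fun p hp => ?_, ih.val_lt_succ he⟩
    by_cases h : ∃ inp l l' dead s', Acts f out ack (e t) (e (t + 1)) p inp l l' dead s'
    · obtain ⟨inp, l, l', dead, s', h⟩ := h
      exact ih.phase_act he hf h hp
    · have h1 := ih.phase p fun h2 => hp (he.crashed_mono t.le_succ h2)
      obtain ⟨h2, h3, -⟩ := (he.node_cases t p).resolve_right h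
      rw [h2]
      refine he.phaseInv_succ h1 (he.still t p h) (fun h4 => ?_) (by rw [h2]) (by simp [h3])
      obtain ⟨s, a, hb⟩ := h1.begun h4
      exact ih.val_succ he hb h

end Operations


/-! ### Outcomes of operations and the values they write -/

section Records

variable {n : ℕ} {U Q B : Type*} {f : ℕ} {out : Q → Finset (Stamped n U) → B} {ack : B}
  {D : ℝ} {e : ℕ → Sys n U Q B}

/-- The node's announcements so far have tags at most `ρ`, and the current tag is at least `ρ`.
Hence the tags that a node announces never decrease. -/
lemma PhaseInv.goodLA_le {t : ℕ} {p : Fin n} {a : Command U Q} {ph r : ℕ}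
    (h : PhaseInv f e t p (.agreeing a ph r)) {d : Finset (Fin n)} {τ : ℕ}
    (hd : (d, .goodLA τ) ∈ (e t).log p) : τ ≤ r := by
  obtain ⟨s, ρ, w, h1, h2, -⟩ := h
  have h3 := h1.good d τ hd
  have h4 := h2.add_le
  rcases Nat.eq_zero_or_pos ph with h5 | h5
  · have := h2.zero h5
    omega
  · omega

/-- A good lattice operation is announced when it ends. -/
lemma Execution.goodLat_of_goodLA (he : Execution f out ack D e) (hf : 2 * f < n) (t : ℕ)
    (j : Fin n) (L : List (Finset (Fin n) × Msg n U)) (d : Finset (Fin n)) (r : ℕ)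
    (hL : L ++ [(d, .goodLA r)] <+: (e t).log j) :
    ∃ w t', t' < t ∧ GoodLat f e r (upTo r (((e t').loc j).V j)) w t' ∧ (e t').log j = L ∧
      ∀ d τ, (d, .goodLA τ) ∈ L → τ ≤ r := by
  induction t with
  | zero => rw [he.log_zero] at hL; simp at hL
  | succ t ih =>
    rcases he.node_cases t j with ⟨-, h1, -⟩ | ⟨inp, l, l', dead, s', h1⟩
    · rw [h1] at hL
      obtain ⟨w, t', h2, h3⟩ := ih hL
      exact ⟨w, t', by omega, h3⟩
    · rw [h1.log_self] at hL
      rcases prefix_append_cases hL with hL | ⟨L', h2, h3⟩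
      · obtain ⟨w, t', h2, h3⟩ := ih hL
        exact ⟨w, t', by omega, h3⟩
      · rcases List.eq_nil_or_concat L' with rfl | ⟨L', y, rfl⟩
        · rw [List.append_nil] at h2
          obtain ⟨w, t', h4, h5⟩ := ih (h2 ▸ List.prefix_rfl)
          exact ⟨w, t', by omega, h5⟩
        · rw [List.concat_eq_append, ← List.append_assoc] at h2
          rw [List.concat_eq_append] at h3
          obtain ⟨rfl, h4⟩ := List.append_inj' h2 rfl
          obtain rfl := List.singleton_inj.mp h4
          obtain ⟨-, -, h5, -, ⟨a, ph, h6⟩, h7, h8⟩ :=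
            h1.micro.goodLA_mem d r (h3.subset (by simp))
          -- The announcement is the first message of its step, so `L` is the log before that step.
          have h9 : L' = [] := by
            rcases L' with _ | ⟨z, L'⟩
            · rfl
            · obtain ⟨l₂, rfl⟩ := h3
              exact absurd (by simp) (h5 r)
          have h10 := (he.opInv hf t).phase j h1.alive
          rw [h6] at h10
          obtain ⟨s, ρ, w, -, -, -, h11, -⟩ := h10.lat he h7
          subst h9
          refine ⟨w, t, t.lt_succ_self, ⟨h11, he.agreedGood_of_EQ h7 h8⟩, by simp, fun d τ hd => ?_⟩
          rw [List.append_nil] at hd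
          exact h10.goodLA_le hd

/-- The borrowed views are views of good lattice operations. -/
lemma Execution.goodLat_of_good (he : Execution f out ack D e) (hf : 2 * f < n) (t : ℕ)
    {i j : Fin n} (hj : j ≠ i) (ρ : ℕ) (hρ : ρ ∈ ((e t).loc i).good j) :
    ∃ r w t', ρ ≤ r ∧ t' ≤ t ∧ GoodLat f e r (((e t).loc i).D j) w t' := by
  induction t generalizing ρ with
  | zero => rw [he.loc_zero] at hρ; simp [blank] at hρ
  | succ t ih =>
    rcases he.node_cases t i with ⟨h1, -, -⟩ | ⟨inp, l, l', dead, s', h1⟩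
    · rw [h1] at hρ ⊢
      obtain ⟨r, w, t', h2, h3, h4⟩ := ih ρ hρ
      exact ⟨r, w, t', h2, by omega, h4⟩
    · have old : ∀ {ρ}, ρ ∈ ((e t).loc i).good j → s'.D j = ((e t).loc i).D j →
          ∃ r w t', ρ ≤ r ∧ t' ≤ t + 1 ∧ GoodLat f e r (s'.D j) w t' := fun h2 h3 => by
        obtain ⟨r, w, t', h4, h5, h6⟩ := ih _ h2
        exact ⟨r, w, t', h4, by omega, h3 ▸ h6⟩
      rw [h1.loc_self] at hρ ⊢
      rcases h1.micro.good_eq with ⟨h2, h3, -⟩ | ⟨k, r, rfl⟩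
      · rw [h2] at hρ
        exact old hρ (by rw [h3])
      · obtain ⟨-, hs'⟩ := h1.micro.of_goodLA
        by_cases hk : j = k
        · subst hk
          have h2 := he.got_prefix (t + 1) i j
          rw [h1.got_self] at h2
          simp only [Input.gets, Function.update_self] at h2
          obtain ⟨L, d, h3, h4, h5⟩ := exists_of_prefix_msgsTo_concat h2
          obtain ⟨w, t', h6, h7, h8, h9⟩ := he.goodLat_of_goodLA hf _ j L d r h3
          refine ⟨r, w, t', ?_, h6.le, ?_⟩
          · rw [hs'] at hρ
            simp only [Function.update_self, Finset.mem_insert] at hρ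
            rcases hρ with rfl | hρ
            · exact le_rfl
            -- A later announcement of `j` overwrites the borrowed view, but its tag is not smaller.
            · rw [he.mem_good, ← h5, mem_msgsTo] at hρ
              obtain ⟨d', h10, -⟩ := hρ
              exact h9 d' ρ h10
          · convert h7 using 1
            rw [hs']
            simp only [Function.update_self]
            ext x
            -- By FIFO order, what arrived from `j` before the announcement is what `j` had logged
            -- when its lattice operation ended. For `j = i` this fails: `V i` may have grown while
            -- the message was in transit.
            rw [mem_upTo, mem_upTo, he.mem_V_of_ne t hj, he.mem_V_self, h8, ← h5, mem_msgsTo]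
            refine and_congr_left fun _ => ⟨?_, fun h => ⟨_, h, Finset.mem_univ _⟩⟩
            rintro ⟨d', h10, -⟩
            obtain rfl := he.value_univ t' j d' x (h8 ▸ h10)
            exact h10
        · refine old ?_ ?_
          · rw [hs'] at hρ
            simpa [hk] using hρ
          · rw [hs']
            simp [hk]

lemma Execution.phase_ne_idle (he : Execution f out ack D e) (t : ℕ) (p : Fin n)
    (hp : p ∉ (e t).crashed) (h : (e t).pending p ≠ none) : ((e t).loc p).phase ≠ .idle := by
  induction t with
  | zero => rw [he.zero] at h; exact absurd rfl h
  | succ t ih =>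
    have hp' : p ∉ (e t).crashed := fun h => hp (he.crashed_mono t.le_succ h)
    by_cases h1 : ∃ inp l l' dead s', Acts f out ack (e t) (e (t + 1)) p inp l l' dead s'
    · obtain ⟨inp, l, l', dead, s', h1⟩ := h1
      have hd : dead = false := by
        rw [h1.crashed] at hp
        cases dead
        · rfl
        · simp at hp
      rw [h1.loc_self]
      have hm := h1.micro
      have h2 : ∀ b, inp ≠ .reply b := by
        rintro b rfl
        rw [h1.eq, hd] at h
        simp [Sys.exec] at h
      by_cases h3 : ∃ a, inp = .invoke a
      · obtain ⟨a, rfl⟩ := h3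
        cases hm
        simp
      · push Not at h3
        rw [h1.pending_eq p fun _ => ⟨h3, h2⟩] at h
        have h4 := ih hp' h
        cases hm with
        | start => simp
        | deliver => rwa [handle_phase]
        | good => exact absurd rfl (h2 _)
        | borrowed => exact absurd rfl (h2 _)
        | skip => exact h4
        | _ => simp [enter]
    · rw [((he.node_cases t p).resolve_right h1).1]
      rw [(he.still t p h1).pending] at h
      exact ih hp' h

/-- A value is written at the end of the reading phase, in which the invariant says that nothing is
recorded yet for the operation. So no record is overwritten. -/
lemma Execution.val_mono (he : Execution f out ack D e) (hf : 2 * f < n) {t t' : ℕ} (h : t ≤ t')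
    {i : ℕ} {x : Stamped n U} (hx : (e t).val i = some x) : (e t').val i = some x := by
  induction t', h using Nat.le_induction with
  | base => exact hx
  | succ t' _ ih =>
    rcases he.cases t' with h1 | h1 | ⟨q, inp, l, l', dead, s', h1⟩
    · rwa [h1]
    · rwa [h1.eq]
    · rw [h1.val_eq i ?_, ih]
      rintro rfl y rfl
      have h2 := (he.opInv hf t').phase q h1.alive
      have hm := h1.micro
      cases hm with
      | readUpdate _ _ h3 =>
        rw [h3] at h2
        obtain ⟨s, -, -, -, h4⟩ := h2
        rw [h4] at ih
        cases ih

lemma completesAt_mono {In Out : Type*} {H H' : List (Event n In Out)} (h : H <+: H') {i j : ℕ}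
    {b : Out} (hc : CompletesAt H i j b) : CompletesAt H' i j b := by
  obtain ⟨h1, p, a, h2, h3, h4⟩ := hc
  obtain ⟨l, rfl⟩ := h
  have h5 := (List.getElem?_eq_some_iff.mp h3).1
  refine ⟨h1, p, a, ?_, ?_, fun m ev hm hm' hev => h4 m ev hm hm' ?_⟩
  · rwa [List.getElem?_append_left (h1.trans h5)]
  · rwa [List.getElem?_append_left h5]
  · rwa [List.getElem?_append_left (hm'.trans h5)] at hev

/-- The reply of `p` completes its operation. -/
lemma Begun.completesAt {s t : ℕ} {p : Fin n} {a : Command U Q} {b : B} (h : Begun e s t p a)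
    {l l' : List (Finset (Fin n) × Msg n U)} {s' : AsoState n U (Command U Q)}
    (h1 : Acts f out ack (e t) (e (t + 1)) p (.reply b) l l' false s') :
    CompletesAt (e (t + 1)).history (e s).history.length (e t).history.length b := by
  have h2 := (List.getElem?_eq_some_iff.mp h.inv).1
  rw [h1.history]
  refine ⟨h2, p, a, ?_, by simp [Input.event], fun m ev hm hm' hev => ?_⟩
  · rw [List.getElem?_append_left h2, h.inv]
  · rw [List.getElem?_append_left hm'] at hev
    exact h.last m ev hm hev

/-- An operation is complete unless it is the current operation of its node. -/
lemma Execution.completes_or (he : Execution f out ack D e) (hf : 2 * f < n) (t : ℕ) (i : ℕ)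
    (p : Fin n) (a : Command U Q) (hi : (e t).history[i]? = some (.inv p a)) :
    (∃ j b, CompletesAt (e t).history i j b) ∨
      (i = (e t).op p ∧ (p ∈ (e t).crashed ∨ (e t).pending p ≠ none)) := by
  induction t with
  | zero => rw [he.zero] at hi; simp [Sys.initial, Config.initial] at hi
  | succ t ih =>
    have hh := he.history_mono t.le_succ
    have old : Still e t p → (∃ j b, CompletesAt (e (t + 1)).history i j b) ∨
        (i = (e (t + 1)).op p ∧ (p ∈ (e (t + 1)).crashed ∨ (e (t + 1)).pending p ≠ none)) := by
      intro hs
      rcases ih ((hs.history i _ hi).resolve_right (by simp [Event.node])) with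
        ⟨j, b, h1⟩ | ⟨h1, h2⟩
      · exact Or.inl ⟨j, b, completesAt_mono hh h1⟩
      · rw [hs.op, hs.pending]
        exact Or.inr ⟨h1, h2.imp_left fun h => he.crashed_mono t.le_succ h⟩
    by_cases h1 : ∃ inp l l' dead s', Acts f out ack (e t) (e (t + 1)) p inp l l' dead s'
    · obtain ⟨inp, l, l', dead, s', h1⟩ := h1
      by_cases h2 : (∀ a, inp ≠ .invoke a) ∧ ∀ b, inp ≠ .reply b
      · exact old (h1.still fun _ => h2)
      · rw [not_and_or] at h2
        push Not at h2
        rcases h2 with ⟨a', rfl⟩ | ⟨b, rfl⟩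
        · rcases h1.history_cases hi with h2 | ⟨rfl, -⟩
          · rcases ih h2 with ⟨j, b, h3⟩ | ⟨-, h3⟩
            · exact Or.inl ⟨j, b, completesAt_mono hh h3⟩
            · exact absurd h3 (not_or.mpr ⟨h1.alive, not_not.mpr h1.offers⟩)
          · rw [h1.eq]
            simp [Sys.exec]
        · have h2 : (e t).history[i]? = some (.inv p a) := by
            rcases h1.history_cases hi with h2 | ⟨rfl, h2⟩
            · exact h2
            · cases dead <;> simp [Input.event] at h2
          rcases ih h2 with ⟨j, b, h3⟩ | ⟨h3, h4⟩
          · exact Or.inl ⟨j, b, completesAt_mono hh h3⟩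
          · cases dead with
            | true =>
              refine Or.inr ⟨by rw [h3, h1.op_eq p fun _ => by simp], Or.inl ?_⟩
              rw [h1.crashed]; simp
            | false =>
              obtain ⟨s, a', hb⟩ := ((he.opInv hf t).phase p h1.alive).begun
                (he.phase_ne_idle t p h1.alive (h4.resolve_left h1.alive))
              exact Or.inl ⟨_, b, by rw [h3, hb.op]; exact hb.completesAt h1⟩
    · exact old (he.still t p h1)

/-- The outcome of the operation `a` that was invoked at position `i` of the history at time `s`,
and that ended at time `t` with the reply `b`. -/
def Outcome (f : ℕ) (out : Q → Finset (Stamped n U) → B) (ack : B) (e : ℕ → Sys n U Q B)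
    (T s t i : ℕ) (b : B) : Command U Q → Prop
  | .update _ => b = ack ∧ ∃ x r H w t', (e T).val i = some x ∧ Lat f e r H w t' ∧ x ∈ H ∧ t' ≤ t
  | .query q => ∃ r H w t', b = out q H ∧ GoodLat f e r H w t' ∧ s ≤ w ∧ t' ≤ t ∧ ReadAt f e r s

lemma Execution.outcome_mono (he : Execution f out ack D e) (hf : 2 * f < n) {T T' s t i : ℕ}
    {b : B} {a : Command U Q} (hT : T ≤ T') (h : Outcome f out ack e T s t i b a) :
    Outcome f out ack e T' s t i b a := by
  cases a with
  | update u =>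
    obtain ⟨h1, x, r, H, w, t', h2, h3⟩ := h
    exact ⟨h1, x, r, H, w, t', he.val_mono hf hT h2, h3⟩
  | query q => exact h

/-- The outcome of the operation that ends with the reply `b` at time `t`. -/
lemma Execution.outcome_of_reply (he : Execution f out ack D e) (hf : 2 * f < n) {t : ℕ}
    {p : Fin n} {b : B} {l l' : List (Finset (Fin n) × Msg n U)} {s' : AsoState n U (Command U Q)}
    {dead : Bool} (h : Acts f out ack (e t) (e (t + 1)) p (.reply b) l l' dead s') :
    ∃ s a, Begun e s t p a ∧ Outcome f out ack e t s t (e s).history.length b a := by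
  have h1 := (he.opInv hf t).phase p h.alive
  have hm := h.micro
  cases hm with
  | good _ a ph r h2 h3 h4 h5 =>
    rw [h2] at h1
    obtain ⟨s, ρ, w, h6, h7, h8, h9, h10⟩ := h1.lat he h4
    refine ⟨s, a, h6.begun, ?_⟩
    have h11 := h7.add_le
    cases a with
    | update u =>
      exact ⟨rfl, _, r, _, w, t, h6.begun.op ▸ (h6.own u rfl).1, h9, h10 h3 u rfl, le_rfl⟩
    | query q =>
      exact ⟨r, _, w, t, rfl, ⟨h9, he.agreedGood_of_EQ h4 h5⟩, h8.le, le_rfl,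
        h6.read.mono (by omega)⟩
  | borrowed _ a r j h2 h3 =>
    rw [h2] at h1
    obtain ⟨s, ρ, H, w, t', h4, h5, h6, h7, h8, h9⟩ := h1
    refine ⟨s, a, h4.begun, ?_⟩
    cases a with
    | update u =>
      exact ⟨rfl, _, r, H, w, t', h4.begun.op ▸ (h4.own u rfl).1, h6, h9 u rfl, h8⟩
    | query q =>
      -- The node itself has announced only tags up to `ρ`, and `r` is at least `ρ + 2`.
      have hj : j ≠ p := by
        rintro rfl
        rw [he.mem_good] at h3
        obtain ⟨d, h10, -⟩ := he.exists_log_of_got h3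
        have := h4.good d r h10
        omega
      obtain ⟨r', w', t'', h10, h11, h12⟩ := he.goodLat_of_good hf t hj r h3
      refine ⟨r', _, w', t'', rfl, h12, ?_, h11, h4.read.mono (by omega)⟩
      -- If the borrowed lattice operation had started before the query was invoked, a quorum would
      -- have seen the tag `r' - 1` by then, and the query would have read a tag `ρ` with `r' ≤ ρ +
      -- 1`.
      by_contra h13
      have := h4.read.le_succ hf (he.near_mono h12.near (by omega))
      omega

/-- Each reply ends an operation. -/
lemma Execution.outcome_of_res (he : Execution f out ack D e) (hf : 2 * f < n) (T j : ℕ)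
    (p : Fin n) (b : B) (hj : (e T).history[j]? = some (.res p b)) :
    ∃ s t a, s < t ∧ t < T ∧ (e s).history.length < j ∧ (e t).history.length = j ∧
      (e T).history[(e s).history.length]? = some (.inv p a) ∧
      CompletesAt (e T).history (e s).history.length j b ∧
      Outcome f out ack e T s t (e s).history.length b a := by
  induction T with
  | zero => rw [he.zero] at hj; simp [Sys.initial, Config.initial] at hj
  | succ T ih =>
    have hh := he.history_mono T.le_succ
    have old : (e T).history[j]? = some (.res p b) → ∃ s t a, s < t ∧ t < T + 1 ∧
        (e s).history.length < j ∧ (e t).history.length = j ∧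
        (e (T + 1)).history[(e s).history.length]? = some (.inv p a) ∧
        CompletesAt (e (T + 1)).history (e s).history.length j b ∧
        Outcome f out ack e (T + 1) s t (e s).history.length b a := fun h => by
      obtain ⟨s, t, a, h1, h2, h3, h4, h5, h6, h7⟩ := ih h
      exact ⟨s, t, a, h1, h2.trans T.lt_succ_self, h3, h4, by
        obtain ⟨l, hl⟩ := hh
        rw [← hl, List.getElem?_append_left (List.getElem?_eq_some_iff.mp h5).1, h5],
        completesAt_mono hh h6, he.outcome_mono hf T.le_succ h7⟩
    rcases he.cases T with h1 | h1 | ⟨q, inp, l, l', dead, s', h1⟩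
    · exact old (by rwa [h1] at hj)
    · exact old (by rwa [h1.eq] at hj)
    · rcases h1.history_cases hj with h2 | ⟨rfl, h2⟩
      · exact old h2
      · obtain ⟨h3, ⟨a, -, h4⟩ | ⟨b', rfl, rfl, h4⟩⟩ := h1.node_event h2
        · simp at h4
        · obtain ⟨rfl, rfl⟩ := (Event.res.injEq _ _ _ _).mp h4
          obtain ⟨s, a, h5, h6⟩ := he.outcome_of_reply hf h1
          have h7 := h5.completesAt h1
          exact ⟨s, T, a, h5.lt, T.lt_succ_self, h7.1, rfl, by
            obtain ⟨l, hl⟩ := hh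
            rw [← hl, List.getElem?_append_left (List.getElem?_eq_some_iff.mp h5.inv).1, h5.inv],
            h7, he.outcome_mono hf T.le_succ h6⟩

lemma completesAt_le {In Out : Type*} {H : List (Event n In Out)} {i j : ℕ} {b : Out}
    (h : CompletesAt H i j b) {p : Fin n} {a : In} (hi : H[i]? = some (.inv p a)) {m : ℕ}
    {ev : Event n In Out} (hm : H[m]? = some ev) (hp : ev.node = p) (him : i < m) : j ≤ m := by
  obtain ⟨-, p', a', h2, -, h4⟩ := h
  rw [hi] at h2
  simp only [Option.some.injEq, Event.inv.injEq] at h2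
  obtain ⟨rfl, -⟩ := h2
  by_contra h5
  exact h4 m ev him (not_le.mp h5) hm hp

lemma completesAt_node {In Out : Type*} {H : List (Event n In Out)} {i j : ℕ} {b : Out}
    (h : CompletesAt H i j b) {p : Fin n} {a : In} (hi : H[i]? = some (.inv p a)) :
    H[j]? = some (.res p b) := by
  obtain ⟨-, p', a', h2, h3, -⟩ := h
  rw [hi] at h2
  simp only [Option.some.injEq, Event.inv.injEq] at h2
  rw [h3, h2.1]

lemma completesAt_unique {In Out : Type*} {H : List (Event n In Out)} {i i' j : ℕ} {b b' : Out}
    (h : CompletesAt H i j b) (h' : CompletesAt H i' j b') : i = i' := by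
  obtain ⟨h1, p, a, h2, h3, h4⟩ := h
  obtain ⟨h1', p', a', h2', h3', h4'⟩ := h'
  rw [h3] at h3'
  simp only [Option.some.injEq, Event.res.injEq] at h3'
  obtain ⟨rfl, -⟩ := h3'
  rcases lt_trichotomy i i' with h5 | h5 | h5
  · exact absurd rfl (h4 i' _ h5 h1' h2')
  · exact h5
  · exact absurd rfl (h4' i _ h5 h1 h2)

/-- The outcome of a completed operation. -/
lemma Execution.outcome_of_completesAt (he : Execution f out ack D e) (hf : 2 * f < n)
    {T i j : ℕ} {b : B} (hc : CompletesAt (e T).history i j b) {p : Fin n} {a : Command U Q}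
    (hi : (e T).history[i]? = some (.inv p a)) :
    ∃ s t, s < t ∧ t < T ∧ (e s).history.length = i ∧ (e t).history.length = j ∧
      Outcome f out ack e T s t i b a := by
  obtain ⟨s, t, a', h1, h2, h3, h4, h5, h6, h7⟩ :=
    he.outcome_of_res hf T j p b (completesAt_node hc hi)
  obtain rfl := completesAt_unique hc h6
  rw [hi] at h5
  simp only [Option.some.injEq, Event.inv.injEq, true_and] at h5
  subst h5
  exact ⟨s, t, h1, h2, rfl, h4, h7⟩

lemma Execution.lt_of_length_lt (he : Execution f out ack D e) {t t' : ℕ}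
    (h : (e t).history.length < (e t').history.length) : t < t' := by
  by_contra h1
  exact absurd (he.history_mono (not_lt.mp h1)).length_le (not_le.mpr h)

lemma Lat.tag_le {H : Finset (Stamped n U)} {r w t : ℕ} (h : Lat f e r H w t) (hf : 2 * f < n)
    {x : Stamped n U} (hx : x ∈ H) : x.tag ≤ r := by
  obtain ⟨k, ⟨L, -, h1⟩, -⟩ := h.agreed.exists_and hf h.agreed
  exact ((h1 x).mp hx).2

/-- The value `x` was written by the operation invoked at position `i` of the history, which was
invoked at time `s` and sent the value at time `w`. -/
structure Written (f : ℕ) (e : ℕ → Sys n U Q B) (i : ℕ) (x : Stamped n U) (s w : ℕ) : Prop where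
  begun : Begun e s w x.owner (.update x.val)
  alive : x.owner ∉ (e w).crashed
  phase : ((e w).loc x.owner).phase = .reading (.update x.val)
  index : (e s).history.length = i
  fresh : ∀ q, (Finset.univ, .value x) ∉ (e w).log q
  read : ∃ ρ, ReadAt f e ρ s ∧ x.tag = ρ + 1

/-- The invariant of the values. -/
structure ValInv (f : ℕ) (e : ℕ → Sys n U Q B) (t : ℕ) : Prop where
  written : ∀ i x, (e t).val i = some x → ∃ s w, w < t ∧ Written f e i x s w
  exists_val : ∀ q x, (Finset.univ, .value x) ∈ (e t).log q → ∃ i, (e t).val i = some x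
  injective : ∀ i i' x, (e t).val i = some x → (e t).val i' = some x → i = i'

/-- A value that is about to be written is new. -/
lemma ValInv.fresh (he : Execution f out ack D e) (hf : 2 * f < n) {t : ℕ} (h : ValInv f e t)
    {s : ℕ} {p : Fin n} {u : U} {ρ : ℕ} (hb : Begun e s t p (.update u)) (hr : ReadAt f e ρ s)
    (hv : (e t).val ((e t).op p) = none) (i : ℕ) :
    (e t).val i ≠ some ⟨u, ρ + 1, p⟩ := by
  intro hi
  obtain ⟨s', w, h1, h2⟩ := h.written i _ hi
  have h3 : (e t).history[i]? = some (.inv p (.update u)) := by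
    obtain ⟨l, h4⟩ := he.history_mono h1.le
    have h5 := h2.begun.inv
    rw [h2.index] at h5
    rw [← h4, List.getElem?_append_left (List.getElem?_eq_some_iff.mp h5).1, h5]
  -- An earlier operation of the same node is complete, so a quorum saw a tag at least as large as
  -- that of its value before the present reading started, and the present value has a larger tag.
  -- The operation itself has no value yet, and the node has no later one.
  rcases lt_trichotomy i (e s).history.length with h4 | h4 | h4
  · rcases he.completes_or hf t i p _ h3 with ⟨j, b, h5⟩ | ⟨h5, -⟩
    · have h6 := completesAt_le h5 h3 hb.inv rfl h4
      have h9 : j ≠ (e s).history.length := by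
        rintro rfl
        have h8 := completesAt_node h5 h3
        rw [hb.inv] at h8
        cases h8
      obtain ⟨s₁, t₁, -, -, -, h10, -, x, r, H, w', t', h11, h12, h13, h14⟩ :=
        he.outcome_of_completesAt hf h5 h3
      rw [hi] at h11
      obtain rfl := (Option.some.injEq _ _).mp h11
      have h15 := h12.tag_le hf h13
      have h16 : t₁ < s := he.lt_of_length_lt (by omega)
      have h17 := hr.le hf (he.seen_mono (he.seen_of_lat h12) (by omega))
      simp only at h15
      omega
    · rw [hb.op] at h5
      omega
  · rw [← hb.op] at h4
    rw [h4, hv] at hi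
    cases hi
  · exact hb.last i _ h4 h3 rfl

/-- A value that is written is new. -/
lemma ValInv.of_write (he : Execution f out ack D e) (hf : 2 * f < n) {t : ℕ} (h : ValInv f e t)
    {p : Fin n} {x : Stamped n U} {l l' : List (Finset (Fin n) × Msg n U)} {dead : Bool}
    {s' : AsoState n U (Command U Q)}
    (h1 : Acts f out ack (e t) (e (t + 1)) p (.write x) l l' dead s') :
    ∃ s, Written f e ((e t).op p) x s t ∧ ∀ i, (e t).val i ≠ some x := by
  have h2 := (he.opInv hf t).phase p h1.alive
  have hm := h1.micro
  cases hm with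
  | readUpdate _ u h3 h4 =>
    rw [h3] at h2
    obtain ⟨s, h5, -, -, h6⟩ := h2
    have h7 := he.readAt_of_acks h3 h4 h5.req
    have h8 := h.fresh he hf h5 h7 h6
    refine ⟨s, ⟨h5, h1.alive, h3, h5.op.symm, fun q hq => ?_, _, h7, rfl⟩, h8⟩
    obtain ⟨i, h9⟩ := h.exists_val q _ hq
    exact h8 i h9

theorem Execution.valInv (he : Execution f out ack D e) (hf : 2 * f < n) (t : ℕ) :
    ValInv f e t := by
  induction t with
  | zero =>
    refine ⟨fun i x hx => ?_, fun q x hx => ?_, fun i i' x hx => ?_⟩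
    · rw [he.zero] at hx; cases hx
    · rw [he.log_zero] at hx; cases hx
    · rw [he.zero] at hx; cases hx
  | succ t ih =>
    have old : (e (t + 1)).val = (e t).val → (∀ q x, (Finset.univ, .value x) ∈ (e (t + 1)).log q →
        ∃ q', (Finset.univ, .value x) ∈ (e t).log q') → ValInv f e (t + 1) := fun h1 h2 => by
      refine ⟨fun i x hx => ?_, fun q x hx => ?_, fun i i' x hx hx' => ?_⟩
      · obtain ⟨s, w, h3, h4⟩ := ih.written i x (h1 ▸ hx)
        exact ⟨s, w, by omega, h4⟩
      · obtain ⟨q', h3⟩ := h2 q x hx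
        rw [h1]
        exact ih.exists_val q' x h3
      · rw [h1] at hx hx'
        exact ih.injective i i' x hx hx'
    rcases he.cases t with h1 | h1 | ⟨p, inp, l, l', dead, s', h1⟩
    · exact old (by rw [h1]) (by rw [h1]; exact fun q x hx => ⟨q, hx⟩)
    · exact old (by rw [h1.eq]) (by rw [h1.eq]; exact fun q x hx => ⟨q, hx⟩)
    · by_cases h2 : ∃ x, inp = .write x
      · obtain ⟨x, rfl⟩ := h2
        have hm := h1.micro
        have hlog : ∀ q y, (Finset.univ, .value y) ∈ (e (t + 1)).log q →
            (Finset.univ, .value y) ∈ (e t).log q ∨ y = x := by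
          intro q y hy
          by_cases hq : q = p
          · subst hq
            rw [h1.log_self, List.mem_append, hm.value_mem] at hy
            rcases hy with hy | ⟨-, hy | ⟨j, hy, -⟩⟩
            · exact Or.inl hy
            · injection hy with hy
              exact Or.inr hy.symm
            · cases hy
          · rw [h1.log_ne hq] at hy
            exact Or.inl hy
        have hval : ∀ i y, (e (t + 1)).val i = some y →
            (e t).val i = some y ∨ (i = (e t).op p ∧ y = x) := by
          intro i y hy
          rw [h1.eq] at hy
          simp only [Sys.exec, Function.update_apply] at hy
          split_ifs at hy with h
          · exact Or.inr ⟨h, ((Option.some.injEq _ _).mp hy).symm⟩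
          · exact Or.inl hy
        have hnew : (e (t + 1)).val ((e t).op p) = some x := by
          rw [h1.eq]; simp [Sys.exec]
        obtain ⟨s, hW, hn⟩ := ih.of_write he hf h1
        refine ⟨fun i y hy => ?_, fun q y hy => ?_, fun i i' y hy hy' => ?_⟩
        · rcases hval i y hy with h3 | ⟨rfl, rfl⟩
          · obtain ⟨s, w, h4, h5⟩ := ih.written i y h3
            exact ⟨s, w, by omega, h5⟩
          · exact ⟨s, t, t.lt_succ_self, hW⟩
        · rcases hlog q y hy with h3 | rfl
          · obtain ⟨i, h4⟩ := ih.exists_val q y h3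
            exact ⟨i, he.val_mono hf t.le_succ h4⟩
          · exact ⟨_, hnew⟩
        · rcases hval i y hy with h3 | ⟨rfl, rfl⟩ <;> rcases hval i' y hy' with h4 | ⟨rfl, h4⟩
          · exact ih.injective i i' y h3 h4
          · exact absurd (h4 ▸ h3) (hn i)
          · exact absurd h4 (hn i')
          · rfl
      · push Not at h2
        refine old (funext fun i => h1.val_eq i fun _ => h2) fun q x hx => ?_
        by_cases hq : q = p
        · subst hq
          rw [h1.log_self, List.mem_append, h1.micro.value_mem] at hx
          rcases hx with hx | ⟨-, hx | ⟨j, rfl, -⟩⟩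
          · exact ⟨q, hx⟩
          · exact absurd hx (h2 x)
          · obtain ⟨σ, h3⟩ := h1.mem_chan_of_receive
            obtain ⟨d, h4, -⟩ := he.exists_log_of_chan h3
            obtain rfl := he.value_univ t j d x h4
            exact ⟨j, h4⟩
        · rw [h1.log_ne hq] at hx
          exact ⟨q, hx⟩

end Records


/-! ### The linearization -/

section Linearization

variable {n : ℕ} {S U Q R : Type*}

/-- The update that a command performs. -/
def updateOf : Command U Q → Option U
  | .update u => some u
  | .query _ => none

/-- Since updates commute, the state depends only on the multiset of updates performed. This is what
allows a query to be answered from an unordered view. -/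
lemma run_eq_applyAll (M : UQMachine S U Q R) (l : List (Command U Q)) :
    M.object.run l = M.applyAll ↑(l.filterMap updateOf) := by
  induction l using List.reverseRecOn with
  | nil => rfl
  | append_singleton l a ih =>
    have h : M.object.run (l ++ [a]) = (M.object.step a (M.object.run l)).1 := by
      simp [SeqObject.run]
    have : LeftCommutative M.apply := ⟨M.comm⟩
    rw [h, ih, List.filterMap_append]
    cases a with
    | update u =>
      have h1 : ((l.filterMap updateOf ++ [Command.update (Q := Q) u].filterMap updateOf : List U) :
          Multiset U) = u ::ₘ ↑(l.filterMap updateOf) := by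
        rw [← Multiset.coe_add, add_comm]
        rfl
      rw [h1]
      simp [UQMachine.applyAll, UQMachine.object]
    | query q =>
      have h1 : [Command.query (U := U) q].filterMap updateOf = [] := rfl
      rw [h1, List.append_nil]
      rfl

/-- The positions in a set, ordered by a key and, for equal keys, by their size. -/
lemma exists_ordered {κ : Type*} [LinearOrder κ] (I : Finset ℕ)
    (key : ℕ → κ) : ∃ σ : List ℕ, σ.Nodup ∧ (∀ i, i ∈ σ ↔ i ∈ I) ∧
    (∀ i ∈ I, ∀ i' ∈ I, toLex (key i, i) < toLex (key i', i') → [i, i'].Sublist σ) ∧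
    ∀ pre i post, σ = pre ++ i :: post → ∀ k, k ∈ pre ↔
      k ∈ I ∧ toLex (key k, k) < toLex (key i, i) := by
  let g : ℕ → κ ×ₗ ℕ := fun i => toLex (key i, i)
  have hg : Function.Injective g := fun i j h => (Prod.ext_iff.mp (toLex.injective h)).2
  have hp : (((I.image g).sort (· ≤ ·)).map fun x => (ofLex x).2).Pairwise
      fun i j => g i < g j := by
    rw [List.pairwise_map]
    refine (I.image g).sortedLT_sort.pairwise.imp_of_mem fun {x y} hx hy h => ?_
    rw [Finset.mem_sort, Finset.mem_image] at hx hy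
    obtain ⟨i, -, rfl⟩ := hx
    obtain ⟨j, -, rfl⟩ := hy
    exact h
  have hm : ∀ i, i ∈ ((I.image g).sort (· ≤ ·)).map (fun x => (ofLex x).2) ↔ i ∈ I := by
    intro i
    simp [g]
  generalize ((I.image g).sort (· ≤ ·)).map (fun x => (ofLex x).2) = σ at hp hm
  refine ⟨σ, hp.imp fun h => by rintro rfl; exact lt_irrefl _ h, hm, ?_, ?_⟩
  · intro i hi i' hi' h
    obtain ⟨pre, post, rfl⟩ := List.append_of_mem ((hm i).mpr hi)
    rw [List.pairwise_append, List.pairwise_cons] at hp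
    have h1 := (hm i').mpr hi'
    rw [List.mem_append, List.mem_cons] at h1
    rcases h1 with h1 | rfl | h1
    · exact absurd (hp.2.2 i' h1 i (by simp)) (lt_asymm h)
    · exact absurd h (lt_irrefl _)
    · exact ((List.singleton_sublist.mpr h1).cons_cons i).trans (List.sublist_append_right _ _)
  · rintro pre i post rfl k
    rw [List.pairwise_append, List.pairwise_cons] at hp
    rw [← hm k, List.mem_append, List.mem_cons]
    constructor
    · exact fun h => ⟨Or.inl h, hp.2.2 k h i (by simp)⟩
    · rintro ⟨h | rfl | h, h1⟩
      · exact h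
      · exact absurd h1 (lt_irrefl _)
      · exact absurd (hp.2.1.1 k h) (lt_asymm h1)

/-- The updates at certain positions of a history. -/
lemma filterMap_eq_map {ι : Type*} (A : Finset ι) (pos : ι → ℕ) (v : ι → U) (g : ℕ → Option U)
    (hinj : Set.InjOn pos A) (hg : ∀ x ∈ A, g (pos x) = some (v x)) (pre : List ℕ)
    (hpre : pre.Nodup) (h : ∀ k u, g k = some u → (k ∈ pre ↔ ∃ x ∈ A, pos x = k)) :
    (↑(pre.filterMap g) : Multiset U) = A.val.map v := by
  classical
  have h1 : ((pre.filter fun k => (g k).isSome : List ℕ) : Multiset ℕ) = (A.image pos).val := by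
    have : pre.toFinset.filter (fun k => (g k).isSome) = A.image pos := by
      ext k
      simp only [Finset.mem_filter, List.mem_toFinset, Finset.mem_image, Option.isSome_iff_exists]
      constructor
      · rintro ⟨h2, u, h3⟩
        exact (h k u h3).mp h2
      · rintro ⟨x, h2, rfl⟩
        exact ⟨(h _ _ (hg x h2)).mpr ⟨x, h2, rfl⟩, _, hg x h2⟩
    rw [← this, Finset.filter_val, List.toFinset_val, hpre.dedup, Multiset.filter_coe]
    simp
  have h2 : pre.filterMap g = (pre.filter fun k => (g k).isSome).filterMap g := by
    rw [List.filterMap_filter]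
    congr 1
    funext k
    cases g k <;> simp
  rw [h2, ← Multiset.filterMap_coe, h1, Finset.image_val_of_injOn hinj, Multiset.filterMap_map]
  have h3 : ∀ s : Multiset ι, (∀ x ∈ s, g (pos x) = some (v x)) →
      s.filterMap (g ∘ pos) = s.map v := by
    intro s
    induction s using Multiset.induction with
    | empty => simp
    | cons x s ih =>
      intro h
      rw [Multiset.filterMap_cons_some (g ∘ pos) x s (h x (by simp)), Multiset.map_cons,
        ih fun y hy => h y (by simp [hy])]
  exact h3 _ hg

/-- A history of an update-query state machine is linearizable if its operations have keys that
respect the real-time order, and the answers are those in the order of the keys. -/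
theorem linearizable_of_key (M : UQMachine S U Q R) (H : List (Event n (Command U Q) (Reply R)))
    {κ : Type*} [LinearOrder κ] (key : ℕ → κ)
    (hres : ∀ j p b, H[j]? = some (.res p b) → ∃ i, CompletesAt H i j b)
    (hkey : ∀ i j b i', CompletesAt H i j b → j < i' → IsInvocation H i' → key i ≤ key i')
    (hupdate : ∀ i j b p u, CompletesAt H i j b → H[i]? = some (.inv p (.update u)) → b = .ok)
    (hquery : ∀ i j b p q, CompletesAt H i j b → H[i]? = some (.inv p (.query q)) →
      ∃ (A : Finset (Stamped n U)) (pos : Stamped n U → ℕ), Set.InjOn pos A ∧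
        (∀ x ∈ A, ∃ p, H[pos x]? = some (.inv p (.update x.val))) ∧
        (∀ k p u, H[k]? = some (.inv p (.update u)) →
          ((∃ x ∈ A, pos x = k) ↔ toLex (key k, k) < toLex (key i, i))) ∧
        b = .answer (M.ask q (M.applyAll (A.val.map Stamped.val)))) :
    Linearizable M.object H := by
  classical
  obtain ⟨σ, h1, h2, h3, h4⟩ :=
    exists_ordered ((Finset.range H.length).filter (IsInvocation H)) key
  have hI : ∀ i, i ∈ (Finset.range H.length).filter (IsInvocation H) ↔ IsInvocation H i := by
    intro i
    rw [Finset.mem_filter, Finset.mem_range, and_iff_right_iff_imp]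
    rintro ⟨p, a, h⟩
    exact (List.getElem?_eq_some_iff.mp h).1
  refine ⟨hres, σ, h1, fun i => (h2 i).trans (hI i), fun i j b i' hc hj hi' => ?_,
    fun pre i post hσ p a j b hi hc => ?_⟩
  · obtain ⟨h5, p, a, h6, -⟩ := id hc
    refine h3 i ((hI i).mpr ⟨p, a, h6⟩) i' ((hI i').mpr hi') ?_
    rw [Prod.Lex.toLex_lt_toLex]
    -- Equal keys are ordered by the positions of the invocations, and an operation that ends
    -- earlier was also invoked earlier.
    rcases (hkey i j b i' hc hj hi').lt_or_eq with h7 | h7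
    · exact Or.inl h7
    · exact Or.inr ⟨h7, h5.trans hj⟩
  · rw [run_eq_applyAll]
    cases a with
    | update u => exact hupdate i j b p u hc hi
    | query q =>
      obtain ⟨A, pos, h5, h6, h7, rfl⟩ := hquery i j b p q hc hi
      have hpre : pre.Nodup := by
        rw [hσ] at h1
        exact h1.of_append_left
      have h8 := filterMap_eq_map A pos Stamped.val
        (fun m => (H[m]?.bind Event.input).bind updateOf) h5 (fun x hx => ?_) pre hpre ?_
      · rw [List.filterMap_filterMap, h8]
        rfl
      · obtain ⟨p, h9⟩ := h6 x hx
        simp [h9, Event.input, updateOf]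
      · intro k u hk
        have h9 : ∃ p, H[k]? = some (.inv p (.update u)) := by
          rcases hk1 : H[k]? with _ | (⟨p, a⟩ | ⟨p, b⟩)
          · simp [hk1] at hk
          · cases a with
            | update u' =>
              simp only [hk1, Option.bind_some, Event.input, updateOf, Option.some.injEq] at hk
              exact ⟨p, by rw [hk]⟩
            | query => simp [hk1, Event.input, updateOf] at hk
          · simp [hk1, Event.input] at hk
        obtain ⟨p', h9⟩ := h9
        rw [h7 k p' u h9, h4 pre i post hσ k, hI]
        exact and_iff_right ⟨p', _, h9⟩

variable {f : ℕ} {M : UQMachine S U Q R} {D : ℝ} {e : ℕ → Sys n U Q (Reply R)}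

/-- The view of a completed query. -/
structure QueryView (M : UQMachine S U Q R) (f : ℕ) (e : ℕ → Sys n U Q (Reply R)) (i j : ℕ)
    (b : Reply R) (q : Q) (A : Finset (Stamped n U)) (r w s t t' : ℕ) : Prop where
  answer : b = .answer (M.ask q (M.applyAll (A.val.map Stamped.val)))
  lat : GoodLat f e r A w t'
  start : (e s).history.length = i
  finish : (e t).history.length = j
  le_start : s ≤ w
  le_finish : t' ≤ t
  read : ReadAt f e r s

/-- The history of an execution is linearizable. -/
theorem Execution.linearizable (hf : 2 * f < n)
    (he : Execution f (fun q H => .answer (M.ask q (M.applyAll (H.val.map Stamped.val)))) .ok D e)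
    (T : ℕ) : Linearizable M.object (e T).history := by
  classical
  have hV := he.valInv hf T
  -- The position of an invocation determines its completion and reply, so the view can be chosen as
  -- a function of the position alone.
  have hview : ∀ i, ∃ A : Finset (Stamped n U), ∀ j b p q, CompletesAt (e T).history i j b →
      (e T).history[i]? = some (.inv p (.query q)) →
      ∃ r w s t t', t < T ∧ QueryView M f e i j b q A r w s t t' := by
    intro i
    by_cases h : ∃ j b p q, CompletesAt (e T).history i j b ∧
      (e T).history[i]? = some (.inv p (.query q))
    · obtain ⟨j, b, p, q, h1, h2⟩ := h
      obtain ⟨s, t, h3, h4, h5, h6, r, A, w, t', h7, h8, h9, h10, h11⟩ :=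
        he.outcome_of_completesAt hf h1 h2
      refine ⟨A, fun j' b' p' q' h1' h2' => ⟨r, w, s, t, t', h4, ?_⟩⟩
      have h12 := completesAt_node h1 h2
      have h12' := completesAt_node h1' h2'
      rw [h2] at h2'
      simp only [Option.some.injEq, Event.inv.injEq, Command.query.injEq] at h2'
      obtain ⟨rfl, rfl⟩ := h2'
      obtain rfl : j = j' := le_antisymm (completesAt_le h1 h2 h12' rfl h1'.1)
        (completesAt_le h1' h2 h12 rfl h1.1)
      rw [h12] at h12'
      simp only [Option.some.injEq, Event.res.injEq, true_and] at h12'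
      subst h12'
      exact ⟨h7, h8, h5, h6, h9, h10, h11⟩
    · push Not at h
      exact ⟨∅, fun j b p q h1 h2 => absurd h2 (h j b p q h1)⟩
  choose A hA using hview
  let done : ℕ → Prop := fun i => ∃ j b p q, CompletesAt (e T).history i j b ∧
    (e T).history[i]? = some (.inv p (.query q))
  -- Good views form a chain and are thus ordered by size. Even keys put an update at the smallest
  -- good view that contains its value; odd keys put a query right after the updates of its view.
  -- Updates that occur in no good view, and queries without a reply, get `sInf ∅ = ⊤`.
  let sizes : ℕ → Set ℕ∞ := fun i => {κ | ∃ x H r w t', (e T).val i = some x ∧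
    GoodLat f e r H w t' ∧ x ∈ H ∧ κ = ((2 * H.card : ℕ) : ℕ∞)}
  let key : ℕ → ℕ∞ := fun i => if done i then ((2 * (A i).card + 1 : ℕ) : ℕ∞) else sInf (sizes i)
  have hdone : ∀ {i}, done i → key i = ((2 * (A i).card + 1 : ℕ) : ℕ∞) := fun h => if_pos h
  have hnot : ∀ {i p u}, (e T).history[i]? = some (.inv p (.update u)) → key i = sInf (sizes i) :=
    fun {i p u} h => if_neg fun ⟨_, _, _, _, _, h'⟩ => by rw [h] at h'; simp at h'
  have hlog : ∀ {r H w t x}, Lat f e r H w t → x ∈ H → ∃ k, (Finset.univ, .value x) ∈ (e t).log k :=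
    fun {r H w t x} h hx => by
      obtain ⟨k, ⟨L, h1, h2⟩, -⟩ := h.agreed.exists_and hf h.agreed
      exact ⟨k, h1.subset ((h2 x).mp hx).1⟩
  have hwritten : ∀ {i x}, (e T).val i = some x →
      (e T).history[i]? = some (.inv x.owner (.update x.val)) := fun {i x} hx => by
    obtain ⟨s, w, h1, h2⟩ := hV.written i x hx
    obtain ⟨l, h3⟩ := he.history_mono h1.le
    have h4 := h2.begun.inv
    rw [h2.index] at h4
    rw [← h3, List.getElem?_append_left (List.getElem?_eq_some_iff.mp h4).1, h4]
  refine linearizable_of_key M _ key (fun j p b hj => ?_) (fun i j b i' hc hj hi' => ?_)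
    (fun i j b p u hc hi => ?_) (fun i j b p q hc hi => ?_)
  · obtain ⟨s, t, a, -, -, -, -, -, h, -⟩ := he.outcome_of_res hf T j p b hj
    exact ⟨_, h⟩
  · obtain ⟨-, p, a, hi, -⟩ := id hc
    by_cases hd : done i'
    · rw [hdone hd]
      obtain ⟨j', b', p', q', h1, h2⟩ := hd
      obtain ⟨r', w', s', t₁, t₁', -, h3⟩ := hA i' j' b' p' q' h1 h2
      cases a with
      | update u =>
        rw [hnot hi]
        obtain ⟨s, t, -, -, -, h4, -, x, r, H, w, t', h5, h6, h7, h8⟩ :=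
          he.outcome_of_completesAt hf hc hi
        have h9 : t < s' := he.lt_of_length_lt (by rw [h4, h3.start]; exact hj)
        have h10 := h3.read.le hf (he.seen_mono (he.seen_of_lat h6) (by omega))
        have h11 := h3.le_start
        refine le_trans (b := ((2 * (A i').card : ℕ) : ℕ∞))
          (sInf_le ⟨x, A i', r', w', t₁', h5, h3.lat, ?_, rfl⟩) (by exact_mod_cast Nat.le_succ _)
        -- The query's good lattice operation started after the update had ended, and its tag is at
        -- least the one the update left with a quorum. So the view of the query contains the value.
        exact he.lat_mem hf h6 h3.lat.toLat (by omega) h7 ((h6.tag_le hf h7).trans h10)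
      | query q =>
        rw [hdone ⟨j, b, p, q, hc, hi⟩]
        obtain ⟨r, w, s, t, t', -, h4⟩ := hA i j b p q hc hi
        have h9 : t < s' := he.lt_of_length_lt (by rw [h4.finish, h3.start]; exact hj)
        have h11 := h3.le_start
        have h12 := h4.le_finish
        have h10 := h3.read.le hf (he.seen_mono (he.seen_of_lat h4.lat.toLat) (by omega))
        have h13 : A i ⊆ A i' := fun x hx => he.lat_mem hf h4.lat.toLat h3.lat.toLat (by omega) hx
          ((h4.lat.toLat.tag_le hf hx).trans h10)
        have := Finset.card_le_card h13
        exact_mod_cast (by omega : 2 * (A i).card + 1 ≤ 2 * (A i').card + 1)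
    · have h1 : key i' = sInf (sizes i') := if_neg hd
      rw [h1]
      refine le_sInf ?_
      -- Every good view that contains the value of the later operation has to be large enough.
      -- Nobody knew that value when the earlier operation ended.
      rintro _ ⟨x', H', r', w', t₁', h2, h3, h4, rfl⟩
      obtain ⟨s', v, h5, h6⟩ := hV.written i' x' h2
      obtain ⟨ρ, h7, h8⟩ := h6.read
      have hfresh : ∀ t, t ≤ s' → ∀ k, (Finset.univ, .value x') ∉ (e t).log k :=
        fun t ht k hk => h6.fresh k ((he.log_mono (ht.trans h6.begun.lt.le) k).subset hk)
      have h9 := h3.toLat.tag_le hf h4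
      cases a with
      | update u =>
        rw [hnot hi]
        obtain ⟨s, t, -, -, -, h10, -, x, r, H, w, t', h11, h12, h13, h14⟩ :=
          he.outcome_of_completesAt hf hc hi
        have h15 : t < s' := he.lt_of_length_lt (by rw [h10, h6.index]; exact hj)
        have h16 := h7.le hf (he.seen_mono (he.seen_of_lat h12) (by omega))
        have h17 := h12.tag_le hf h13
        -- A good view with the later value contains the earlier one too, so the smallest good view
        -- for the earlier value is no larger.
        exact sInf_le ⟨x, H', r', w', t₁', h11, h3, he.lat_mem_of_later hf h12 h3.toLat h13
          (by omega) h4 (hfresh _ (by omega)), rfl⟩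
      | query q =>
        rw [hdone ⟨j, b, p, q, hc, hi⟩]
        obtain ⟨r, w, s, t, t', -, h10⟩ := hA i j b p q hc hi
        have h15 : t < s' := he.lt_of_length_lt (by rw [h10.finish, h6.index]; exact hj)
        have h12 := h10.le_finish
        have h16 : x' ∉ A i := fun h => by
          obtain ⟨k, hk⟩ := hlog h10.lat.toLat h
          exact hfresh _ (by omega) k hk
        -- The view of the query lacks the later value, so in the chain of good views it lies
        -- strictly below `H'`; this makes up for the odd key.
        have h17 : A i ⊂ H' := by
          rcases he.goodLat_comparable hf h10.lat h3 with h | h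
          · exact (Finset.ssubset_iff_of_subset h).mpr ⟨x', h4, h16⟩
          · exact absurd (h h4) h16
        have := Finset.card_lt_card h17
        exact_mod_cast (by omega : 2 * (A i).card + 1 ≤ 2 * H'.card)
  · obtain ⟨s, t, -, -, -, -, h, -⟩ := he.outcome_of_completesAt hf hc hi
    exact h
  · obtain ⟨r, w, s, t, t', hT, h1⟩ := hA i j b p q hc hi
    have h2 : ∀ x ∈ A i, ∃ k, (e T).val k = some x := fun x hx => by
      obtain ⟨k, hk⟩ := hlog h1.lat.toLat hx
      have h3 := h1.le_finish
      exact hV.exists_val k x ((he.log_mono (by omega) k).subset hk)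
    have h3 : ∀ x, ∃ k, x ∈ A i → (e T).val k = some x := fun x => by
      by_cases hx : x ∈ A i
      · obtain ⟨k, hk⟩ := h2 x hx
        exact ⟨k, fun _ => hk⟩
      · exact ⟨0, fun h => absurd h hx⟩
    choose pos hpos using h3
    refine ⟨A i, pos, fun x hx y hy hxy => ?_, fun x hx => ⟨_, hwritten (hpos x hx)⟩,
      fun k p' u hk => ?_, h1.answer⟩
    · have h4 := hpos x hx
      rw [hxy, hpos y hy] at h4
      exact ((Option.some.injEq _ _).mp h4).symm
    · rw [Prod.Lex.toLex_lt_toLex, hdone ⟨j, b, p, q, hc, hi⟩, hnot hk]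
      constructor
      · rintro ⟨x, hx, rfl⟩
        refine Or.inl (lt_of_le_of_lt (b := ((2 * (A i).card : ℕ) : ℕ∞))
          (sInf_le ⟨x, A i, r, w, t', hpos x hx, h1.lat, hx, rfl⟩) ?_)
        exact Nat.cast_lt.mpr (Nat.lt_succ_self (2 * (A i).card))
      · intro h4
        have h5 : sInf (sizes k) ≤ ((2 * (A i).card + 1 : ℕ) : ℕ∞) :=
          h4.elim le_of_lt fun h => h.1.le
        rcases (sizes k).eq_empty_or_nonempty with h6 | h6
        · rw [h6, sInf_empty] at h5
          exact absurd (top_le_iff.mp h5) (ENat.natCast_ne_top _)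
        -- The infimum is attained, so the key belongs to an actual good view `H`.
        · obtain ⟨x, H, r', w', t'', h7, h8, h9, h10⟩ := csInf_mem h6
          rw [h10] at h5
          have h11 : 2 * H.card ≤ 2 * (A i).card + 1 := by exact_mod_cast h5
          -- By parity `H` is no larger than the view of the query, and the two are comparable.
          have h12 : H ⊆ A i := by
            rcases he.goodLat_comparable hf h8 h1.lat with h | h
            · exact h
            · exact (Finset.eq_of_subset_of_card_le h (by omega)).ge
          exact ⟨x, h12 h9, hV.injective _ _ x (hpos x (h12 h9)) h7⟩

end Linearization


/-! ### Timely delivery and answered requests -/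

section Liveness

variable {n : ℕ} {U Q B : Type*} {f : ℕ} {out : Q → Finset (Stamped n U) → B} {ack : B}
  {D : ℝ} {e : ℕ → Sys n U Q B}

lemma Execution.chan_le_now (he : Execution f out ack D e) (t : ℕ) (q p : Fin n)
    (x : ℝ × Msg n U) (hx : x ∈ (e t).chan q p) : x.1 ≤ (e t).now := by
  induction t with
  | zero => rw [he.zero] at hx; simp [Sys.initial, Config.initial] at hx
  | succ t ih =>
    rcases he.cases t with h | h | ⟨k, inp, l, l', dead, s', h⟩
    · rw [h] at hx ⊢; exact ih hx
    · rw [h.eq] at hx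
      exact (ih hx).trans h.le
    · rw [h.now]
      rcases h.mem_chan hx with h1 | ⟨-, h1, -⟩
      · exact ih h1
      · exact h1.le

/-- Messages are delivered in time. -/
lemma Execution.now_le_chan (he : Execution f out ack D e) (hD : 0 < D) (t : ℕ) (q p : Fin n)
    (hp : p ∉ (e t).crashed) (x : ℝ × Msg n U) (hx : x ∈ (e t).chan q p) :
    (e t).now ≤ x.1 + D := by
  induction t with
  | zero => rw [he.zero] at hx; simp [Sys.initial, Config.initial] at hx
  | succ t ih =>
    have hp' : p ∉ (e t).crashed := fun h => hp (he.crashed_mono t.le_succ h)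
    rcases he.cases t with h | h | ⟨k, inp, l, l', dead, s', h⟩
    · rw [h] at hx ⊢; exact ih hp' hx
    · refine h.chan q p hp' x ?_
      rwa [h.eq] at hx
    · rw [h.now]
      rcases h.mem_chan hx with h1 | ⟨-, h1, -⟩
      · exact ih hp' h1
      · rw [h1]; linarith

/-- A message in transit was sent in some step. -/
lemma Execution.exists_send (he : Execution f out ack D e) (t : ℕ) (q p : Fin n)
    (x : ℝ × Msg n U) (hx : x ∈ (e t).chan q p) : ∃ c < t, (e c).now = x.1 ∧
      ∃ inp l l' dead s', Acts f out ack (e c) (e (c + 1)) q inp l l' dead s' ∧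
        ∃ d, (d, x.2) ∈ l := by
  induction t with
  | zero => rw [he.zero] at hx; simp [Sys.initial, Config.initial] at hx
  | succ t ih =>
    have old : x ∈ (e t).chan q p → ∃ c < t + 1, (e c).now = x.1 ∧
        ∃ inp l l' dead s', Acts f out ack (e c) (e (c + 1)) q inp l l' dead s' ∧
          ∃ d, (d, x.2) ∈ l := fun h => by
      obtain ⟨c, h1, h2⟩ := ih h
      exact ⟨c, h1.trans t.lt_succ_self, h2⟩
    rcases he.cases t with h | h | ⟨k, inp, l, l', dead, s', h⟩
    · exact old (by rwa [h] at hx)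
    · exact old (by rwa [h.eq] at hx)
    · rcases h.mem_chan hx with h1 | ⟨rfl, h1, d, h2, -⟩
      · exact old h1
      · obtain ⟨⟨d', m⟩, h3, h4, -⟩ := h.snd_mem h2
        exact ⟨t, t.lt_succ_self, h1.symm, inp, l, l', dead, s', h, d', h4 ▸ h3⟩

/-- What was sent by time `s` has been received by time `t`, or some of it is still in transit. -/
lemma Execution.received_or (he : Execution f out ack D e) {s t : ℕ} (hst : s ≤ t) (q p : Fin n) :
    (e s).sent q p <+: (e t).got p q ∨ ∃ L₁ L₂, (e t).chan q p = L₁ ++ L₂ ∧ L₁ ≠ [] ∧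
      (e t).got p q ++ L₁.map Prod.snd = (e s).sent q p ∧ ∀ x ∈ L₁, x.1 ≤ (e s).now := by
  induction t, hst using Nat.le_induction with
  | base =>
    rcases h : (e s).chan q p with _ | ⟨x, L⟩
    · left
      simp [Sys.sent, h]
    · right
      refine ⟨x :: L, [], by simp, by simp, by simp [Sys.sent, h], fun y hy => ?_⟩
      exact he.chan_le_now s q p y (h ▸ hy)
  | succ t hst ih =>
    rcases he.cases t with h | h | ⟨k, inp, l, l', dead, s', h⟩
    · rwa [h]
    · rw [h.eq]; exact ih
    · rcases ih with ih | ⟨L₁, L₂, h1, h2, h3, h4⟩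
      · refine Or.inl (ih.trans ?_)
        by_cases hk : p = k
        · subst hk
          rw [h.got_self]
          cases inp with
          | receive q' m =>
            simp only [Input.gets, Function.update_apply]
            split_ifs with hq
            · subst hq; exact List.prefix_append _ _
            · exact List.prefix_rfl
          | _ => exact List.prefix_rfl
        · rw [h.got_ne hk]
      · have h5 := h.chan q p
        rw [h1] at h5
        by_cases hr : ∃ m, inp = .receive q m ∧ p = k
        · obtain ⟨m, rfl, rfl⟩ := hr
          obtain ⟨σ, h6⟩ := h.offers
          rcases L₁ with _ | ⟨x, L₁⟩
          · exact absurd rfl h2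
          · rw [h1] at h6
            simp only [List.cons_append, List.head?_cons, Option.some.injEq] at h6
            subst h6
            have h7 : (e (t + 1)).got p q = (e t).got p q ++ [m] := by
              rw [h.got_self]; simp [Input.gets]
            simp only [Input.rest, and_self, if_true, List.cons_append, List.tail_cons] at h5
            rw [h7, ← h3]
            rcases L₁ with _ | ⟨y, L₁⟩
            · left; simp
            · right
              refine ⟨y :: L₁, _, by rw [h5, List.append_assoc], by simp, by simp,
                fun z hz => h4 z (by simp_all)⟩
        · right
          have h6 : inp.rest k q p (L₁ ++ L₂) = L₁ ++ L₂ := by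
            cases inp with
            | receive q' m =>
              simp only [Input.rest]
              rw [if_neg]
              rintro ⟨rfl, rfl⟩
              exact hr ⟨m, rfl, rfl⟩
            | _ => rfl
          refine ⟨L₁, _, by rw [h5, h6, List.append_assoc], h2, ?_, h4⟩
          rw [← h3]
          congr 1
          by_cases hk : p = k
          · subst hk
            rw [h.got_self]
            cases inp with
            | receive q' m =>
              simp only [Input.gets, Function.update_apply]
              rw [if_neg]
              rintro rfl
              exact hr ⟨m, rfl, rfl⟩
            | _ => rfl
          · rw [h.got_ne hk]

/-- Messages are received within time `D`. -/
lemma Execution.mem_got (he : Execution f out ack D e) (hD : 0 < D) {s t : ℕ} (hst : s ≤ t)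
    {q p : Fin n} {m : Msg n U} (hm : m ∈ (e s).sent q p) (hp : p ∉ (e t).crashed)
    (h : (e s).now + D < (e t).now) : m ∈ (e t).got p q := by
  rcases he.received_or hst q p with h1 | ⟨L₁, L₂, h1, h2, -, h3⟩
  · exact h1.subset hm
  · obtain ⟨x, L, rfl⟩ := List.exists_cons_of_ne_nil h2
    have h4 := he.now_le_chan hD t q p hp x (by simp [h1])
    have h5 := h3 x (by simp)
    linarith

/-- Time passes a given value in some step. -/
lemma Execution.exists_tick (he : Execution f out ack D e) {s t : ℕ} (hst : s ≤ t) {θ : ℝ}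
    (hs : (e s).now ≤ θ) (ht : θ < (e t).now) :
    ∃ b, s ≤ b ∧ b < t ∧ (e b).now ≤ θ ∧ θ < (e (b + 1)).now ∧ Ticks f D (e b) (e (b + 1)) := by
  induction t, hst using Nat.le_induction with
  | base => exact absurd hs (not_le.mpr ht)
  | succ t hst ih =>
    by_cases h : θ < (e t).now
    · obtain ⟨b, h1, h2, h3⟩ := ih h
      exact ⟨b, h1, by omega, h3⟩
    · rcases he.cases t with h1 | h1 | ⟨k, inp, l, l', dead, s', h1⟩
      · exact absurd (h1 ▸ ht) h
      · exact ⟨t, hst, t.lt_succ_self, not_lt.mp h, ht, h1⟩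
      · exact absurd (h1.now ▸ ht) h

/-- `mem_got` needs a time strictly after the deadline, which is available right after the tick that
passes `θ`. The tick itself delivers nothing, so the message had arrived right before it, at a time
not beyond `θ`. This makes consecutive delays add up without slack. -/
lemma Execution.exists_got (he : Execution f out ack D e) (hD : 0 < D) {s t : ℕ} (hst : s ≤ t)
    {q p : Fin n} {m : Msg n U} (hm : m ∈ (e s).sent q p) (hp : p ∉ (e t).crashed) {θ : ℝ}
    (hθ : (e s).now + D ≤ θ) (h : θ < (e t).now) :
    ∃ b, s ≤ b ∧ b < t ∧ (e b).now ≤ θ ∧ m ∈ (e b).got p q := by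
  obtain ⟨b, h1, h2, h3, h4, h5⟩ := he.exists_tick hst (by linarith) h
  refine ⟨b, h1, h2, h3, ?_⟩
  have h6 := he.mem_got hD (h1.trans b.le_succ) hm
    (fun h => hp (he.crashed_mono h2 h)) (by linarith)
  rwa [h5.eq] at h6

lemma Execution.mem_sent (he : Execution f out ack D e) {t : ℕ} {q p : Fin n} {m : Msg n U}
    {d : Finset (Fin n)} (hq : q ∉ (e t).crashed) (hm : (d, m) ∈ (e t).log q) (hp : p ∈ d) :
    m ∈ (e t).sent q p := by
  rw [(he.sent_log t q p).2 hq, mem_msgsTo]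
  exact ⟨d, hm, hp⟩

/-- The reply to a message is received within time `2D`. -/
lemma Execution.mem_got_reply (he : Execution f out ack D e) (hD : 0 < D) {s t : ℕ} (hst : s ≤ t)
    {p k : Fin n} {m : Msg n U} (hm : (Finset.univ, m) ∈ (e s).log p) (hp : p ∉ (e t).crashed)
    (hk : k ∉ (e t).crashed) (h : (e s).now + 2 * D < (e t).now) {P : Msg n U → Prop}
    (hP : ∀ b, m ∈ (e b).got k p → ∃ d m', P m' ∧ (d, m') ∈ (e b).log k ∧ p ∈ d) :
    ∃ m', P m' ∧ m' ∈ (e t).got p k := by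
  obtain ⟨b, h1, h2, h3, h4⟩ := he.exists_got hD hst
    (he.mem_sent (fun h => hp (he.crashed_mono hst h)) hm (Finset.mem_univ k)) hk le_rfl
    (by linarith)
  obtain ⟨d, m', h5, h6, h7⟩ := hP b h4
  exact ⟨m', h5, he.mem_got hD h2.le (he.mem_sent (fun h => hk (he.crashed_mono h2.le h)) h6 h7) hp
    (by linarith)⟩

/-- The nodes that have not crashed are a quorum. -/
lemma Execution.quorum_of_alive (he : Execution f out ack D e) (t : ℕ) (A : Finset (Fin n))
    (h : ∀ k, k ∉ (e t).crashed → k ∈ A) : n - f ≤ A.card := by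
  have h1 : ((e t).crashed)ᶜ ⊆ A := fun k hk => h k (Finset.mem_compl.mp hk)
  have h2 := Finset.card_le_card h1
  rw [Finset.card_compl, Fintype.card_fin] at h2
  have := he.crashed_card t
  omega

lemma Ticks.loc {g g' : Sys n U Q B} (h : Ticks f D g g') : g'.loc = g.loc := by rw [h.eq]

lemma Ticks.crashed {g g' : Sys n U Q B} (h : Ticks f D g g') : g'.crashed = g.crashed := by
  rw [h.eq]

lemma Ticks.got {g g' : Sys n U Q B} (h : Ticks f D g g') : g'.got = g.got := by rw [h.eq]

/-- A request is answered within time `2D`. -/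
lemma Execution.not_ticks_of_request (he : Execution f out ack D e) (hD : 0 < D) {w t : ℕ}
    (hw : w < t) {p : Fin n} (hp : p ∉ (e t).crashed) (h : Ticks f D (e t) (e (t + 1)))
    (hr : (Finset.univ, .readTag ((e t).loc p).req) ∈ (e (w + 1)).log p ∨
      ∃ τ, (Finset.univ, .writeTag ((e t).loc p).req τ) ∈ (e (w + 1)).log p)
    (hnow : (e (w + 1)).now + 2 * D < (e (t + 1)).now) : n - f ≤ ((e t).loc p).acks.card := by
  refine he.quorum_of_alive t _ fun k hk => ?_
  rw [← h.crashed] at hp hk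
  have h1 : w + 1 ≤ t + 1 := by omega
  rw [(he.mem_acks t p k).1, ← h.got]
  rcases hr with hr | ⟨τ, hr⟩
  · obtain ⟨m', ⟨τ, rfl⟩, h3⟩ := he.mem_got_reply hD h1 hr hp hk hnow
      (P := fun m => ∃ τ, m = .readAck ((e t).loc p).req τ) fun b hb => by
        obtain ⟨τ, h2⟩ := he.exists_readAck b k p _ hb
        exact ⟨_, _, ⟨τ, rfl⟩, h2, by simp⟩
    exact ⟨τ, Or.inl h3⟩
  · obtain ⟨m', rfl, h3⟩ := he.mem_got_reply hD h1 hr hp hk hnow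
      (P := fun m => m = .writeAck ((e t).loc p).req τ) fun b hb =>
        ⟨_, _, rfl, he.exists_writeAck b k p _ _ hb, by simp⟩
    exact ⟨τ, Or.inr h3⟩

end Liveness


/-! ### How long a node waits for an equivalence quorum -/

section Waiting

variable {n : ℕ} {U Q B : Type*} {f : ℕ} {out : Q → Finset (Stamped n U) → B} {ack : B}
  {D : ℝ} {e : ℕ → Sys n U Q B}

/-- Time does not pass beyond `t₀ + 2 * D` while an operation invoked at time `t₀` reads a tag. -/
lemma Ticks.now_le_of_reading (he : Execution f out ack D e) (hf : 2 * f < n) (hD : 0 < D) {t : ℕ}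
    {p : Fin n} (hp : p ∉ (e t).crashed) (h : Ticks f D (e t) (e (t + 1))) {a : Command U Q}
    (ha : ((e t).loc p).phase = .reading a) {t₀ : ℝ} (ht : (e t).pending p = some t₀) :
    (e (t + 1)).now ≤ t₀ + 2 * D := by
  have h1 := (he.opInv hf t).phase p hp
  rw [ha] at h1
  obtain ⟨s, h2, -, h3, -⟩ := h1
  rw [h2.pending] at ht
  obtain rfl := (Option.some.injEq _ _).mp ht
  by_contra h4
  -- The request enters the log in the step at `s`. A tick leaves the counter unchanged, which would
  -- contradict the number of the request.
  have h5 : (e (s + 1)).now = (e s).now := by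
    rcases he.cases s with h6 | h6 | ⟨k, inp, l, l', dead, s', h6⟩
    · rw [h6]
    · have h7 := h2.req
      have h8 := (he.readTag_log (s + 1) p _ _ h3).2
      rw [h6.loc] at h8
      omega
    · exact h6.now
  have h6 := he.not_ticks_of_request hD h2.lt hp h (Or.inl h3) (by rw [h5]; linarith)
  have h7 := h.quiet p hp
  rw [Quiet, ha] at h7
  exact absurd h6 (not_le.mpr h7)

/-- An operation reads a tag within time `2D`. -/
lemma Execution.now_le_of_reading (he : Execution f out ack D e) (hf : 2 * f < n) (hD : 0 < D)
    (t : ℕ) (p : Fin n) (hp : p ∉ (e t).crashed) {a : Command U Q}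
    (ha : ((e t).loc p).phase = .reading a) {t₀ : ℝ} (ht : (e t).pending p = some t₀) :
    (e t).now ≤ t₀ + 2 * D := by
  induction t with
  | zero => rw [he.loc_zero] at ha; simp [blank] at ha
  | succ t ih =>
    have hp' : p ∉ (e t).crashed := fun h => hp (he.crashed_mono t.le_succ h)
    rcases he.cases t with h | h | ⟨k, inp, l, l', dead, s', h⟩
    · rw [h] at ha ht ⊢; exact ih hp' ha ht
    · rw [h.loc] at ha
      refine h.now_le_of_reading he hf hD hp' ha ?_
      rwa [h.eq] at ht
    · rw [h.now]
      by_cases hk : p = k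
      · subst hk
        rw [h.loc_self] at ha
        have hpend : (∀ a, inp ≠ .invoke a) → (∀ b, inp ≠ .reply b) →
            (e t).pending p = some t₀ := fun h1 h2 => by
          rwa [h.pending_eq p fun _ => ⟨h1, h2⟩] at ht
        have hm := h.micro
        cases hm with
        | start =>
          have h1 : (e (t + 1)).pending p = some (e t).now := by rw [h.eq]; simp [Sys.exec]
          rw [h1] at ht
          obtain rfl := (Option.some.injEq _ _).mp ht
          linarith
        | deliver =>
          rw [handle_phase] at ha
          exact ih hp' ha (hpend (by simp) (by simp))
        | skip => exact ih hp' ha (hpend (by simp) (by simp))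
        | _ => simp [enter] at ha
      · rw [h.loc_ne hk] at ha
        rw [h.pending_eq p fun h => absurd h hk] at ht
        exact ih hp' ha ht

/-- The value `x` reaches node `q` in the step at time `c`. -/
def New (e : ℕ → Sys n U Q B) (q : Fin n) (x : Stamped n U) (c : ℕ) : Prop :=
  (Finset.univ, .value x) ∉ (e c).log q ∧ (Finset.univ, .value x) ∈ (e (c + 1)).log q

lemma Execution.act_of_new (he : Execution f out ack D e) {q : Fin n} {x : Stamped n U} {c : ℕ}
    (h : New e q x c) : ∃ inp l l' dead s', Acts f out ack (e c) (e (c + 1)) q inp l l' dead s' ∧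
      (inp = .write x ∨ ∃ j, inp = .receive j (.value x)) := by
  rcases he.node_cases c q with ⟨-, h1, -⟩ | ⟨inp, l, l', dead, s', h1⟩
  · exact absurd (h1 ▸ h.2) h.1
  · have h2 := h.2
    rw [h1.log_self, List.mem_append] at h2
    have h3 := (h1.micro.value_mem _ x).mp (h2.resolve_left h.1)
    exact ⟨inp, l, l', dead, s', h1, h3.2.imp_right fun ⟨j, hj, _⟩ => ⟨j, hj⟩⟩

/-- A step takes in at most one value. A node that crashes while passing on a value can therefore be
charged to that value only. -/
lemma Execution.new_unique (he : Execution f out ack D e) {q : Fin n} {x x' : Stamped n U}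
    {c : ℕ} (h : New e q x c) (h' : New e q x' c) : x = x' := by
  rcases he.node_cases c q with ⟨-, h1, -⟩ | ⟨inp, l, l', dead, s', h1⟩
  · exact absurd (h1 ▸ h.2) h.1
  · have h2 := h.2
    have h2' := h'.2
    rw [h1.log_self, List.mem_append] at h2 h2'
    have h3 := (h1.micro.value_mem _ x).mp (h2.resolve_left h.1)
    have h3' := (h1.micro.value_mem _ x').mp (h2'.resolve_left h'.1)
    rcases h3.2 with rfl | ⟨j, rfl, -⟩ <;> rcases h3'.2 with h4 | ⟨j', h4, -⟩ <;> simp_all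

/-- A node receives a new value from a node that received it recently. -/
lemma Execution.exists_new_before (he : Execution f out ack D e) (hf : 2 * f < n) (hD : 0 < D)
    {q j : Fin n} {x : Stamped n U} {c : ℕ} {l l' : List (Finset (Fin n) × Msg n U)} {dead : Bool}
    {s' : AsoState n U (Command U Q)}
    (h : Acts f out ack (e c) (e (c + 1)) q (.receive j (.value x)) l l' dead s') :
    ∃ c', c' < c ∧ New e j x c' ∧ (e c).now ≤ (e c').now + D := by
  obtain ⟨σ, h1⟩ := h.mem_chan_of_receive
  have h2 := he.now_le_chan hD c j q h.alive _ h1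
  obtain ⟨c', h3, h4, inp, l₁, l₁', dead', s₁, h5, d, h6⟩ := he.exists_send c j q _ h1
  refine ⟨c', h3, ⟨?_, ?_⟩, h4 ▸ h2⟩
  -- The sender has either just written the value, which was fresh then, or received it for the
  -- first time.
  · obtain ⟨-, h7⟩ := (h5.micro.value_mem d x).mp h6
    rcases h7 with rfl | ⟨k, -, h7⟩
    · obtain ⟨s, h8, -⟩ := (he.valInv hf c').of_write he hf h5
      exact h8.fresh j
    · rwa [← he.mem_V_self]
  · obtain ⟨rfl, -⟩ := (h5.micro.value_mem d x).mp h6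
    rw [h5.log_self]
    exact List.mem_append_right _ h6

/-- A value that travels for a long time is received by some node in each interval of
length `D`. -/
lemma Execution.exists_new_between (he : Execution f out ack D e) (hf : 2 * f < n) (hD : 0 < D)
    {x : Stamped n U} {θ : ℝ} (hx : ∀ i s w, Written f e i x s w → (e w).now ≤ θ) (c : ℕ) :
    ∀ q, New e q x c → θ + D < (e c).now →
      ∃ q' c', c' < c ∧ New e q' x c' ∧ θ < (e c').now ∧ (e c').now ≤ θ + D := by
  induction c using Nat.strong_induction_on with
  | _ c ih =>
    intro q hq hc
    obtain ⟨inp, l, l', dead, s', h1, rfl | ⟨j, rfl⟩⟩ := he.act_of_new hq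
    · obtain ⟨s, h2, -⟩ := (he.valInv hf c).of_write he hf h1
      have := hx _ _ _ h2
      linarith
    -- The value is followed back along its path. Each hop takes at most `D`, so the path cannot
    -- jump over an interval of that length.
    · obtain ⟨c', h2, h3, h4⟩ := he.exists_new_before hf hD h1
      by_cases h5 : (e c').now ≤ θ + D
      · exact ⟨j, c', h2, h3, by linarith, h5⟩
      · obtain ⟨q', c'', h6, h7⟩ := ih c' h2 j h3 (not_le.mp h5)
        exact ⟨q', c'', h6.trans h2, h7⟩

/-- Values with tags that have been seen by a quorum are written soon. -/
lemma Execution.written_le (he : Execution f out ack D e) (hf : 2 * f < n) (hD : 0 < D) {r c : ℕ}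
    (hr : Seen f e r c) {x : Stamped n U} (hx : x.tag ≤ r) {i s w : ℕ}
    (h : Written f e i x s w) : (e w).now ≤ (e c).now + 2 * D := by
  obtain ⟨ρ, h1, h2⟩ := h.read
  -- An operation invoked after a quorum had seen `r` would read a tag of at least `r` and give its
  -- value a larger one.
  have h3 : s ≤ c := by
    by_contra h3
    have := h1.le hf (he.seen_mono hr (not_le.mp h3).le)
    omega
  have h4 := he.now_le_of_reading hf hD w _ h.alive h.phase h.begun.pending
  have h5 := he.now_mono h3
  linarith

lemma Execution.exists_new_step {p : Fin n} {x : Stamped n U} {b b' : ℕ} (hb : b ≤ b')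
    (h : (Finset.univ, .value x) ∉ (e b).log p) (h' : (Finset.univ, .value x) ∈ (e b').log p) :
    ∃ c, b ≤ c ∧ c < b' ∧ New e p x c := by
  induction b', hb using Nat.le_induction with
  | base => exact absurd h' h
  | succ b' hb ih =>
    by_cases h1 : (Finset.univ, .value x) ∈ (e b').log p
    · obtain ⟨c, h2, h3, h4⟩ := ih h1
      exact ⟨c, h2, by omega, h4⟩
    · exact ⟨b', hb, b'.lt_succ_self, h1, h'⟩

/-- A node that waits for an equivalence quorum receives a new value in each interval of
length `2D`. -/
lemma Execution.exists_new (he : Execution f out ack D e) (hD : 0 < D) {c t r : ℕ} {p : Fin n}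
    {a : Command U Q} {ph : ℕ} (hct : c ≤ t) (hp : p ∉ (e t).crashed)
    (ha : ∀ c', c ≤ c' → c' < t → ((e c').loc p).phase = .agreeing a ph r) {θ : ℝ}
    (hθ : (e c).now ≤ θ) (ht : θ + 2 * D < (e t).now) :
    ∃ x c', c ≤ c' ∧ c' < t ∧ New e p x c' ∧ x.tag ≤ r ∧ θ < (e c').now ∧
      (e c').now ≤ θ + 2 * D := by
  -- The ticks at `b` and `b'` pass the two ends of the interval. If no value with tag at most `r`
  -- arrives in between, the live nodes are shown to form an equivalence quorum at `b'`, although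
  -- time passes there only because none exists.
  obtain ⟨b, h1, h2, h3, h4, h5⟩ := he.exists_tick hct hθ (by linarith)
  obtain ⟨b', h6, h7, h8, h9, h10⟩ := he.exists_tick h2.le (θ := θ + 2 * D) (by linarith) ht
  by_contra hno
  push Not at hno
  have hlog : ∀ x : Stamped n U, x.tag ≤ r → (Finset.univ, .value x) ∈ (e b').log p →
      (Finset.univ, .value x) ∈ (e b).log p := by
    intro x hx hx'
    by_contra hx''
    obtain ⟨c', h11, h12, h13⟩ := Execution.exists_new_step h6 hx'' hx'
    have h14 : b ≠ c' := by
      rintro rfl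
      refine h13.1 ?_
      have := h13.2
      rwa [h5.eq] at this
    have h15 := he.now_mono (show b + 1 ≤ c' by omega)
    have h16 := he.now_mono h12.le
    have := hno x c' (by omega) (by omega) h13 hx (by linarith)
    linarith
  have hq := h10.quiet p fun h => hp (he.crashed_mono h7.le h)
  rw [Quiet, ha b' (by omega) h7] at hq
  refine hq ⟨((e b').crashed)ᶜ, he.quorum_of_alive b' _ fun k hk => Finset.mem_compl.mpr hk,
    fun k hk => ?_⟩
  rw [Finset.mem_compl, ← h10.crashed] at hk
  by_cases hkp : k = p
  · rw [hkp]
  · have hp' : p ∉ (e (b' + 1)).crashed := fun h => hp (he.crashed_mono h7 h)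
    ext x
    simp only [mem_upTo]
    refine and_congr_left fun hx => ⟨fun h => ?_, fun h => ?_⟩
    · exact he.mem_V_of_got b' x ((he.mem_V_of_ne b' hkp x).mp h)
    · rw [he.mem_V_self] at h
      -- A value that `p` had logged by time `θ` reaches `k` by `θ + D`, and what `k` has logged by
      -- then reaches `p` within another `D`.
      obtain ⟨b₁, h11, h12, h13, h14⟩ := he.exists_got hD (h6.trans b'.le_succ)
        (he.mem_sent (fun h => hp (he.crashed_mono (h2.le.trans' le_rfl) h)) (hlog x hx h)
          (Finset.mem_univ k)) hk (θ := θ + D) (by linarith) (by linarith)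
      have h15 := (he.mem_V_self b₁ k x).mp (he.mem_V_of_got b₁ x h14)
      have h16 := he.mem_got hD h12.le (he.mem_sent (fun h => hk (he.crashed_mono h12.le h)) h15
        (Finset.mem_univ p)) hp' (by linarith)
      rw [h10.got] at h16
      exact (he.mem_V_of_ne b' hkp x).mpr h16

/-- A node that passes a new value on without crashing reaches all others within time `D`. -/
lemma Execution.crashed_of_new (he : Execution f out ack D e) (hD : 0 < D) {p q : Fin n}
    {x : Stamped n U} {c c' : ℕ} (h : New e p x c) (h' : New e q x c') (hcc : c' < c)
    (hnow : (e c').now + D < (e c).now) : q ∉ (e c').crashed ∧ q ∈ (e (c' + 1)).crashed := by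
  obtain ⟨inp, l, l', dead, s', h1, -⟩ := he.act_of_new h'
  refine ⟨h1.alive, ?_⟩
  by_contra h2
  obtain ⟨inp₂, l₂, l₂', dead₂, s₂, h3, -⟩ := he.act_of_new h
  -- Had `q` survived the step, its broadcast would have brought the value to `p` before time `c`.
  have h4 := he.mem_got hD (s := c' + 1) hcc (he.mem_sent h2 h'.2 (Finset.mem_univ p)) h3.alive
    (by rw [h1.now]; exact hnow)
  exact h.1 ((he.mem_V_self c p x).mp (he.mem_V_of_got c x h4))

lemma Execution.crash_unique (he : Execution f out ack D e) {q : Fin n} {c c' : ℕ}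
    (h : q ∉ (e c).crashed ∧ q ∈ (e (c + 1)).crashed)
    (h' : q ∉ (e c').crashed ∧ q ∈ (e (c' + 1)).crashed) : c = c' := by
  rcases lt_trichotomy c c' with h1 | h1 | h1
  · exact absurd (he.crashed_mono h1 h.2) h'.1
  · exact h1
  · exact absurd (he.crashed_mono h1 h'.2) h.1

lemma sum_two_mul_sub_one (M : ℕ) : ∑ m ∈ Finset.range (M + 1), (2 * m - 1) = M ^ 2 := by
  induction M with
  | zero => rfl
  | succ M ih =>
    rw [Finset.sum_range_succ, ih, Nat.mul_add, Nat.add_sub_assoc (by norm_num)]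
    ring

/-- Each of the new values that arrive late has caused many crashes. -/
lemma Execution.sq_le_card (he : Execution f out ack D e) (hf : 2 * f < n) (hD : 0 < D)
    {c t r : ℕ} {p : Fin n} {a : Command U Q} {ph : ℕ} (hct : c ≤ t) (hp : p ∉ (e t).crashed)
    (ha : ∀ c', c ≤ c' → c' < t → ((e c').loc p).phase = .agreeing a ph r) (M : ℕ)
    (ht : (e c).now + 2 * D + 2 * D * (M + 1) < (e t).now) : M ^ 2 ≤ (e t).crashed.card := by
  have hseen : Seen f e r c := by
    have h1 : c < t := by
      by_contra h
      have := he.now_mono (not_lt.mp h)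
      have : 0 ≤ 2 * D * ((M : ℝ) + 1) := by positivity
      linarith
    exact he.seen_of_agreeing c p a ph r (ha c le_rfl h1)
  have h1 : ∀ m ∈ Finset.range (M + 1), ∃ x c', c ≤ c' ∧ c' < t ∧ New e p x c' ∧ x.tag ≤ r ∧
      (e c).now + 2 * D + 2 * D * m < (e c').now ∧
      (e c').now ≤ (e c).now + 2 * D + 2 * D * m + 2 * D := by
    intro m hm
    have h2 : (m : ℝ) + 1 ≤ M + 1 := by exact_mod_cast Finset.mem_range.mp hm
    have h3 : 2 * D * ((m : ℝ) + 1) ≤ 2 * D * (M + 1) := by gcongr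
    have h4 : 0 ≤ 2 * D * (m : ℝ) := by positivity
    exact he.exists_new hD hct hp ha (by linarith) (by linarith)
  -- The value of interval `m` is new at some node in each of the first `2 * m - 1` intervals of
  -- length `D`. All of these end more than `D` before the value reaches `p`, so the node must have
  -- crashed in passing it on. Truncated subtraction charges nothing to `m = 0`.
  have h2 : ∀ i ∈ (Finset.range (M + 1)).sigma fun m => Finset.range (2 * m - 1),
      ∃ q c' b, (∃ x, New e p x c' ∧ New e q x b) ∧
        (e c).now + 2 * D + 2 * D * i.1 < (e c').now ∧
        (e c').now ≤ (e c).now + 2 * D + 2 * D * i.1 + 2 * D ∧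
        (e c).now + 2 * D + D * i.2 < (e b).now ∧
        (e b).now ≤ (e c).now + 2 * D + D * i.2 + D ∧
        q ∉ (e b).crashed ∧ q ∈ (e (b + 1)).crashed ∧ b < t := by
    rintro ⟨m, k⟩ hi
    rw [Finset.mem_sigma, Finset.mem_range, Finset.mem_range] at hi
    obtain ⟨x, c', h3, h4, h5, h6, h7, h8⟩ := h1 m (Finset.mem_range.mpr hi.1)
    have h9 : (k : ℝ) + 2 ≤ 2 * m := by
      have : k + 2 ≤ 2 * m := by have : k < 2 * m - 1 := hi.2; omega
      exact_mod_cast this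
    have h10 : D * ((k : ℝ) + 2) ≤ D * (2 * m) := by gcongr
    have h11 : 0 ≤ D * (k : ℝ) := by positivity
    obtain ⟨q, b, h12, h13, h14, h15⟩ := he.exists_new_between hf hD
      (θ := (e c).now + 2 * D + D * k) (fun i s w hw => by
        have := he.written_le hf hD hseen h6 hw
        linarith) c' p h5 (by linarith)
    obtain ⟨h16, h17⟩ := he.crashed_of_new hD h5 h13 h12 (by linarith)
    exact ⟨q, c', b, ⟨x, h5, h13⟩, h7, h8, h14, h15, h16, h17, by omega⟩
  have : Nonempty (Fin n) := ⟨p⟩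
  choose! q c' b h5 h6 h7 h8 h9 h10 h11 h12 using h2
  have h13 : ((Finset.range (M + 1)).sigma fun m => Finset.range (2 * m - 1)).card ≤
      (e t).crashed.card := by
    refine Finset.card_le_card_of_injOn q (fun i hi => he.crashed_mono (h12 i hi) (h11 i hi))
      fun i hi i' hi' hq => ?_
    -- A node crashes once, its last step takes in one value, and that value is new at `p` only
    -- once. Both coordinates of the index are then recovered, as the half-open intervals are
    -- disjoint.
    have h14 : b i = b i' := he.crash_unique ⟨h10 i hi, h11 i hi⟩
      (by rw [hq]; exact ⟨h10 i' hi', h11 i' hi'⟩)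
    have h16 : c' i = c' i' := by
      obtain ⟨x, h17, h19⟩ := h5 i hi
      obtain ⟨x', h18, h20⟩ := h5 i' hi'
      rw [← hq, ← h14] at h20
      obtain rfl := he.new_unique h19 h20
      rcases lt_trichotomy (c' i) (c' i') with h | h | h
      · exact absurd ((he.log_mono h p).subset h17.2) h18.1
      · exact h
      · exact absurd ((he.log_mono h p).subset h18.2) h17.1
    have key : ∀ {δ y z : ℝ} {u v : ℕ}, 0 < δ → y + δ * u < z → z ≤ y + δ * v + δ → u ≤ v := by
      intro δ y z u v hδ h h'
      have h17 : δ * (u : ℝ) < δ * (v + 1) := by linarith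
      have h18 := lt_of_mul_lt_mul_left h17 hδ.le
      exact Nat.lt_succ_iff.mp (by exact_mod_cast h18)
    have hD2 : 0 < 2 * D := by linarith
    have h19 : i.1 = i'.1 := le_antisymm
      (key hD2 (h6 i hi) (by rw [h16]; exact h7 i' hi'))
      (key hD2 (h6 i' hi') (by rw [← h16]; exact h7 i hi))
    have h20 : i.2 = i'.2 := le_antisymm
      (key hD (h8 i hi) (by rw [h14]; exact h9 i' hi'))
      (key hD (h8 i' hi') (by rw [← h14]; exact h9 i hi))
    exact Sigma.ext h19 (heq_of_eq h20)
  rw [Finset.card_sigma] at h13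
  simp only [Finset.card_range] at h13
  rwa [sum_two_mul_sub_one] at h13

end Waiting


/-! ### The duration of an operation -/

section Termination

variable {n : ℕ} {U Q B : Type*} {f : ℕ} {out : Q → Finset (Stamped n U) → B} {ack : B}
  {D : ℝ} {e : ℕ → Sys n U Q B}

/-- How long a node waits for an equivalence quorum when `k` nodes crash. -/
noncomputable def waitBound (D : ℝ) (k : ℕ) : ℝ := 2 * D + 2 * D * (√(k : ℝ) + 2)

lemma waitBound_nonneg (hD : 0 < D) (k : ℕ) : 0 ≤ waitBound D k := by
  unfold waitBound
  positivity

/-- `sq_le_card` is applied with `M = ⌊√k⌋ + 1`, the least number whose square exceeds `k`. -/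
lemma Execution.now_le_of_agreeing (he : Execution f out ack D e) (hf : 2 * f < n) (hD : 0 < D)
    {c t r : ℕ} {p : Fin n} {a : Command U Q} {ph : ℕ} (hct : c ≤ t) (hp : p ∉ (e t).crashed)
    (ha : ∀ c', c ≤ c' → c' < t → ((e c').loc p).phase = .agreeing a ph r) {k : ℕ}
    (hk : (e t).crashed.card ≤ k) : (e t).now ≤ (e c).now + waitBound D k := by
  by_contra h
  have h1 : ((Nat.sqrt k : ℕ) : ℝ) ≤ √(k : ℝ) := Real.nat_sqrt_le_real_sqrt
  have h2 : 2 * D * (((Nat.sqrt k + 1 : ℕ) : ℝ) + 1) ≤ 2 * D * (√(k : ℝ) + 2) := by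
    push_cast
    gcongr 2 * D * ?_
    linarith
  rw [waitBound] at h
  have h3 := he.sq_le_card hf hD hct hp ha (Nat.sqrt k + 1) (by linarith)
  have h4 := Nat.lt_succ_sqrt' k
  rw [Nat.succ_eq_add_one] at h4
  omega

/-- How long an operation has been in progress in the phases of the client thread. -/
def Timely (D A : ℝ) (e : ℕ → Sys n U Q B) (t : ℕ) (p : Fin n) : Phase (Command U Q) → Prop
  | .idle => True
  | .reading _ => True
  | .writing _ ph r => ∃ t₀ w, (e t).pending p = some t₀ ∧ ph ≤ 3 ∧ w < t ∧
      (Finset.univ, .writeTag ((e t).loc p).req r) ∈ (e (w + 1)).log p ∧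
      -- The reading takes `2 * D`, and each of the `ph` possible earlier lattice operations takes
      -- `2 * D` for its tag and `A` for its quorum.
      (e (w + 1)).now ≤ t₀ + 2 * D + ph * (2 * D + A) ∧ (e t).now ≤ (e (w + 1)).now + 2 * D
  | .agreeing a ph r => ∃ t₀ c, (e t).pending p = some t₀ ∧ ph ≤ 3 ∧ c ≤ t ∧
      (∀ c', c ≤ c' → c' ≤ t → ((e c').loc p).phase = .agreeing a ph r) ∧
      (e c).now ≤ t₀ + 4 * D + ph * (2 * D + A) ∧ (e t).now ≤ (e c).now + A
  | .borrowing _ r => ∃ t₀ c, (e t).pending p = some t₀ ∧ c ≤ t ∧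
      -- This is the reading together with four lattice operations, `2 * D + 4 * (2 * D + A)`.
      (e c).now ≤ t₀ + 10 * D + 4 * A ∧ (∃ q, .goodLA r ∈ (e c).sent q p) ∧
      (e t).now ≤ (e c).now + D

lemma Timely.mono {A : ℝ} {t : ℕ} {p : Fin n} {π : Phase (Command U Q)}
    (h : Timely D A e t p π) (hp : (e (t + 1)).pending p = (e t).pending p)
    (hr : ((e (t + 1)).loc p).req = ((e t).loc p).req)
    (hπ : ((e (t + 1)).loc p).phase = π) (hn : (e (t + 1)).now = (e t).now) :
    Timely D A e (t + 1) p π := by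
  cases π with
  | idle => trivial
  | reading => trivial
  | writing a ph r =>
    obtain ⟨t₀, w, h1, h2, h3, h4, h5, h6⟩ := h
    exact ⟨t₀, w, hp ▸ h1, h2, by omega, hr ▸ h4, h5, hn ▸ h6⟩
  | agreeing a ph r =>
    obtain ⟨t₀, c, h1, h2, h3, h4, h5, h6⟩ := h
    refine ⟨t₀, c, hp ▸ h1, h2, by omega, fun c' h7 h8 => ?_, h5, hn ▸ h6⟩
    rcases h8.lt_or_eq with h8 | rfl
    · exact h4 c' h7 (by omega)
    · exact hπ
  | borrowing a r =>
    obtain ⟨t₀, c, h1, h2, h3, h4, h5⟩ := h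
    exact ⟨t₀, c, hp ▸ h1, by omega, h3, h4, hn ▸ h5⟩

/-- Time passes only while the client thread is stuck, so a tick beyond the bound of a phase would
contradict the arrival of what the phase waits for. -/
lemma Timely.tick (he : Execution f out ack D e) (hf : 2 * f < n) (hD : 0 < D) {t k : ℕ}
    {p : Fin n} (hp : p ∉ (e t).crashed) (h1 : Ticks f D (e t) (e (t + 1)))
    (hk : (e (t + 1)).crashed.card ≤ k)
    (h : Timely D (waitBound D k) e t p ((e t).loc p).phase) :
    Timely D (waitBound D k) e (t + 1) p ((e t).loc p).phase := by
  have hpend : (e (t + 1)).pending p = (e t).pending p := by rw [h1.eq]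
  have hq := h1.quiet p hp
  rw [Quiet] at hq
  have hp' : p ∉ (e (t + 1)).crashed := by rwa [h1.crashed]
  rcases hπ : ((e t).loc p).phase with _ | a | ⟨a, ph, r⟩ | ⟨a, ph, r⟩ | ⟨a, r⟩
  · trivial
  · trivial
  · rw [hπ] at h hq
    obtain ⟨t₀, w, h2, h3, h4, h5, h6, h7⟩ := h
    refine ⟨t₀, w, hpend ▸ h2, h3, by omega, by rwa [h1.loc], h6, ?_⟩
    by_contra h8
    exact absurd (he.not_ticks_of_request hD h4 hp h1 (Or.inr ⟨r, h5⟩) (not_le.mp h8))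
      (not_le.mpr hq)
  · rw [hπ] at h
    obtain ⟨t₀, c, h2, h3, h4, h5, h6, h7⟩ := h
    refine ⟨t₀, c, hpend ▸ h2, h3, by omega, fun c' h8 h9 => ?_, h6,
      he.now_le_of_agreeing hf hD (by omega) hp' (fun c' h8 h9 => h5 c' h8 (by omega)) hk⟩
    rcases h9.lt_or_eq with h9 | rfl
    · exact h5 c' h8 (by omega)
    · rw [h1.loc, hπ]
  · rw [hπ] at h hq
    obtain ⟨t₀, c, h2, h3, h4, ⟨q, h5⟩, h6⟩ := h
    refine ⟨t₀, c, hpend ▸ h2, by omega, h4, ⟨q, h5⟩, ?_⟩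
    by_contra h8
    have h9 := he.mem_got hD (by omega) h5 hp' (not_le.mp h8)
    rw [h1.got, ← he.mem_good] at h9
    exact hq q h9

lemma Timely.act (he : Execution f out ack D e) (hf : 2 * f < n) (hD : 0 < D) {t : ℕ} {A : ℝ}
    (hA : 0 ≤ A) {p : Fin n} {inp : Input n U Q B} {l l' : List (Finset (Fin n) × Msg n U)}
    {dead : Bool} {s' : AsoState n U (Command U Q)}
    (h1 : Acts f out ack (e t) (e (t + 1)) p inp l l' dead s')
    (h : Timely D A e t p ((e t).loc p).phase) : Timely D A e (t + 1) p s'.phase := by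
  have hl := h1.loc_self
  have hlog := h1.log_self
  have hn := h1.now
  have hpend := h1.pending_eq p
  have hph := (he.opInv hf t).phase p h1.alive
  have hm := h1.micro
  cases hm with
  | start => trivial
  | deliver _ q m =>
    rw [handle_phase]
    exact h.mono (hpend (by simp)) (by rw [hl]; exact h1.micro.receive_phase.2)
      (by rw [hl, handle_phase]) hn
  | readUpdate _ u h3 h4 =>
    rw [h3] at hph
    obtain ⟨s, h5, -⟩ := hph
    have h6 := he.now_le_of_reading hf hD t p h1.alive h3 h5.pending
    refine ⟨_, t, (hpend (by simp)).trans h5.pending, by simp, t.lt_succ_self, ?_, ?_, by linarith⟩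
    · rw [hlog, hl]; simp [enter, addOwn]
    · push_cast; linarith
  | readQuery _ a h3 h4 =>
    rw [h3] at hph
    obtain ⟨s, h5, -⟩ := hph
    have h6 := he.now_le_of_reading hf hD t p h1.alive h3 h5.pending
    refine ⟨_, t, (hpend (by simp)).trans h5.pending, by simp, t.lt_succ_self, ?_, ?_, by linarith⟩
    · rw [hlog, hl]; simp [enter]
    · push_cast; linarith
  | written _ a ph r h3 h4 =>
    rw [h3] at h
    obtain ⟨t₀, w, h5, h6, h7, h8, h9, h10⟩ := h
    refine ⟨t₀, t + 1, (hpend (by simp)).trans h5, h6, le_rfl, fun c' h11 h12 => ?_, by linarith,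
      by linarith⟩
    obtain rfl := le_antisymm h11 h12
    rw [hl]
  | goodFirst _ a r h3 h4 h5 =>
    rw [h3] at h
    obtain ⟨t₀, c, h6, h7, h8, h9, h10, h11⟩ := h
    refine ⟨t₀, t, (hpend (by simp)).trans h6, by simp, t.lt_succ_self, ?_, ?_, by linarith⟩
    · rw [hlog, hl]; simp [enter]
    · push_cast at h10 ⊢
      linarith
  | good => trivial
  | retry _ a ph r h3 h4 h5 h6 =>
    rw [h3] at h
    obtain ⟨t₀, c, h7, h8, h9, h10, h11, h12⟩ := h
    refine ⟨t₀, t, (hpend (by simp)).trans h7, by omega, t.lt_succ_self, ?_, ?_, by linarith⟩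
    · rw [hlog, hl]; simp [enter]
    · push_cast
      linarith
  | borrow _ a r h3 h4 h5 =>
    rw [h3] at h
    obtain ⟨t₀, c, h7, h8, h9, h10, h11, h12⟩ := h
    -- The operation failed because a tag larger than `r` is in use, so a good lattice operation
    -- with tag `r` has already been announced and only its delivery is awaited.
    obtain ⟨q, h13⟩ := he.goodLA_sent t ((e t).loc p).maxTag
      (Or.inl ⟨p, h1.alive, Or.inl rfl⟩) r h5
    refine ⟨t₀, t, (hpend (by simp)).trans h7, t.le_succ, ?_, ⟨q, h13 p⟩, by linarith⟩
    push_cast at h11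
    linarith
  | borrowed => trivial
  | skip => exact h.mono (hpend (by simp)) (by rw [hl]) (by rw [hl]) hn

lemma Execution.timely (he : Execution f out ack D e) (hf : 2 * f < n) (hD : 0 < D) {k t : ℕ}
    (hk : (e t).crashed.card ≤ k) (p : Fin n) (hp : p ∉ (e t).crashed) :
    Timely D (waitBound D k) e t p ((e t).loc p).phase := by
  induction t with
  | zero => rw [he.loc_zero]; trivial
  | succ t ih =>
    have hc := he.crashed_mono t.le_succ
    have hp' : p ∉ (e t).crashed := fun h => hp (hc h)
    have ih := ih ((Finset.card_le_card hc).trans hk) hp'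
    rcases he.cases t with h | h | ⟨q, inp, l, l', dead, s', h⟩
    · have h1 := ih.mono (by rw [h]) (by rw [h]) (by rw [h]) (by rw [h])
      rwa [h]
    · rw [h.loc]
      exact ih.tick he hf hD hp' h hk
    · by_cases hq : p = q
      · subst hq
        rw [h.loc_self]
        exact ih.act he hf hD (waitBound_nonneg hD k) h
      · have h1 := ih.mono (h.pending_eq p fun h => absurd h hq) (by rw [h.loc_ne hq])
          (by rw [h.loc_ne hq]) h.now
        rwa [h.loc_ne hq]

/-- The time that an operation takes. -/
theorem Execution.now_le_of_pending (he : Execution f out ack D e) (hf : 2 * f < n) (hD : 0 < D)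
    (t : ℕ) (p : Fin n) (hp : p ∉ (e t).crashed) {t₀ : ℝ} (ht : (e t).pending p = some t₀) :
    (e t).now ≤ t₀ + 35 * (√((e t).crashed.card : ℝ) + 1) * D := by
  have h := he.timely hf hD le_rfl p hp
  have hA := waitBound_nonneg hD (e t).crashed.card
  have h1 : 11 * D + 4 * waitBound D (e t).crashed.card ≤
      35 * (√((e t).crashed.card : ℝ) + 1) * D := by
    have : 0 ≤ √((e t).crashed.card : ℝ) * D := by positivity
    rw [waitBound]
    linarith
  have h2 := he.phase_ne_idle t p hp (by rw [ht]; simp)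
  generalize waitBound D (e t).crashed.card = A at h hA h1
  rcases hπ : ((e t).loc p).phase with _ | a | ⟨a, ph, r⟩ | ⟨a, ph, r⟩ | ⟨a, r⟩
  · exact absurd hπ h2
  · have := he.now_le_of_reading hf hD t p hp hπ ht
    linarith
  · rw [hπ] at h
    obtain ⟨t₀', w, h3, h4, -, -, h5, h6⟩ := h
    rw [ht] at h3
    obtain rfl := (Option.some.injEq _ _).mp h3
    have h7 : (ph : ℝ) * (2 * D + A) ≤ 3 * (2 * D + A) := by
      have : (ph : ℝ) ≤ 3 := by exact_mod_cast h4
      gcongr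
    linarith
  · rw [hπ] at h
    obtain ⟨t₀', w, h3, h4, -, -, h5, h6⟩ := h
    rw [ht] at h3
    obtain rfl := (Option.some.injEq _ _).mp h3
    have h7 : (ph : ℝ) * (2 * D + A) ≤ 3 * (2 * D + A) := by
      have : (ph : ℝ) ≤ 3 := by exact_mod_cast h4
      gcongr
    linarith
  · rw [hπ] at h
    obtain ⟨t₀', w, h3, -, h5, -, h6⟩ := h
    rw [ht] at h3
    obtain rfl := (Option.some.injEq _ _).mp h3
    linarith

end Termination


/-! ### The numbers in messages -/

section MessageSize

variable {n : ℕ} {U Q B : Type*} {f : ℕ} {out : Q → Finset (Stamped n U) → B} {ack : B}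
  {D : ℝ} {e : ℕ → Sys n U Q B}

lemma Execution.invocations_mono (he : Execution f out ack D e) {t t' : ℕ} (h : t ≤ t') :
    (e t).invocations ≤ (e t').invocations :=
  ((he.history_mono h).sublist.filterMap _).length_le

lemma Acts.invocations_invoke {g g' : Sys n U Q B} {p : Fin n} {a : Command U Q}
    {l l' : List (Finset (Fin n) × Msg n U)} {dead : Bool} {s' : AsoState n U (Command U Q)}
    (h : Acts f out ack g g' p (.invoke a) l l' dead s') :
    g'.invocations = g.invocations + 1 := by
  rw [Config.invocations, h.history]
  simp [Input.event, Event.input, Config.invocations]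

/-- The number of requests that an operation can still make. -/
def requestsLeft : Phase (Command U Q) → ℕ
  | .idle => 0
  | .reading _ => 4
  | .writing _ ph _ => 3 - ph
  | .agreeing _ ph _ => 3 - ph
  | .borrowing _ _ => 0

/-- Each invocation pays for five requests in advance: one to read a tag and at most four to write
one, in the phases `0` to `3`. -/
lemma Execution.req_add_le (he : Execution f out ack D e) (hf : 2 * f < n) (t : ℕ) (p : Fin n) :
    ((e t).loc p).req + requestsLeft ((e t).loc p).phase ≤ 5 * (e t).invocations := by
  induction t with
  | zero => rw [he.loc_zero]; simp [blank, requestsLeft]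
  | succ t ih =>
    have hi : (e t).invocations ≤ (e (t + 1)).invocations := he.invocations_mono t.le_succ
    rcases he.node_cases t p with ⟨h, -, -⟩ | ⟨inp, l, l', dead, s', h⟩
    · rw [h]; omega
    · rw [h.loc_self]
      have hm := h.micro
      have hph := (he.opInv hf t).phase p h.alive
      cases hm with
      | start =>
        rw [h.invocations_invoke]
        simp only [requestsLeft]
        omega
      | deliver =>
        rw [handle_phase, h.micro.receive_phase.2]
        omega
      | retry _ a ph r h3 h4 h5 h6 =>
        rw [h3] at ih hph
        obtain ⟨s, ρ, w, -, h7, -⟩ := hph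
        have := h7.le
        simp only [requestsLeft, enter] at ih ⊢
        omega
      | skip => omega
      | good _ a ph r h3 => simp only [requestsLeft]; omega
      | borrowed _ a r j h3 => simp only [requestsLeft]; omega
      | readUpdate _ u h3 =>
        rw [h3] at ih; simp only [requestsLeft, enter, addOwn] at ih ⊢; omega
      | readQuery _ u h3 => rw [h3] at ih; simp only [requestsLeft, enter] at ih ⊢; omega
      | written _ a ph r h3 => rw [h3] at ih; simp only [requestsLeft] at ih ⊢; omega
      | goodFirst _ a r h3 => rw [h3] at ih; simp only [requestsLeft, enter] at ih ⊢; omega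
      | borrow _ a r h3 => rw [h3] at ih; simp only [requestsLeft] at ih ⊢; omega

/-- An operation that may still increase the largest tag. -/
def Early : Phase (Command U Q) → Prop
  | .reading _ => True
  | .writing _ ph _ => ph = 0
  | .agreeing _ ph _ => ph = 0
  | _ => False

open Classical in
/-- The nodes that may still increase the largest tag. -/
noncomputable def earlyNodes (g : Sys n U Q B) : Finset (Fin n) :=
  Finset.univ.filter fun p => p ∉ g.crashed ∧ Early (g.loc p).phase

lemma mem_earlyNodes {g : Sys n U Q B} {p : Fin n} :
    p ∈ earlyNodes g ↔ p ∉ g.crashed ∧ Early (g.loc p).phase := by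
  simp [earlyNodes]

lemma Micro.early {p : Fin n} {inp : Input n U Q B} {s s' : AsoState n U (Command U Q)}
    {l : List (Finset (Fin n) × Msg n U)} (h : Micro f out ack p inp s l s')
    (hi : ∀ a, inp ≠ .invoke a) (hs : Early s'.phase) : Early s.phase := by
  cases h with
  | start s a => exact absurd rfl (hi a)
  | deliver => rwa [handle_phase] at hs
  | skip => exact hs
  | readUpdate _ _ h => rw [h]; trivial
  | written _ _ _ _ h => rw [h]; exact hs
  | _ => simp [Early, enter] at hs

lemma Acts.earlyNodes {g g' : Sys n U Q B} {p : Fin n} {inp : Input n U Q B}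
    {l l' : List (Finset (Fin n) × Msg n U)} {dead : Bool} {s' : AsoState n U (Command U Q)}
    (h : Acts f out ack g g' p inp l l' dead s') {q : Fin n} (hq : q ∈ earlyNodes g') :
    q ∈ earlyNodes g ∨ (q = p ∧ ∃ a, inp = .invoke a) := by
  rw [mem_earlyNodes] at hq ⊢
  have h1 : q ∉ g.crashed := fun h1 => hq.1 (h.crashed_subset h1)
  by_cases hp : q = p
  · subst hp
    by_cases hi : ∃ a, inp = .invoke a
    · exact Or.inr ⟨rfl, hi⟩
    · push Not at hi
      rw [h.loc_self] at hq
      exact Or.inl ⟨h1, h.micro.early hi hq.2⟩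
  · rw [h.loc_ne hp] at hq
    exact Or.inl ⟨h1, hq.2⟩

/-- A potential argument: an invocation pays for at most one additional early node, and the only
step that creates a larger tag is taken by an early node, which ceases to be early. -/
lemma Execution.sysTag_add_le (he : Execution f out ack D e) (t τ : ℕ) (hτ : SysTag (e t) τ) :
    τ + (earlyNodes (e t)).card ≤ (e t).invocations := by
  classical
  induction t generalizing τ with
  | zero =>
    obtain rfl := he.sysTag_zero hτ
    have h1 : earlyNodes (e 0) = ∅ := by
      rw [earlyNodes, Finset.filter_eq_empty_iff]
      intro p _
      rw [he.loc_zero]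
      simp [blank, Early]
    simp [h1]
  | succ t ih =>
    rcases he.cases t with h | h | ⟨p, inp, l, l', dead, s', h⟩
    · rw [h] at hτ ⊢; exact ih τ hτ
    · have h1 := ih τ ((sysTag_tick h).mp hτ)
      rw [h.eq]
      exact h1
    · have h1 : (earlyNodes (e (t + 1))).card + (e t).invocations ≤
          (earlyNodes (e t)).card + (e (t + 1)).invocations := by
        by_cases hi : ∃ a, inp = .invoke a
        · obtain ⟨a, rfl⟩ := hi
          have h2 : earlyNodes (e (t + 1)) ⊆ insert p (earlyNodes (e t)) := fun q hq =>
            Finset.mem_insert.mpr ((h.earlyNodes hq).elim Or.inr fun h => Or.inl h.1)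
          have h3 := (Finset.card_le_card h2).trans (Finset.card_insert_le _ _)
          rw [h.invocations_invoke]
          omega
        · have h2 : earlyNodes (e (t + 1)) ⊆ earlyNodes (e t) := fun q hq =>
            (h.earlyNodes hq).elim id fun h => absurd h.2 hi
          have h3 := Finset.card_le_card h2
          have : (e t).invocations ≤ (e (t + 1)).invocations := he.invocations_mono t.le_succ
          omega
      rcases h.sysTag hτ with h2 | rfl | ⟨a, r, h2, rfl, -, h3⟩
      · have := ih τ h2
        omega
      -- For the tag `0` the induction hypothesis is applied to the `maxTag` of the acting node,
      -- merely to bound the number of early nodes.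
      · have := ih _ (Or.inl ⟨p, h.alive, Or.inl rfl⟩)
        omega
      · have h4 := ih r (Or.inl ⟨p, h.alive, Or.inr (Or.inr ⟨a, 0, Or.inr h2⟩)⟩)
        have h5 : p ∈ earlyNodes (e t) := by
          rw [mem_earlyNodes, h2]
          exact ⟨h.alive, rfl⟩
        have h6 : earlyNodes (e (t + 1)) ⊆ (earlyNodes (e t)).erase p := fun q hq => by
          have hqp : q ≠ p := by
            rintro rfl
            rw [mem_earlyNodes] at hq
            rcases h3 with h3 | h3
            · exact hq.1 h3
            · rw [h3] at hq
              simp [Early] at hq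
          exact Finset.mem_erase.mpr ⟨hqp, (h.earlyNodes hq).elim id fun h => absurd h.1 hqp⟩
        have h7 := Finset.card_le_card h6
        rw [Finset.card_erase_of_mem h5] at h7
        have h8 := Finset.card_pos.mpr ⟨p, h5⟩
        have : (e t).invocations ≤ (e (t + 1)).invocations := he.invocations_mono t.le_succ
        omega

/-- The numbers in messages. -/
lemma Execution.numbers_le (he : Execution f out ack D e) (hf : 2 * f < n) (t : ℕ) (q : Fin n)
    (d : Finset (Fin n)) (m : Msg n U) (hm : (d, m) ∈ (e t).log q) (y : ℕ) (hy : y ∈ m.numbers) :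
    y ≤ 5 * (n + (e t).invocations) := by
  induction t generalizing q d m y with
  | zero => rw [he.log_zero] at hm; cases hm
  | succ t ih =>
    have hi : (e t).invocations ≤ (e (t + 1)).invocations := he.invocations_mono t.le_succ
    rcases he.node_cases t q with ⟨-, h, -⟩ | ⟨inp, l, l', dead, s', h⟩
    · have := ih q d m (h ▸ hm) y hy
      omega
    · rw [h.log_self, List.mem_append] at hm
      rcases hm with hm | hm
      · have := ih q d m hm y hy
        omega
      · have hn : 0 < n := by omega
        have hq := q.isLt
        have hreq := he.req_add_le hf (t + 1) q
        rw [h.loc_self] at hreq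
        have hstate : ∀ τ, StateTag ((e t).loc q) τ → τ + (earlyNodes (e t)).card ≤
            (e t).invocations := fun τ hτ => he.sysTag_add_le t τ (Or.inl ⟨q, h.alive, hτ⟩)
        have hack := hstate ((e t).loc q).ackTag (Or.inr (Or.inl rfl))
        have hmax := hstate ((e t).loc q).maxTag (Or.inl rfl)
        have hmicro := h.micro
        cases hmicro with
        | start =>
          simp only [List.mem_singleton, Prod.mk.injEq] at hm
          obtain ⟨-, rfl⟩ := hm
          simp only [Msg.numbers, List.mem_singleton] at hy
          simp only [requestsLeft] at hreq
          omega
        | deliver _ j m' =>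
          obtain ⟨σ, hσ⟩ := h.mem_chan_of_receive
          obtain ⟨d', hd', -⟩ := he.exists_log_of_chan hσ
          -- Forwarded values, echoes and acknowledgements repeat numbers of the message received;
          -- the only other number is the `maxTag` in an answer to a `readTag` request.
          have hold := fun z hz => ih j d' m' hd' z hz
          cases m' with
          | value x =>
            simp only [handle] at hm
            split_ifs at hm with hx
            · cases hm
            · simp only [List.mem_singleton, Prod.mk.injEq] at hm
              obtain ⟨-, rfl⟩ := hm
              have := hold y hy
              omega
          | readTag κ =>
            simp only [handle, List.mem_singleton, Prod.mk.injEq] at hm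
            obtain ⟨-, rfl⟩ := hm
            have := hold κ (by simp [Msg.numbers])
            simp only [Msg.numbers, List.mem_cons, List.not_mem_nil, or_false] at hy
            omega
          | writeTag κ τ =>
            have h1 := hold κ (by simp [Msg.numbers])
            have h2 := hold τ (by simp [Msg.numbers])
            simp only [handle, List.mem_cons, Prod.mk.injEq, List.not_mem_nil, or_false] at hm
            rcases hm with ⟨-, rfl⟩ | ⟨-, rfl⟩ <;>
              simp only [Msg.numbers, List.mem_cons, List.not_mem_nil, or_false] at hy <;> omega
          | _ => simp [handle] at hm
        | readUpdate _ u h1 h2 =>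
          simp only [enter, addOwn] at hreq
          simp only [List.mem_cons, Prod.mk.injEq, List.not_mem_nil, or_false] at hm
          rcases hm with ⟨-, rfl⟩ | ⟨-, rfl⟩ <;>
            simp only [Msg.numbers, List.mem_cons, List.not_mem_nil, or_false] at hy <;> omega
        | readQuery _ u h1 h2 =>
          simp only [enter] at hreq
          simp only [List.mem_singleton, Prod.mk.injEq] at hm
          obtain ⟨-, rfl⟩ := hm
          simp only [Msg.numbers, List.mem_cons, List.not_mem_nil, or_false] at hy
          omega
        | goodFirst _ a r h1 h2 h3 =>
          have h4 := hstate r (Or.inr (Or.inr ⟨a, 0, Or.inr h1⟩))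
          simp only [enter] at hreq
          simp only [List.mem_cons, Prod.mk.injEq, List.not_mem_nil, or_false] at hm
          rcases hm with ⟨-, rfl⟩ | ⟨-, rfl⟩ <;>
            simp only [Msg.numbers, List.mem_cons, List.not_mem_nil, or_false] at hy <;> omega
        | good _ a ph r h1 h2 h3 =>
          have h4 := hstate r (Or.inr (Or.inr ⟨a, ph, Or.inr h1⟩))
          simp only [List.mem_singleton, Prod.mk.injEq] at hm
          obtain ⟨-, rfl⟩ := hm
          simp only [Msg.numbers, List.mem_singleton] at hy
          omega
        | retry _ a ph r h1 h2 h3 h4 =>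
          simp only [enter] at hreq
          simp only [List.mem_singleton, Prod.mk.injEq] at hm
          obtain ⟨-, rfl⟩ := hm
          simp only [Msg.numbers, List.mem_cons, List.not_mem_nil, or_false] at hy
          omega
        | _ => cases hm

end MessageSize

end AcAso

theorem mainTheorem6 :
    ∃ (C : ℝ) (b : ℕ), ∀ (n f : ℕ), 2 * f < n →
      ∀ (S U Q R : Type*) (M : UQMachine S U Q R) (D : ℝ), 0 < D →
      ∀ c : Config n (Command U Q) (Reply R) (Msg n U) (AsoState n U (Command U Q)),
        Reachable (uqProtocol n f M) f D c →
        -- the history is linearizable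
        Linearizable M.object c.history ∧
        -- no command of a node that has not crashed is pending for longer than `O(√k)` delays
        (∀ (p : Fin n) (t : ℝ), p ∉ c.crashed → c.pending p = some t →
          c.now ≤ t + C * (Real.sqrt (c.crashed.card : ℝ) + 1) * D) ∧
        -- a message consists of at most one command and `O(1)` numbers
        (∀ (q p : Fin n), ∀ x ∈ c.chan q p,
          x.2.commands.length ≤ 1 ∧ x.2.numbers.length ≤ b ∧
            ∀ y ∈ x.2.numbers, y ≤ b * (n + c.invocations)) := by
  -- The constant `35` comes from `now_le_of_pending`. The constant `5` is the number of requests of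
  -- an operation, which dominates the bounds for tags and node names and the count of at most two
  -- numbers per message.
  refine ⟨35, 5, fun n f hf S U Q R M D hD c hc => ?_⟩
  obtain ⟨e, N, he, ⟨loc', hN, -⟩, -⟩ := AcAso.exists_execution_of_reachable (by omega) c hc
  have h1 : c.history = (e N).history := by rw [hN]
  have h2 : c.crashed = (e N).crashed := by rw [hN]
  have h3 : c.pending = (e N).pending := by rw [hN]
  have h4 : c.now = (e N).now := by rw [hN]
  have h5 : c.chan = (e N).chan := by rw [hN]
  rw [Config.invocations, h1, h2, h3, h4, h5]
  refine ⟨AcAso.Execution.linearizable hf he N, fun p t hp ht =>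
    he.now_le_of_pending hf hD N p hp ht, fun q p x hx => ⟨?_, ?_, fun y hy => ?_⟩⟩
  · cases x.2 <;> simp [Msg.commands]
  · cases x.2 <;> simp [Msg.numbers]
  · obtain ⟨d, h6, -⟩ := he.exists_log_of_chan hx
    exact he.numbers_le hf N q d x.2 h6 y hy
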